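/- Notation. Let $L^2(\mathbb R)=L^2(\mathbb R,\mathbb C)$, let $L^2_+$ be the closed subspace of those $f\in L^2(\mathbb R)$ whose Fourier transform $\hat f$ is supported in $[0,+\infty)$, let $\Pi:L^2(\mathbb R)\to L^2_+$, $\widehat{\Pi f}=\mathbf 1_{[0,+\infty)}\hat f$, be the Szegő projector, and let $H^1_+=L^2_+\cap H^1(\mathbb R)$. For $u\in L^2(\mathbb R,\mathbb R)$ the Lax operator is the unbounded operator $L_u h=-i\partial_x h-\Pi(uh)$ on $L^2_+$ with domain $\mathbf D(L_u)=H^1_+$. For a self-adjoint operator $A$, let $\mu_\psi$ be the spectral measure of $A$ at the vector $\psi$, so that $\langle (A-z)^{-1}\psi,\psi\rangle=\int_{\mathbb R}\frac{d\mu_\psi(t)}{t-z}$ for $z\in\mathbb C\setminus\mathbb R$; then $\mathscr H_{\mathrm{ac}}(A)$, $\mathscr H_{\mathrm{sc}}(A)$, $\mathscr H_{\mathrm{pp}}(A)$ are the sets of those $\psi$ for which $\mu_\psi$ is, respectively, absolutely continuous with respect to Lebesgue measure, singular continuous, pure point. Let $\sigma_{\mathrm{ac}}(A)$ and $\sigma_{\mathrm{sc}}(A)$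 be the spectra of the parts of $A$ in $\mathscr H_{\mathrm{ac}}(A)$ and $\mathscr H_{\mathrm{sc}}(A)$, and $\sigma_{\mathrm{pp}}(A)$ the set of eigenvalues of $A$. For an integer $N\ge 1$ let $\mathcal U_N\subset L^2(\mathbb R,\mathbb R)$ be the set of $N$-solitons $$u(x)=\sum_{j=1}^N c_j\,\mathcal R\bigl(c_j(x-x_j)\bigr),\qquad \mathcal R(x)=\frac{2}{1+x^2},\quad c_j>0,\ x_j\in\mathbb R .$$ Proposition. Let $N\geq 1$ and $u\in\mathcal U_N$. Then: (1) $L_u$ is self-adjoint, and it has exactly $N$ eigenvalues $\lambda_1<\dots<\lambda_N$; they are all negative and simple: $\dim_{\mathbb C}\mathrm{Ker}(L_u-\lambda_j)=1$. (2) There is a unique monic polynomial $Q_u\in\mathbb C[X]$ of degree $N$ (the characteristic polynomial of $u$) with all its roots in $\{\mathrm{Im}\,z<0\}$ and $\Pi u=i\,Q_u'/Q_u$. Put $\Theta_u=\overline{Q}_u/Q_u$, where $\overline Q_u$ has the conjugate coefficients, put $\Theta_uL^2_+=\{\Theta_u h: h\in L^2_+\}$, which is contained in $L^2_+$, let $K_{\Theta_u}$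 be the orthogonal complement of $\Theta_uL^2_+$ in $L^2_+$, and let $\frac{\mathbb C_{\le N-1}[X]}{Q_u}$ be the set of the functions $P/Q_u$ with $P\in\mathbb{C}[X]$ of degree at most $N-1$, which also lie in $L^2_+$. Then $$\mathscr H_{\mathrm{ac}}(L_u)=\Theta_uL^2_+,\qquad \mathscr H_{\mathrm{sc}}(L_u)=\{0\},\qquad \mathscr H_{\mathrm{pp}}(L_u)=K_{\Theta_u}=\frac{\mathbb C_{\le N-1}[X]}{Q_u}.$$ (3) $\sigma_{\mathrm{ac}}(L_u)=[0,+\infty)$, $\sigma_{\mathrm{sc}}(L_u)=\emptyset$ and $\sigma(L_u)=\sigma_{\mathrm{ac}}(L_u)\cup\sigma_{\mathrm{sc}}(L_u)\cup\sigma_{\mathrm{pp}}(L_u)$. -/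

import Mathlib

open MeasureTheory
open scoped FourierTransform SchwartzMap LineDeriv ENNReal

noncomputable section

namespace BenjaminOno

/-! ### The Hardy space and the Szegő projector -/

/-- The complex Hilbert space `L²(ℝ) = L²(ℝ, ℂ)`. -/
abbrev L2 : Type := Lp ℂ 2 (volume : Measure ℝ)

/-- The restriction to `(-∞, 0)` of the Fourier–Plancherel transform. -/
def negFourier : L2 →L[ℂ] Lp ℂ 2 ((volume : Measure ℝ).restrict (Set.Iio 0)) :=
  (LpToLpRestrictCLM ℝ ℂ ℂ (volume : Measure ℝ) 2 (Set.Iio 0)).comp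
    (Lp.fourierTransformₗᵢ ℝ ℂ).toContinuousLinearEquiv.toContinuousLinearMap

/-- The Hardy space `L²₊`: the functions in `L²(ℝ)` whose Fourier transform is supported in
`[0, ∞)`. -/
def hardy : Submodule ℂ L2 where
  carrier := {f | ∀ᵐ ξ : ℝ, ξ < 0 → (𝓕 f : L2) ξ = 0}
  zero_mem' := by
    have h : (𝓕 (0 : L2) : L2) = 0 := (Lp.fourierTransformₗᵢ ℝ ℂ).map_zero
    simp only [Set.mem_ofPred_eq, h]
    filter_upwards [Lp.coeFn_zero ℂ 2 (volume : Measure ℝ)] with ξ h0 _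
    rw [h0, Pi.zero_apply]
  add_mem' := by
    intro f g hf hg
    have h : (𝓕 (f + g) : L2) = 𝓕 f + 𝓕 g := (Lp.fourierTransformₗᵢ ℝ ℂ).map_add f g
    simp only [Set.mem_ofPred_eq] at hf hg ⊢
    rw [h]
    filter_upwards [hf, hg, Lp.coeFn_add (𝓕 f : L2) (𝓕 g)] with ξ h1 h2 h3 hξ
    rw [h3, Pi.add_apply, h1 hξ, h2 hξ, add_zero]
  smul_mem' := by
    intro c f hf
    have h : (𝓕 (c • f) : L2) = c • 𝓕 f := (Lp.fourierTransformₗᵢ ℝ ℂ).map_smul c f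
    simp only [Set.mem_ofPred_eq] at hf ⊢
    rw [h]
    filter_upwards [hf, Lp.coeFn_smul c (𝓕 f : L2)] with ξ h1 h3 hξ
    rw [h3, Pi.smul_apply, h1 hξ, smul_zero]

theorem mem_hardy {f : L2} : f ∈ hardy ↔ ∀ᵐ ξ : ℝ, ξ < 0 → (𝓕 f : L2) ξ = 0 := Iff.rfl

theorem isClosed_hardy : IsClosed (hardy : Set L2) := by
  have h : (hardy : Set L2) = negFourier ⁻¹' {0} := by
    ext f
    have e : (negFourier f : ℝ → ℂ) =ᵐ[volume.restrict (Set.Iio 0)] (𝓕 f : L2) :=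
      LpToLpRestrictCLM_coeFn ℂ (Set.Iio 0) (𝓕 f : L2)
    rw [SetLike.mem_coe, mem_hardy, Set.mem_preimage, Set.mem_singleton_iff,
      Lp.eq_zero_iff_ae_eq_zero]
    change (∀ᵐ ξ : ℝ, ξ ∈ Set.Iio (0 : ℝ) → (𝓕 f : L2) ξ = 0) ↔ _
    rw [← ae_restrict_iff' measurableSet_Iio]
    constructor
    · intro h
      filter_upwards [e, h] with ξ h1 h2
      simp [h1, h2]
    · intro h
      filter_upwards [e, h] with ξ h1 h2
      rw [← h1, h2]
      rfl
  rw [h]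
  exact isClosed_singleton.preimage negFourier.continuous

instance : CompleteSpace hardy := isClosed_hardy.completeSpace_coe

/-- The function `1_{[0,∞)} f` for `f ∈ L²(ℝ)`. -/
def cutoff (f : L2) : L2 := ((Lp.memLp f).indicator (s := Set.Ici (0 : ℝ)) measurableSet_Ici).toLp _

theorem cutoff_coe (f : L2) : cutoff f =ᵐ[volume] (Set.Ici (0 : ℝ)).indicator f :=
  MemLp.coeFn_toLp _

/-- The Szegő projector `Π : L²(ℝ) → L²₊`, the Fourier multiplier with symbol `1_{[0,∞)}`. -/
def szego : L2 →ₗ[ℂ] hardy where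
  toFun f := ⟨𝓕⁻ (cutoff (𝓕 f)), by
    rw [mem_hardy, FourierTransform.fourier_fourierInv_eq]
    filter_upwards [cutoff_coe (𝓕 f)] with ξ h hξ
    rw [h, Set.indicator_of_notMem (by simpa using hξ)]⟩
  map_add' f g := by
    ext1
    have h : (𝓕 (f + g) : L2) = 𝓕 f + 𝓕 g := (Lp.fourierTransformₗᵢ ℝ ℂ).map_add f g
    have h2 : cutoff (𝓕 f + 𝓕 g : L2) = cutoff (𝓕 f) + cutoff (𝓕 g) := by
      apply Lp.ext
      filter_upwards [cutoff_coe (𝓕 f + 𝓕 g : L2), cutoff_coe (𝓕 f), cutoff_coe (𝓕 g),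
        Lp.coeFn_add (cutoff (𝓕 f)) (cutoff (𝓕 g)), Lp.coeFn_add (𝓕 f : L2) (𝓕 g)]
        with ξ h1 h2 h3 h4 h5
      by_cases hx : ξ ∈ Set.Ici (0 : ℝ) <;>
        simp only [h1, h4, Pi.add_apply, h2, h3, Set.indicator_of_mem, Set.indicator_of_notMem, hx, h5,
          not_false_eq_true, add_zero]
    change (𝓕⁻ (cutoff (𝓕 (f + g))) : L2) = 𝓕⁻ (cutoff (𝓕 f)) + 𝓕⁻ (cutoff (𝓕 g))
    rw [h, h2]
    exact (Lp.fourierTransformₗᵢ ℝ ℂ).symm.map_add _ _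
  map_smul' c f := by
    ext1
    have h : (𝓕 (c • f) : L2) = c • 𝓕 f := (Lp.fourierTransformₗᵢ ℝ ℂ).map_smul c f
    have h2 : cutoff (c • 𝓕 f : L2) = c • cutoff (𝓕 f) := by
      apply Lp.ext
      filter_upwards [cutoff_coe (c • 𝓕 f : L2), cutoff_coe (𝓕 f),
        Lp.coeFn_smul c (cutoff (𝓕 f)), Lp.coeFn_smul c (𝓕 f : L2)]
        with ξ h1 h2 h4 h5
      by_cases hx : ξ ∈ Set.Ici (0 : ℝ) <;>
        simp only [h1, h4, Pi.smul_apply, h2, Set.indicator_of_mem, Set.indicator_of_notMem, hx, h5,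
          not_false_eq_true, smul_zero]
    change (𝓕⁻ (cutoff (𝓕 (c • f))) : L2) = c • 𝓕⁻ (cutoff (𝓕 f))
    rw [h, h2]
    exact (Lp.fourierTransformₗᵢ ℝ ℂ).symm.map_smul _ _

/-! ### The Sobolev space `H¹₊` and the operators `D` and `T_u` -/

theorem toDist_zero : ((0 : L2) : 𝓢'(ℝ, ℂ)) = 0 :=
  (Lp.toTemperedDistributionCLM ℂ (volume : Measure ℝ) 2).map_zero

theorem toDist_add (f g : L2) : ((f + g : L2) : 𝓢'(ℝ, ℂ)) = (f : 𝓢'(ℝ, ℂ)) + (g : 𝓢'(ℝ, ℂ)) :=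
  (Lp.toTemperedDistributionCLM ℂ (volume : Measure ℝ) 2).map_add f g

theorem toDist_smul (c : ℂ) (f : L2) : ((c • f : L2) : 𝓢'(ℝ, ℂ)) = c • (f : 𝓢'(ℝ, ℂ)) :=
  (Lp.toTemperedDistributionCLM ℂ (volume : Measure ℝ) 2).map_smul c f

/-- `H¹₊ = L²₊ ∩ H¹(ℝ)`, as a subspace of `L²₊`. -/
def hardySobolev : Submodule ℂ hardy where
  carrier := {f | TemperedDistribution.MemSobolev 1 2 ((f : L2) : 𝓢'(ℝ, ℂ))}
  zero_mem' := by
    simp only [Set.mem_ofPred_eq, Submodule.coe_zero, toDist_zero]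
    exact TemperedDistribution.memSobolev_fun_zero ℝ ℂ 1 2
  add_mem' := by
    intro f g hf hg
    simp only [Set.mem_ofPred_eq, Submodule.coe_add, toDist_add] at hf hg ⊢
    exact hf.add hg
  smul_mem' := by
    intro c f hf
    simp only [Set.mem_ofPred_eq, Submodule.coe_smul, toDist_smul] at hf ⊢
    exact hf.smul c

theorem toTemperedDistribution_injective {p : ℝ≥0∞} [Fact (1 ≤ p)] {f g : Lp ℂ p (volume : Measure ℝ)}
    (h : (f : 𝓢'(ℝ, ℂ)) = (g : 𝓢'(ℝ, ℂ))) : f = g := by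
  have := Lp.ker_toTemperedDistributionCLM_eq_bot (F := ℂ) (μ := (volume : Measure ℝ)) (p := p)
  exact LinearMap.ker_eq_bot.1 this h

theorem memSobolev_exists_deriv {f : L2} (hf : TemperedDistribution.MemSobolev 1 2 (f : 𝓢'(ℝ, ℂ))) :
    ∃ g : L2, (g : 𝓢'(ℝ, ℂ)) = -Complex.I • ∂_{(1 : ℝ)} (f : 𝓢'(ℝ, ℂ)) := by
  have h := hf.lineDerivOp (m := (1 : ℝ))
  rw [sub_self, TemperedDistribution.memSobolev_zero_iff] at h
  obtain ⟨g, hg⟩ := h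
  exact ⟨-Complex.I • g, by rw [toDist_smul, hg]⟩

theorem deriv_mem_hardy {f g : L2} (hf : f ∈ hardy)
    (h : (g : 𝓢'(ℝ, ℂ)) = -Complex.I • ∂_{(1 : ℝ)} (f : 𝓢'(ℝ, ℂ))) :
    g ∈ hardy := by
  have hF : ((𝓕 g : L2) : 𝓢'(ℝ, ℂ)) = (-Complex.I * (2 * Real.pi * Complex.I)) •
      TemperedDistribution.smulLeftCLM ℂ (fun x : ℝ => ((inner ℝ x (1 : ℝ) : ℝ) : ℂ))
        ((𝓕 f : L2) : 𝓢'(ℝ, ℂ)) := by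
    rw [← Lp.fourier_toTemperedDistribution_eq, ← Lp.fourier_toTemperedDistribution_eq, h,
      FourierTransform.fourier_smul, TemperedDistribution.fourier_lineDerivOp_eq, smul_smul]
  rw [mem_hardy] at hf ⊢
  refine isOpen_Iio.ae_eq_zero_of_integral_contDiff_smul_eq_zero (U := Set.Iio (0 : ℝ))
    (((Lp.memLp (𝓕 g : L2)).locallyIntegrable (by norm_num)).locallyIntegrableOn _) ?_
  intro φ hφ hc hs
  have hg₁ : HasCompactSupport (Complex.ofRealCLM ∘ φ) := hc.comp_left rfl
  have hg₂ : ContDiff ℝ ((⊤ : ℕ∞) : WithTop ℕ∞) (Complex.ofRealCLM ∘ φ) :=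
    Complex.ofRealCLM.contDiff.comp hφ
  have e := congrArg (fun T : 𝓢'(ℝ, ℂ) => T (hg₁.toSchwartzMap hg₂)) hF
  have ht : (fun x : ℝ => ((inner ℝ x (1 : ℝ) : ℝ) : ℂ)).HasTemperateGrowth := by fun_prop
  simp only [_root_.smul_apply, TemperedDistribution.smulLeftCLM_apply_apply,
    Lp.toTemperedDistribution_apply] at e
  have e0 : ∫ x : ℝ, (SchwartzMap.smulLeftCLM ℂ (fun x : ℝ => ((inner ℝ x (1 : ℝ) : ℝ) : ℂ))
      (hg₁.toSchwartzMap hg₂)) x • (𝓕 f : L2) x = 0 := by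
    apply integral_eq_zero_of_ae
    filter_upwards [hf] with x hx
    by_cases h0 : x < 0
    · simp [hx h0]
    · have : φ x = 0 := by
        by_contra hne
        exact h0 (hs (subset_tsupport _ hne))
      rw [SchwartzMap.smulLeftCLM_apply_apply ht]
      simp [this]
  rw [e0, smul_zero] at e
  exact e

theorem exists_D (f : hardySobolev) : ∃ g : hardy, ((g : L2) : 𝓢'(ℝ, ℂ)) =
    -Complex.I • ∂_{(1 : ℝ)} (((f : hardy) : L2) : 𝓢'(ℝ, ℂ)) := by
  obtain ⟨g, hg⟩ := memSobolev_exists_deriv f.2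
  exact ⟨⟨g, deriv_mem_hardy f.1.2 hg⟩, hg⟩

/-- The operator `D = -i ∂ₓ : H¹₊ → L²₊`, where `∂ₓ` is the derivative of tempered distributions. -/
def opD : hardySobolev →ₗ[ℂ] hardy where
  toFun f := (exists_D f).choose
  map_add' f g := by
    ext1
    apply toTemperedDistribution_injective
    have h1 := (exists_D f).choose_spec
    have h2 := (exists_D g).choose_spec
    rw [(exists_D (f + g)).choose_spec]
    simp only [Submodule.coe_add, toDist_add, LineDeriv.lineDerivOp_add, smul_add, h1, h2]
  map_smul' c f := by
    ext1
    apply toTemperedDistribution_injective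
    have h1 := (exists_D f).choose_spec
    rw [(exists_D (c • f)).choose_spec]
    simp only [RingHom.id_apply, Submodule.coe_smul, toDist_smul, LineDeriv.lineDerivOp_smul, h1,
      smul_comm c]

theorem opD_spec (f : hardySobolev) : ((opD f : L2) : 𝓢'(ℝ, ℂ)) =
    -Complex.I • ∂_{(1 : ℝ)} (((f : hardy) : L2) : 𝓢'(ℝ, ℂ)) :=
  (exists_D f).choose_spec

theorem memLp_top {f : L2} (hf : TemperedDistribution.MemSobolev 1 2 (f : 𝓢'(ℝ, ℂ))) :
    MemLp f ∞ volume := by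
  obtain ⟨v, hv⟩ := hf.fourier_memL1 (by norm_num)
  have hvi : Integrable v := memLp_one_iff_integrable.1 (Lp.memLp v)
  have hL : Continuous fun p : ℝ × ℝ => (-innerₗ ℝ : ℝ →ₗ[ℝ] ℝ →ₗ[ℝ] ℝ) p.1 p.2 :=
    (continuous_inner (𝕜 := ℝ) (E := ℝ)).neg
  have hb : ∀ x, ‖𝓕⁻ (v : ℝ → ℂ) x‖ ≤ ∫ t, ‖v t‖ := fun x =>
    VectorFourier.norm_fourierIntegral_le_integral_norm _ _ _ _ _
  have hcont : Continuous (𝓕⁻ (v : ℝ → ℂ)) :=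
    VectorFourier.fourierIntegral_continuous Real.continuous_fourierChar hL hvi
  have hae : ∀ᵐ x, f x = 𝓕⁻ (v : ℝ → ℂ) x := by
    refine ae_eq_of_integral_contDiff_smul_eq ((Lp.memLp f).locallyIntegrable (by norm_num))
      hcont.locallyIntegrable ?_
    intro φ hφ hc
    have hg₁ : HasCompactSupport (Complex.ofRealCLM ∘ φ) := hc.comp_left rfl
    have hg₂ : ContDiff ℝ ((⊤ : ℕ∞) : WithTop ℕ∞) (Complex.ofRealCLM ∘ φ) :=
    Complex.ofRealCLM.contDiff.comp hφ
    have e : (f : 𝓢'(ℝ, ℂ)) = 𝓕⁻ (v : 𝓢'(ℝ, ℂ)) := by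
      rw [← hv, FourierTransform.fourierInv_fourier_eq]
    have e2 := congrArg (fun T : 𝓢'(ℝ, ℂ) => T (hg₁.toSchwartzMap hg₂)) e
    simp only [TemperedDistribution.fourierInv_apply, Lp.toTemperedDistribution_apply] at e2
    have e3 := VectorFourier.integral_fourierIntegral_smul_eq_flip (μ := volume) (ν := volume)
      (f := hg₁.toSchwartzMap hg₂) (g := (v : ℝ → ℂ)) Real.continuous_fourierChar hL
      (hg₁.toSchwartzMap hg₂).integrable hvi
    have hflip : (-innerₗ ℝ : ℝ →ₗ[ℝ] ℝ →ₗ[ℝ] ℝ).flip = -innerₗ ℝ := by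
      ext; simp
    rw [hflip] at e3
    rw [SchwartzMap.fourierInv_coe] at e2
    exact e2.trans e3
  refine (memLp_congr_ae hae).2 (memLp_top_of_bound hcont.aestronglyMeasurable _ (.of_forall hb))

theorem memLp_mul (u : Lp ℝ 2 (volume : Measure ℝ)) (f : hardySobolev) :
    MemLp (fun x => (u x : ℂ) * ((f : hardy) : L2) x) 2 volume :=
  MemLp.mul (p := 2) (q := ∞) (memLp_top f.2) (Lp.memLp u).ofReal

/-- The Toeplitz operator `T_u : H¹₊ → L²₊`, `T_u h = Π (u h)`, with symbol `u ∈ L²(ℝ, ℝ)`. -/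
def toeplitz (u : Lp ℝ 2 (volume : Measure ℝ)) : hardySobolev →ₗ[ℂ] hardy where
  toFun f := szego ((memLp_mul u f).toLp _)
  map_add' f g := by
    rw [← map_add]
    congr 1
    rw [← MemLp.toLp_add]
    apply MemLp.toLp_congr
    filter_upwards [Lp.coeFn_add ((f : hardy) : L2) ((g : hardy) : L2)] with x hx
    simp only [Submodule.coe_add, Pi.add_apply, hx, mul_add]
  map_smul' c f := by
    rw [← map_smul]
    congr 1
    rw [RingHom.id_apply, ← MemLp.toLp_const_smul]
    apply MemLp.toLp_congr
    filter_upwards [Lp.coeFn_smul c ((f : hardy) : L2)] with x hx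
    simp only [Submodule.coe_smul, Pi.smul_apply, hx, smul_eq_mul]
    ring

/-- The Lax operator `L_u = D - T_u`, an unbounded operator on `L²₊` with domain `H¹₊`. -/
def laxOperator (u : Lp ℝ 2 (volume : Measure ℝ)) : hardy →ₗ.[ℂ] hardy where
  domain := hardySobolev
  toFun := opD - toeplitz u

/-! ### Spectral subspaces of an unbounded operator -/

section Spectral

variable {E : Type*} [NormedAddCommGroup E] [InnerProductSpace ℂ E]

/-- `μ` is the spectral measure of the self-adjoint operator `A` at the vector `ψ`, i.e. the (unique)
finite Borel measure on `ℝ` with `⟨(A - z)⁻¹ ψ, ψ⟩ = ∫ (t - z)⁻¹ dμ(t)` for all `z ∈ ℂ \ ℝ`. -/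
structure IsSpectralMeasure (A : E →ₗ.[ℂ] E) (ψ : E) (μ : Measure ℝ) : Prop where
  finite : IsFiniteMeasure μ
  cauchy : ∀ z : ℂ, z.im ≠ 0 → ∃ φ : A.domain, A φ - z • (φ : E) = ψ ∧
    inner ℂ ψ (φ : E) = ∫ t : ℝ, ((t : ℂ) - z)⁻¹ ∂μ

/-- `ℋ_ac(A)`: the vectors whose spectral measure is absolutely continuous with respect to the
Lebesgue measure. -/
def acSubspace (A : E →ₗ.[ℂ] E) : Set E :=
  {ψ | ∃ μ : Measure ℝ, IsSpectralMeasure A ψ μ ∧ μ ≪ volume}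

/-- `ℋ_sc(A)`: the vectors whose spectral measure is singular continuous. -/
def scSubspace (A : E →ₗ.[ℂ] E) : Set E :=
  {ψ | ∃ μ : Measure ℝ, IsSpectralMeasure A ψ μ ∧ μ ⟂ₘ volume ∧ ∀ t : ℝ, μ {t} = 0}

/-- `ℋ_pp(A)`: the vectors whose spectral measure is pure point, i.e. carried by a countable set. -/
def ppSubspace (A : E →ₗ.[ℂ] E) : Set E :=
  {ψ | ∃ μ : Measure ℝ, IsSpectralMeasure A ψ μ ∧ ∃ S : Set ℝ, S.Countable ∧ μ Sᶜ = 0}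

/-- The eigenspace `Ker(A - z)`. -/
def eigenspace (A : E →ₗ.[ℂ] E) (z : ℂ) : Submodule ℂ E :=
  (LinearMap.ker (A.toFun - z • A.domain.subtype)).map A.domain.subtype

/-- `σ_pp(A)`: the set of eigenvalues of `A`. -/
def pointSpectrum (A : E →ₗ.[ℂ] E) : Set ℂ := {z | eigenspace A z ≠ ⊥}

/-- The spectrum of the part of `A` in the reducing subspace `M`: the `z ∈ ℂ` for which
`A - z : D(A) ∩ M → M` is not a bijection with bounded inverse. -/
def spectrumOn (A : E →ₗ.[ℂ] E) (M : Set E) : Set ℂ :=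
  {z | ¬ ((∀ ψ ∈ M, ∃! φ : A.domain, (φ : E) ∈ M ∧ A φ - z • (φ : E) = ψ) ∧
    ∃ C : ℝ, ∀ φ : A.domain, (φ : E) ∈ M → ‖(φ : E)‖ ≤ C * ‖A φ - z • (φ : E)‖)}

end Spectral

/-! ### Multi-solitons and their characteristic polynomials -/

/-- The soliton profile `R(x) = 2 / (1 + x²)`. -/
def solitonProfile (x : ℝ) : ℝ := 2 / (1 + x ^ 2)

/-- The set `𝒰_N ⊆ L²(ℝ, ℝ)` of the `N`-solitons `u(x) = ∑ⱼ R_{cⱼ}(x - xⱼ)`, where `cⱼ > 0`,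
`xⱼ ∈ ℝ` and `R_c(x) = c R(c x)`. -/
def multiSolitons (N : ℕ) : Set (Lp ℝ 2 (volume : Measure ℝ)) :=
  {u | ∃ c a : Fin N → ℝ, (∀ j, 0 < c j) ∧
    u =ᵐ[volume] fun x => ∑ j, c j * solitonProfile (c j * (x - a j))}

/-- `Q` is a characteristic polynomial of the `N`-soliton `u`: it is monic of degree `N`, its roots
lie in the open lower half-plane, and `Π u = i Q' / Q`. -/
structure IsCharPoly (N : ℕ) (u : Lp ℝ 2 (volume : Measure ℝ)) (Q : Polynomial ℂ) : Prop where
  monic : Q.Monic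
  natDegree_eq : Q.natDegree = N
  roots_im_neg : ∀ z : ℂ, Q.IsRoot z → z.im < 0
  szego_eq : (szego (Complex.ofRealCLM.compLp u) : L2) =ᵐ[volume]
    fun x : ℝ => Complex.I * Q.derivative.eval (x : ℂ) / Q.eval (x : ℂ)

/-- `Θ_Q = Q̄ / Q` on `ℝ`, where the coefficients of `Q̄` are the conjugates of those of `Q`. -/
def innerFunction (Q : Polynomial ℂ) (x : ℝ) : ℂ :=
  (Q.map (starRingEnd ℂ)).eval (x : ℂ) / Q.eval (x : ℂ)

/-- `Θ_Q L²₊`, as a subspace of `L²₊`. -/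
def innerRange (Q : Polynomial ℂ) : Submodule ℂ hardy where
  carrier := {f | ∃ h : hardy, (f : L2) =ᵐ[volume] fun x => innerFunction Q x * (h : L2) x}
  zero_mem' := by
    refine ⟨0, ?_⟩
    filter_upwards [Lp.coeFn_zero ℂ 2 (volume : Measure ℝ)] with x hx
    simp only [Submodule.coe_zero, hx, Pi.zero_apply, mul_zero]
  add_mem' := by
    rintro f g ⟨h, hf⟩ ⟨k, hg⟩
    refine ⟨h + k, ?_⟩
    filter_upwards [hf, hg, Lp.coeFn_add (f : L2) (g : L2), Lp.coeFn_add (h : L2) (k : L2)]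
      with x h1 h2 h3 h4
    simp only [Submodule.coe_add, h3, h4, Pi.add_apply, h1, h2, mul_add]
  smul_mem' := by
    rintro c f ⟨h, hf⟩
    refine ⟨c • h, ?_⟩
    filter_upwards [hf, Lp.coeFn_smul c (f : L2), Lp.coeFn_smul c (h : L2)] with x h1 h3 h4
    simp only [Submodule.coe_smul, h3, h4, Pi.smul_apply, h1, smul_eq_mul, mul_left_comm]

/-- `K_{Θ_Q} = (Θ_Q L²₊)^⊥`, the orthogonal complement being taken in `L²₊`. -/
def modelSpace (Q : Polynomial ℂ) : Submodule ℂ hardy := (innerRange Q)ᗮ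

/-- `ℂ_{≤ N-1}[X] / Q`: the functions `P / Q` in `L²₊` with `P` a polynomial of degree less
than `N`. -/
def polyQuotients (N : ℕ) (Q : Polynomial ℂ) : Set hardy :=
  {f | ∃ P ∈ Polynomial.degreeLT ℂ N,
    (f : L2) =ᵐ[volume] fun x : ℝ => P.eval (x : ℂ) / Q.eval (x : ℂ)}

end BenjaminOno
end

/-!
The spectral theory of `L_u` for a multi-soliton `u` is explicit, because the Hardy space splits into
two invariant subspaces on which `L_u` is a known operator.

Put `z_j = x_j - i / c_j` and `Q = ∏ (X - z_j)`. Partial fractions give `u = i Q' / Q - i Q̄' / Q̄`,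
where the first term belongs to `L²₊` and the second one is orthogonal to it, so `Π u = i Q' / Q`; and
`Q` is determined by its logarithmic derivative (`exists_isSolitonOf`, `szego_eq_of_isSolitonOf`,
`IsCharPoly.eq`). With `Θ = Q̄ / Q` one has `-i Θ' = u Θ`, hence `L_u (Θ h) = Θ D h`, where
`D = -i ∂ₓ` (`laxOperator_mulInner`). Thus `L_u` restricted to `Θ L²₊` is unitarily equivalent to
`D`, which on the Fourier side is multiplication by `2πξ` on `[0, ∞)`: its spectral measures are
absolutely continuous and its spectrum is `[0, ∞)` (`isHalfLineOperator_freeOperator`).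

Splitting off one root of `Q` at a time shows that `L²₊` is the orthogonal sum of `Θ L²₊` and of the
space of the `P / Q` with `deg P < N` (`InHardy.exists_decomposition`, `mem_modelSpace_iff`). If
`Q̄' P = A Q + B Q̄`, then `L_u (P / Q) = i (B - P') / Q` (`laxOperator_rational`), so this
`N`-dimensional space is invariant and has an orthonormal basis of eigenvectors. For
`G (P / Q) = (X P - p Q) / Q`, with `p` the coefficient of `X ^ (N - 1)` in `P`, the commutator
identity `[L_u, G] f = -i f + p Π u` paired with an eigenvector `f = P / Q` of eigenvalue `λ` yields
`‖f‖² = -2πλ |p|²` (`norm_sq_eq_of_eigenvector`). Hence `λ < 0`, and `λ` is simple: a combination of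
two eigenvectors with `p = 0` vanishes.

The rest holds for any symmetric operator that is the orthogonal sum of such a half-line operator and
of a finite diagonal operator (`SpectralModel`): it is self-adjoint, its resolvent is explicit, and the
spectral measure at `V h + ∑ cᵢ eᵢ` is that of `D` at `h` plus `∑ |cᵢ|² δ_{ev i}`. Since a finite
measure is determined by its Stieltjes transform (`measure_eq_of_stieltjes_eq`), the absolutely
continuous, singular continuous and pure point subspaces can be read off.
-/

noncomputable section

namespace BenjaminOno

/-! ### Distributional identities between square-integrable functions -/

/-- Multiplication of distributions by a function of temperate growth agrees with pointwise
multiplication when both sides are in `L²`. -/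
theorem eq_smulLeftCLM_iff {f g : L2} {m : ℝ → ℂ} (hm : m.HasTemperateGrowth) :
    (g : 𝓢'(ℝ, ℂ)) = TemperedDistribution.smulLeftCLM ℂ m (f : 𝓢'(ℝ, ℂ)) ↔
      g =ᵐ[volume] fun x => m x * f x := by
  have key : ∀ φ : 𝓢(ℝ, ℂ), TemperedDistribution.smulLeftCLM ℂ m (f : 𝓢'(ℝ, ℂ)) φ =
      ∫ x, φ x • (m x * f x) := by
    intro φ
    rw [TemperedDistribution.smulLeftCLM_apply_apply, Lp.toTemperedDistribution_apply]
    refine integral_congr_ae (.of_forall fun x => ?_)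
    simp only [SchwartzMap.smulLeftCLM_apply_apply hm, smul_eq_mul]
    ring
  constructor
  · intro h
    have hloc : LocallyIntegrable (fun x => m x * f x) := by
      have hf := (Lp.memLp f).locallyIntegrable (μ := volume) (by norm_num)
      rw [← locallyIntegrableOn_univ] at hf ⊢
      exact hf.continuousOn_mul hm.1.continuous.continuousOn isOpen_univ.isLocallyClosed
    refine ae_eq_of_integral_contDiff_smul_eq ((Lp.memLp g).locallyIntegrable (by norm_num))
      hloc ?_
    intro φ hφ hc
    have hg₁ : HasCompactSupport (Complex.ofRealCLM ∘ φ) := hc.comp_left rfl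
    have hg₂ : ContDiff ℝ ((⊤ : ℕ∞) : WithTop ℕ∞) (Complex.ofRealCLM ∘ φ) :=
      Complex.ofRealCLM.contDiff.comp hφ
    have e := congrArg (fun T : 𝓢'(ℝ, ℂ) => T (hg₁.toSchwartzMap hg₂)) h
    simp only [key, Lp.toTemperedDistribution_apply] at e
    exact e
  · intro h
    ext φ
    rw [key, Lp.toTemperedDistribution_apply]
    refine integral_congr_ae ?_
    filter_upwards [h] with x hx
    rw [hx]

theorem hasTemperateGrowth_freq :
    (fun ξ : ℝ => (2 * Real.pi * ξ : ℂ)).HasTemperateGrowth := by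
  fun_prop

/-- On the Fourier side the distributional operator `-i ∂ₓ` is multiplication by `2πξ`. -/
theorem eq_deriv_iff_fourier {f g : L2} :
    (g : 𝓢'(ℝ, ℂ)) = -Complex.I • ∂_{(1 : ℝ)} (f : 𝓢'(ℝ, ℂ)) ↔
      (𝓕 g : L2) =ᵐ[volume] fun ξ : ℝ => (2 * Real.pi * ξ : ℂ) * (𝓕 f : L2) ξ := by
  rw [← eq_smulLeftCLM_iff hasTemperateGrowth_freq, ← Lp.fourier_toTemperedDistribution_eq,
    ← Lp.fourier_toTemperedDistribution_eq]
  have h : 𝓕 (-Complex.I • ∂_{(1 : ℝ)} (f : 𝓢'(ℝ, ℂ))) =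
      TemperedDistribution.smulLeftCLM ℂ (fun ξ : ℝ => (2 * Real.pi * ξ : ℂ))
        (𝓕 (f : 𝓢'(ℝ, ℂ))) := by
    rw [FourierTransform.fourier_smul, TemperedDistribution.fourier_lineDerivOp_eq, smul_smul]
    have e : (fun ξ : ℝ => (2 * Real.pi * ξ : ℂ)) =
        (-Complex.I * (2 * Real.pi * Complex.I)) • (fun x : ℝ => ((inner ℝ x (1 : ℝ) : ℝ) : ℂ)) := by
      ext x
      simp only [Pi.smul_apply, smul_eq_mul, RCLike.inner_apply, conj_trivial, one_mul]
      linear_combination (2 * Real.pi * x : ℂ) * Complex.I_sq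
    rw [e, TemperedDistribution.smulLeftCLM_smul (by fun_prop)]
    rfl
  constructor
  · intro e
    rw [← h, e]
  · intro e
    rw [← h] at e
    have := congrArg (fun T : 𝓢'(ℝ, ℂ) => 𝓕⁻ T) e
    simpa only [FourierTransform.fourierInv_fourier_eq] using this

/-- A function in `L²` whose distributional derivative is in `L²` belongs to `H¹`. -/
theorem memSobolev_of_deriv {f g : L2}
    (h : (g : 𝓢'(ℝ, ℂ)) = -Complex.I • ∂_{(1 : ℝ)} (f : 𝓢'(ℝ, ℂ))) :
    TemperedDistribution.MemSobolev 1 2 (f : 𝓢'(ℝ, ℂ)) := by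
  rw [eq_deriv_iff_fourier] at h
  rw [TemperedDistribution.memSobolev_iff_exists_smulLeftCLM_fourier,
    Lp.fourier_toTemperedDistribution_eq]
  have hm : (fun x : ℝ => (((1 + ‖x‖ ^ 2) ^ ((1 : ℝ) / 2) : ℝ) : ℂ)).HasTemperateGrowth := by
    fun_prop
  have hL : MemLp (fun x : ℝ => (((1 + ‖x‖ ^ 2) ^ ((1 : ℝ) / 2) : ℝ) : ℂ) * (𝓕 f : L2) x) 2 := by
    refine MemLp.of_le ((Lp.memLp (𝓕 f : L2)).norm.add (Lp.memLp (𝓕 g : L2)).norm)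
      (hm.1.continuous.aestronglyMeasurable.mul (Lp.memLp _).1) ?_
    filter_upwards [h] with x hx
    simp only [Pi.add_apply, hx, norm_mul, Complex.norm_real, RCLike.norm_ofNat]
    rw [← Real.sqrt_eq_rpow, Real.norm_of_nonneg (Real.sqrt_nonneg _),
      Real.norm_of_nonneg Real.pi_pos.le]
    refine le_trans ?_ (le_abs_self _)
    have h1 : Real.sqrt (1 + ‖x‖ ^ 2) ≤ 1 + 2 * Real.pi * ‖x‖ := by
      rw [Real.sqrt_le_left (by positivity)]
      nlinarith [norm_nonneg x, Real.pi_gt_three, mul_nonneg (norm_nonneg x) (norm_nonneg x),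
        mul_le_mul Real.pi_gt_three.le Real.pi_gt_three.le (by norm_num) Real.pi_pos.le]
    nlinarith [norm_nonneg ((𝓕 f : L2) x)]
  refine ⟨hL.toLp _, ?_⟩
  exact ((eq_smulLeftCLM_iff hm).2 hL.coeFn_toLp).symm

/-- The Leibniz rule `-i (m f)' = m (-i f') - i m' f` for `f` with distributional derivative in
`L²`. -/
theorem deriv_mul {f g F G : L2} {m m' : ℝ → ℂ} (hm : m.HasTemperateGrowth)
    (hm' : m'.HasTemperateGrowth) (hd : ∀ x, HasDerivAt m (m' x) x)
    (h : (g : 𝓢'(ℝ, ℂ)) = -Complex.I • ∂_{(1 : ℝ)} (f : 𝓢'(ℝ, ℂ)))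
    (hF : F =ᵐ[volume] fun x => m x * f x)
    (hG : G =ᵐ[volume] fun x => m x * g x - Complex.I * (m' x * f x)) :
    (G : 𝓢'(ℝ, ℂ)) = -Complex.I • ∂_{(1 : ℝ)} (F : 𝓢'(ℝ, ℂ)) := by
  ext φ
  set S := SchwartzMap.smulLeftCLM ℂ m φ with hS
  set S' := SchwartzMap.smulLeftCLM ℂ m' φ with hS'
  have hSd : ∀ x, ∂_{(1 : ℝ)} S x = S' x + m x * ∂_{(1 : ℝ)} φ x := by
    intro x
    have e1 : (S : ℝ → ℂ) = fun x => m x * φ x := by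
      ext x; rw [hS, SchwartzMap.smulLeftCLM_apply_apply hm, smul_eq_mul]
    have e2 : HasDerivAt φ (∂_{(1 : ℝ)} φ x) x := by
      rw [SchwartzMap.lineDerivOp_apply_eq_fderiv, fderiv_eq_smul_deriv, one_smul]
      exact φ.differentiableAt.hasDerivAt
    rw [SchwartzMap.lineDerivOp_apply_eq_fderiv, fderiv_eq_smul_deriv, one_smul, e1,
      ((hd x).fun_mul e2).deriv, hS', SchwartzMap.smulLeftCLM_apply_apply hm', smul_eq_mul]
  have hint : ∀ (ψ : 𝓢(ℝ, ℂ)) (k : L2), Integrable (fun x => ψ x * k x) := fun ψ k =>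
    (ψ.memLp 2 volume).integrable_mul (Lp.memLp k)
  have e := congrArg (fun T : 𝓢'(ℝ, ℂ) => T S) h
  simp only [_root_.smul_apply, TemperedDistribution.lineDerivOp_apply_apply,
    Lp.toTemperedDistribution_apply, neg_apply, smul_eq_mul, hSd] at e ⊢
  have e1 : ∫ x, φ x * G x = (∫ x, S x * g x) - Complex.I * ∫ x, S' x * f x := by
    rw [← integral_const_mul, ← integral_sub (hint _ _) ((hint _ _).const_mul _)]
    refine integral_congr_ae ?_
    filter_upwards [hG] with x hx
    rw [hx, hS, hS', SchwartzMap.smulLeftCLM_apply_apply hm, SchwartzMap.smulLeftCLM_apply_apply hm']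
    simp only [smul_eq_mul]
    ring
  have e2 : ∫ x, -∂_{(1 : ℝ)} φ x * F x =
      (∫ x, -∂_{(1 : ℝ)} S x * f x) + ∫ x, S' x * f x := by
    rw [← integral_add (by simpa using (hint (∂_{(1 : ℝ)} S) f).neg) (hint _ _)]
    refine integral_congr_ae ?_
    filter_upwards [hF] with x hx
    rw [hx, hSd]
    ring
  simp only [← hSd] at e
  rw [e1, e2, e]
  ring

/-! ### The Fourier side of `L²₊` -/

theorem fourier_sub' (f g : L2) : (𝓕 (f - g) : L2) = 𝓕 f - 𝓕 g :=
  (Lp.fourierTransformₗᵢ ℝ ℂ).map_sub f g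

theorem fourier_smul' (c : ℂ) (f : L2) : (𝓕 (c • f) : L2) = c • 𝓕 f :=
  (Lp.fourierTransformₗᵢ ℝ ℂ).map_smul c f

theorem fourier_injective' : Function.Injective (fun f : L2 => (𝓕 f : L2)) :=
  (Lp.fourierTransformₗᵢ ℝ ℂ).injective

theorem inner_szego (F : L2) (g : hardy) : inner ℂ (szego F) g = inner ℂ F (g : L2) := by
  rw [Submodule.coe_inner, ← Lp.inner_fourier_eq, ← Lp.inner_fourier_eq F]
  have h : (𝓕 (szego F : L2) : L2) = cutoff (𝓕 F) := FourierTransform.fourier_fourierInv_eq _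
  rw [h, L2.inner_def, L2.inner_def]
  refine integral_congr_ae ?_
  filter_upwards [cutoff_coe (𝓕 F), mem_hardy.1 g.2] with ξ h1 h2
  rw [h1]
  by_cases hξ : ξ < 0
  · simp [h2 hξ]
  · rw [Set.indicator_of_mem (by simpa using hξ)]

/-- `Π F` is the only element `f` of `L²₊` with `F - f ⟂ L²₊`. -/
theorem szego_eq_of_forall_inner {F : L2} {f : hardy}
    (h : ∀ g : hardy, inner ℂ F (g : L2) = inner ℂ f g) : szego F = f :=
  ext_inner_right ℂ fun g => by rw [inner_szego, h]

theorem exists_hardy_of_fourier {k : ℝ → ℂ} (hk : MemLp k 2) (h0 : ∀ ξ < 0, k ξ = 0) :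
    ∃ f : hardy, (𝓕 (f : L2) : L2) =ᵐ[volume] k := by
  have e : (𝓕 (𝓕⁻ (hk.toLp k) : L2) : L2) = hk.toLp k := FourierTransform.fourier_fourierInv_eq _
  refine ⟨⟨𝓕⁻ (hk.toLp k), ?_⟩, ?_⟩
  · rw [mem_hardy, e]
    filter_upwards [hk.coeFn_toLp] with ξ h hξ
    rw [h, h0 ξ hξ]
  · rw [e]
    exact hk.coeFn_toLp

theorem exists_hardySobolev_of_deriv {f g : L2} (hf : f ∈ hardy)
    (h : (g : 𝓢'(ℝ, ℂ)) = -Complex.I • ∂_{(1 : ℝ)} (f : 𝓢'(ℝ, ℂ))) :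
    ∃ F : hardySobolev, ((F : hardy) : L2) = f ∧ (opD F : L2) = g := by
  refine ⟨⟨⟨f, hf⟩, memSobolev_of_deriv h⟩, rfl, ?_⟩
  apply toTemperedDistribution_injective
  rw [opD_spec, h]

theorem fourier_opD (f : hardySobolev) : (𝓕 (opD f : L2) : L2) =ᵐ[volume]
    fun ξ : ℝ => (2 * Real.pi * ξ : ℂ) * (𝓕 ((f : hardy) : L2) : L2) ξ :=
  eq_deriv_iff_fourier.1 (opD_spec f)

theorem fourier_opD_sub (f : hardySobolev) (z : ℂ) :
    (𝓕 ((opD f - z • (f : hardy) : hardy) : L2) : L2) =ᵐ[volume]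
      fun ξ : ℝ => (2 * Real.pi * ξ - z : ℂ) * (𝓕 ((f : hardy) : L2) : L2) ξ := by
  rw [Submodule.coe_sub, Submodule.coe_smul, fourier_sub', fourier_smul']
  filter_upwards [fourier_opD f, Lp.coeFn_sub (𝓕 (opD f : L2) : L2) (z • 𝓕 ((f : hardy) : L2)),
    Lp.coeFn_smul z (𝓕 ((f : hardy) : L2) : L2)] with ξ h1 h2 h3
  rw [h2, Pi.sub_apply, h1, h3, Pi.smul_apply, smul_eq_mul, sub_mul]

theorem exists_hardySobolev_of_fourier {k : ℝ → ℂ} (hk : MemLp k 2)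
    (hk' : MemLp (fun ξ : ℝ => (2 * Real.pi * ξ : ℂ) * k ξ) 2) (h0 : ∀ ξ < 0, k ξ = 0) :
    ∃ f : hardySobolev, (𝓕 ((f : hardy) : L2) : L2) =ᵐ[volume] k := by
  obtain ⟨f, hf⟩ := exists_hardy_of_fourier hk h0
  obtain ⟨g, hg⟩ := exists_hardy_of_fourier hk' fun ξ hξ => by rw [h0 ξ hξ, mul_zero]
  obtain ⟨F, hF, -⟩ := exists_hardySobolev_of_deriv (f := f) (g := g) f.2
    (eq_deriv_iff_fourier.2 (by filter_upwards [hf, hg] with ξ h1 h2; rw [h1, h2]))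
  exact ⟨F, by rwa [hF]⟩

theorem opD_symmetric (f g : hardySobolev) :
    inner ℂ (opD f) (g : hardy) = inner ℂ (f : hardy) (opD g) := by
  rw [Submodule.coe_inner, Submodule.coe_inner, ← Lp.inner_fourier_eq,
    ← Lp.inner_fourier_eq ((f : hardy) : L2), L2.inner_def, L2.inner_def]
  refine integral_congr_ae ?_
  filter_upwards [fourier_opD f, fourier_opD g] with ξ h1 h2
  rw [h1, h2]
  simp only [RCLike.inner_apply, map_mul, Complex.conj_ofReal, map_ofNat]
  ring

/-- `D` has no eigenvalues. -/
theorem eq_zero_of_opD_eq_smul {f : hardySobolev} {z : ℂ} (h : opD f - z • (f : hardy) = 0) :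
    (f : hardy) = 0 := by
  have h1 := fourier_opD_sub f z
  have h0 : (𝓕 (0 : L2) : L2) = 0 := (Lp.fourierTransformₗᵢ ℝ ℂ).map_zero
  rw [h, Submodule.coe_zero, h0] at h1
  have h2 : (𝓕 ((f : hardy) : L2) : L2) = 0 := by
    rw [Lp.eq_zero_iff_ae_eq_zero]
    have hne : ∀ᵐ ξ : ℝ, ξ ≠ z.re / (2 * Real.pi) := Measure.ae_ne volume _
    filter_upwards [h1, hne, Lp.coeFn_zero ℂ 2 (volume : Measure ℝ)] with ξ h3 h4 h5
    rw [h5, Pi.zero_apply, eq_comm, mul_eq_zero] at h3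
    refine h3.resolve_left fun h6 => h4 ?_
    have := congrArg Complex.re h6
    simp at this
    field_simp
    linarith
  ext1
  refine fourier_injective' (h2.trans h0.symm)

/-- `D - z` is bounded below by the distance from `z` to `[0, ∞)`. -/
theorem norm_opD_sub_ge {z : ℂ} {d : ℝ} (hd : 0 ≤ d)
    (h : ∀ ξ : ℝ, 0 ≤ ξ → d ≤ ‖(2 * Real.pi * ξ - z : ℂ)‖) (f : hardySobolev) :
    d * ‖(f : hardy)‖ ≤ ‖opD f - z • (f : hardy)‖ := by
  have e : d * ‖(f : hardy)‖ = ‖((d : ℂ) • 𝓕 ((f : hardy) : L2) : L2)‖ := by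
    rw [norm_smul, Lp.norm_fourier_eq, Complex.norm_real, Real.norm_of_nonneg hd]; rfl
  have e2 : ‖opD f - z • (f : hardy)‖ = ‖(𝓕 ((opD f - z • (f : hardy) : hardy) : L2) : L2)‖ := by
    rw [Lp.norm_fourier_eq]; rfl
  rw [e, e2]
  refine Lp.norm_le_norm_of_ae_le ?_
  filter_upwards [fourier_opD_sub f z, Lp.coeFn_smul (d : ℂ) (𝓕 ((f : hardy) : L2) : L2),
    mem_hardy.1 (f : hardy).2] with ξ h1 h2 h3
  rw [h1, h2, Pi.smul_apply, norm_smul, norm_mul, Complex.norm_real, Real.norm_of_nonneg hd]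
  by_cases hξ : ξ < 0
  · simp [h3 hξ]
  · gcongr
    exact h ξ (not_lt.1 hξ)

/-- The resolvent of `D` divides the Fourier transform by `2πξ - z`. -/
theorem exists_opD_sub_eq {z : ℂ} {d : ℝ} (hd : 0 < d)
    (h : ∀ ξ : ℝ, 0 ≤ ξ → d ≤ ‖(2 * Real.pi * ξ - z : ℂ)‖) (ψ : hardy) :
    ∃ f : hardySobolev, opD f - z • (f : hardy) = ψ ∧
      (𝓕 ((f : hardy) : L2) : L2) =ᵐ[volume] fun ξ : ℝ =>
        (2 * Real.pi * ξ - z : ℂ)⁻¹ * (𝓕 (ψ : L2) : L2) ξ := by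
  set k : ℝ → ℂ := (Set.Ici (0 : ℝ)).indicator fun ξ : ℝ =>
    (2 * Real.pi * ξ - z : ℂ)⁻¹ * (𝓕 (ψ : L2) : L2) ξ with hkdef
  have hpt : ∀ ξ : ℝ, (2 * Real.pi * ξ : ℂ) * k ξ =
      (Set.Ici (0 : ℝ)).indicator (𝓕 (ψ : L2) : L2) ξ + z * k ξ := by
    intro ξ
    by_cases hξ : ξ ∈ Set.Ici (0 : ℝ)
    · have hne : (2 * Real.pi * ξ - z : ℂ) ≠ 0 := norm_pos_iff.1 (hd.trans_le (h ξ hξ))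
      simp only [hkdef, Set.indicator_of_mem hξ]
      field_simp
      ring
    · simp only [hkdef, Set.indicator_of_notMem hξ, mul_zero, add_zero]
  have hk : MemLp k 2 := by
    refine MemLp.of_le ((Lp.memLp (𝓕 (ψ : L2) : L2)).const_mul ((d⁻¹ : ℝ) : ℂ)) ?_
      (.of_forall fun ξ => ?_)
    · refine AEStronglyMeasurable.indicator (.mul ?_ (Lp.memLp _).1) measurableSet_Ici
      exact Measurable.aestronglyMeasurable (by fun_prop)
    · by_cases hξ : ξ ∈ Set.Ici (0 : ℝ)
      · simp only [hkdef, Set.indicator_of_mem hξ, norm_mul, norm_inv, Complex.norm_real,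
          Real.norm_of_nonneg hd.le]
        gcongr
        exact h ξ hξ
      · simp only [hkdef, Set.indicator_of_notMem hξ, norm_zero]
        positivity
  have hk' : MemLp (fun ξ : ℝ => (2 * Real.pi * ξ : ℂ) * k ξ) 2 := by
    simp only [hpt]
    exact ((Lp.memLp (𝓕 (ψ : L2) : L2)).indicator measurableSet_Ici).add (hk.const_mul z)
  obtain ⟨f, hf⟩ := exists_hardySobolev_of_fourier hk hk' fun ξ hξ =>
    Set.indicator_of_notMem (by simpa using hξ) _
  have hk2 : k =ᵐ[volume] fun ξ : ℝ => (2 * Real.pi * ξ - z : ℂ)⁻¹ * (𝓕 (ψ : L2) : L2) ξ := by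
    filter_upwards [mem_hardy.1 ψ.2] with ξ h1
    by_cases hξ : ξ < 0
    · simp [hkdef, h1 hξ]
    · rw [hkdef, Set.indicator_of_mem (by simpa using hξ)]
  refine ⟨f, ?_, hf.trans hk2⟩
  ext1
  apply fourier_injective'
  apply Lp.ext
  filter_upwards [fourier_opD_sub f z, hf, hk2, mem_hardy.1 ψ.2] with ξ h1 h2 h3 h4
  rw [h1, h2, h3]
  by_cases hξ : ξ < 0
  · simp [h4 hξ]
  · have hne : (2 * Real.pi * ξ - z : ℂ) ≠ 0 := norm_pos_iff.1 (hd.trans_le (h ξ (not_lt.1 hξ)))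
    field_simp

/-- Every `t ≥ 0` is an approximate eigenvalue of `D`: the Fourier transform of the approximate
eigenvector is the indicator function of a short interval to the right of `t / 2π`. -/
theorem exists_norm_opD_sub_le {t ε : ℝ} (ht : 0 ≤ t) (hε : 0 < ε) :
    ∃ f : hardySobolev, (f : hardy) ≠ 0 ∧
      ‖opD f - (t : ℂ) • (f : hardy)‖ ≤ ε * ‖(f : hardy)‖ := by
  have hpi := Real.pi_pos
  set a := t / (2 * Real.pi) with ha
  set δ := ε / (2 * Real.pi) with hδ
  have hδ0 : 0 < δ := by positivity
  set k : ℝ → ℂ := (Set.Icc a (a + δ)).indicator fun _ => 1 with hkdef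
  have hk : MemLp k 2 := memLp_indicator_const 2 measurableSet_Icc _ (Or.inr (by simp))
  have hk' : MemLp (fun ξ : ℝ => (2 * Real.pi * ξ : ℂ) * k ξ) 2 := by
    refine MemLp.of_le (hk.const_mul ((2 * Real.pi * (a + δ) : ℝ) : ℂ))
      (.mul (Measurable.aestronglyMeasurable (by fun_prop)) hk.1) (.of_forall fun ξ => ?_)
    by_cases hξ : ξ ∈ Set.Icc a (a + δ)
    · have h0 : 0 ≤ ξ := le_trans (by positivity) hξ.1
      rw [norm_mul _ (k ξ), norm_mul _ (k ξ)]
      refine mul_le_mul_of_nonneg_right ?_ (norm_nonneg (k ξ))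
      rw [Complex.norm_real, Real.norm_of_nonneg (by positivity),
        show (2 * Real.pi * ξ : ℂ) = ((2 * Real.pi * ξ : ℝ) : ℂ) by push_cast; rfl,
        Complex.norm_real, Real.norm_of_nonneg (by positivity)]
      have := hξ.2
      gcongr
    · simp [hkdef, Set.indicator_of_notMem hξ]
  obtain ⟨f, hf⟩ := exists_hardySobolev_of_fourier hk hk' fun ξ hξ =>
    Set.indicator_of_notMem (fun h => by have : 0 ≤ a := by positivity
                                         linarith [h.1]) _
  refine ⟨f, fun h0 => ?_, ?_⟩
  · have h1 : (𝓕 (0 : L2) : L2) = 0 := (Lp.fourierTransformₗᵢ ℝ ℂ).map_zero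
    rw [h0, Submodule.coe_zero, h1] at hf
    have h2 : ∀ᵐ ξ : ℝ, ξ ∉ Set.Icc a (a + δ) := by
      filter_upwards [hf, Lp.coeFn_zero ℂ 2 (volume : Measure ℝ)] with ξ h3 h4 h5
      rw [h4, hkdef, Set.indicator_of_mem h5] at h3
      simp at h3
    rw [ae_iff] at h2
    simp only [not_not] at h2
    have h3 : volume (Set.Icc a (a + δ)) = 0 := h2
    rw [Real.volume_Icc] at h3
    simp at h3
    linarith
  · have e : ε * ‖(f : hardy)‖ = ‖((ε : ℂ) • 𝓕 ((f : hardy) : L2) : L2)‖ := by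
      rw [norm_smul, Lp.norm_fourier_eq, Complex.norm_real, Real.norm_of_nonneg hε.le]; rfl
    have e2 : ‖opD f - (t : ℂ) • (f : hardy)‖ =
        ‖(𝓕 ((opD f - (t : ℂ) • (f : hardy) : hardy) : L2) : L2)‖ := by
      rw [Lp.norm_fourier_eq]; rfl
    rw [e, e2]
    refine Lp.norm_le_norm_of_ae_le ?_
    filter_upwards [fourier_opD_sub f t, Lp.coeFn_smul (ε : ℂ) (𝓕 ((f : hardy) : L2) : L2),
      hf] with ξ h1 h2 h3
    rw [h1, h2, Pi.smul_apply, norm_smul, norm_mul, Complex.norm_real, Real.norm_of_nonneg hε.le,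
      h3]
    by_cases hξ : ξ ∈ Set.Icc a (a + δ)
    · gcongr
      rw [show (2 * Real.pi * ξ - t : ℂ) = ((2 * Real.pi * ξ - t : ℝ) : ℂ) by push_cast; rfl,
        Complex.norm_real, Real.norm_eq_abs, abs_le]
      have h4 : t = 2 * Real.pi * a := by rw [ha]; field_simp
      have h5 : ε = 2 * Real.pi * δ := by rw [hδ]; field_simp
      rw [h4, h5]
      constructor
      · nlinarith [hξ.1]
      · nlinarith [hξ.2]
    · simp [hkdef, Set.indicator_of_notMem hξ]

/-- The operator `D = -i ∂ₓ` on `L²₊` with domain `H¹₊`, that is, the Lax operator of `u = 0`. -/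
def freeOperator : hardy →ₗ.[ℂ] hardy where
  domain := hardySobolev
  toFun := opD

/-- The spectral measure of `D` at `ψ`: the image of `|ψ̂(ξ)|² dξ` under `ξ ↦ 2πξ`. -/
def freeSpectralMeasure (ψ : hardy) : Measure ℝ :=
  (volume.withDensity fun ξ => ‖(𝓕 (ψ : L2) : L2) ξ‖ₑ ^ 2).map fun ξ => 2 * Real.pi * ξ

theorem freeSpectralMeasure_absolutelyContinuous (ψ : hardy) :
    freeSpectralMeasure ψ ≪ volume := by
  have h : Measure.map (fun ξ : ℝ => 2 * Real.pi * ξ) volume ≪ volume := by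
    rw [Real.map_volume_mul_left (by positivity)]
    exact Measure.smul_absolutelyContinuous
  exact ((withDensity_absolutelyContinuous _ _).map (by fun_prop)).trans h

theorem isFiniteMeasure_freeSpectralMeasure (ψ : hardy) :
    IsFiniteMeasure (freeSpectralMeasure ψ) := by
  have : IsFiniteMeasure (volume.withDensity fun ξ => ‖(𝓕 (ψ : L2) : L2) ξ‖ₑ ^ 2) := by
    refine isFiniteMeasure_withDensity ?_
    have := (Lp.memLp (𝓕 (ψ : L2) : L2)).2
    rw [eLpNorm_lt_top_iff_lintegral_rpow_enorm_lt_top (by norm_num) (by norm_num)] at this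
    simpa using this.ne
  unfold freeSpectralMeasure
  infer_instance

theorem isSpectralMeasure_freeOperator (ψ : hardy) :
    IsSpectralMeasure freeOperator ψ (freeSpectralMeasure ψ) where
  finite := isFiniteMeasure_freeSpectralMeasure ψ
  cauchy := by
    intro z hz
    obtain ⟨f, hf, hfF⟩ := exists_opD_sub_eq (z := z) (abs_pos.2 hz) (fun ξ _ => by
      refine le_trans (le_of_eq ?_) (Complex.abs_im_le_norm _)
      simp) ψ
    refine ⟨f, hf, ?_⟩
    rw [Submodule.coe_inner, ← Lp.inner_fourier_eq, L2.inner_def, freeSpectralMeasure,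
      integral_map (by fun_prop) (Measurable.aestronglyMeasurable (by fun_prop)),
      integral_withDensity_eq_integral_toReal_smul₀
        ((Lp.stronglyMeasurable _).measurable.enorm.pow_const 2).aemeasurable
        (.of_forall fun _ => by finiteness)]
    refine integral_congr_ae ?_
    filter_upwards [hfF] with ξ h
    rw [h]
    simp only [RCLike.inner_apply, ENNReal.toReal_pow, toReal_enorm, Complex.real_smul,
      Complex.ofReal_pow, Complex.ofReal_mul, Complex.ofReal_ofNat]
    rw [← Complex.mul_conj']
    ring

/-! ### Cauchy kernels and a criterion for membership in `L²₊` -/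

/-- On `L¹ ∩ L²` the Plancherel extension of the inverse Fourier transform is given by the
integral. -/
theorem fourierInv_toLp_ae {f : ℝ → ℂ} (h1 : Integrable f) (h2 : MemLp f 2) :
    (𝓕⁻ (h2.toLp f) : L2) =ᵐ[volume] 𝓕⁻ f := by
  have hL : Continuous fun p : ℝ × ℝ => (-innerₗ ℝ : ℝ →ₗ[ℝ] ℝ →ₗ[ℝ] ℝ) p.1 p.2 :=
    (continuous_inner (𝕜 := ℝ) (E := ℝ)).neg
  have hcont : Continuous (𝓕⁻ f) :=
    VectorFourier.fourierIntegral_continuous Real.continuous_fourierChar hL h1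
  refine ae_eq_of_integral_contDiff_smul_eq ((Lp.memLp _).locallyIntegrable (by norm_num))
    hcont.locallyIntegrable ?_
  intro φ hφ hc
  have hg₁ : HasCompactSupport (Complex.ofRealCLM ∘ φ) := hc.comp_left rfl
  have hg₂ : ContDiff ℝ ((⊤ : ℕ∞) : WithTop ℕ∞) (Complex.ofRealCLM ∘ φ) :=
    Complex.ofRealCLM.contDiff.comp hφ
  have e2 := congrArg (fun T : 𝓢'(ℝ, ℂ) => T (hg₁.toSchwartzMap hg₂))
    (Lp.fourierInv_toTemperedDistribution_eq (h2.toLp f))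
  simp only [TemperedDistribution.fourierInv_apply, Lp.toTemperedDistribution_apply] at e2
  have e3 := VectorFourier.integral_fourierIntegral_smul_eq_flip (μ := volume) (ν := volume)
    (f := hg₁.toSchwartzMap hg₂) (g := f) Real.continuous_fourierChar hL
    (hg₁.toSchwartzMap hg₂).integrable h1
  have hflip : (-innerₗ ℝ : ℝ →ₗ[ℝ] ℝ →ₗ[ℝ] ℝ).flip = -innerₗ ℝ := by
    ext; simp
  rw [hflip] at e3
  rw [SchwartzMap.fourierInv_coe] at e2
  refine e2.symm.trans (Eq.trans ?_ e3)
  refine integral_congr_ae ?_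
  filter_upwards [h2.coeFn_toLp] with x hx
  rw [hx]
  rfl

theorem ae_eq_zero_of_fourierInv_eq_zero {f : ℝ → ℂ} (h1 : Integrable f) (h2 : MemLp f 2)
    (h : ∀ x, 𝓕⁻ f x = 0) : f =ᵐ[volume] 0 := by
  have e : (𝓕⁻ (h2.toLp f) : L2) = 0 := by
    rw [Lp.eq_zero_iff_ae_eq_zero]
    filter_upwards [fourierInv_toLp_ae h1 h2] with x hx
    rw [hx, h, Pi.zero_apply]
  have e2 : h2.toLp f = 0 := (Lp.fourierTransformₗᵢ ℝ ℂ).symm.map_eq_zero_iff.1 e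
  exact h2.coeFn_toLp.symm.trans ((Lp.eq_zero_iff_ae_eq_zero).1 e2)

theorem re_kernel_exponent (w : ℂ) : (2 * Real.pi * Complex.I * w).re = -(2 * Real.pi * w.im) := by
  simp

theorem sub_ne_zero_of_im_ne_zero {w : ℂ} (hw : w.im ≠ 0) (x : ℝ) : (x : ℂ) - w ≠ 0 := by
  intro h
  apply hw
  have := congrArg Complex.im h
  simpa using this

theorem integrable_kernel_Ioi {w : ℂ} (hw : w.im < 0) :
    Integrable ((Set.Ioi (0 : ℝ)).indicator
      fun ξ : ℝ => Complex.exp (-(2 * Real.pi * Complex.I * w) * ξ)) := by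
  rw [integrable_indicator_iff measurableSet_Ioi]
  refine integrableOn_exp_mul_complex_Ioi ?_ 0
  rw [Complex.neg_re, re_kernel_exponent, neg_neg]
  exact mul_neg_of_pos_of_neg (by positivity) hw

theorem integrable_kernel_Iic {w : ℂ} (hw : 0 < w.im) :
    Integrable ((Set.Iic (0 : ℝ)).indicator
      fun ξ : ℝ => Complex.exp (-(2 * Real.pi * Complex.I * w) * ξ)) := by
  rw [integrable_indicator_iff measurableSet_Iic]
  refine integrableOn_exp_mul_complex_Iic ?_ 0
  rw [Complex.neg_re, re_kernel_exponent, neg_neg]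
  positivity

theorem memLp_two_of_bounded {f : ℝ → ℂ} (hf : Integrable f) {C : ℝ} (hC : ∀ x, ‖f x‖ ≤ C) :
    MemLp f 2 := by
  rw [memLp_two_iff_integrable_sq_norm hf.1]
  refine (hf.norm.const_mul C).mono' (hf.1.norm.pow 2) (.of_forall fun x => ?_)
  rw [Real.norm_of_nonneg (by positivity), sq]
  exact mul_le_mul_of_nonneg_right (hC x) (norm_nonneg _)

theorem fourierInv_kernel {S : Set ℝ} (hS : MeasurableSet S) (w : ℂ) (x : ℝ) :
    𝓕⁻ (S.indicator fun ξ : ℝ => Complex.exp (-(2 * Real.pi * Complex.I * w) * ξ)) x =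
      ∫ ξ in S, Complex.exp (2 * Real.pi * Complex.I * (x - w) * ξ) := by
  rw [Real.fourierInv_eq', ← integral_indicator hS]
  congr 1 with ξ
  by_cases hξ : ξ ∈ S
  · rw [Set.indicator_of_mem hξ, Set.indicator_of_mem hξ, smul_eq_mul, ← Complex.exp_add]
    congr 1
    simp only [RCLike.inner_apply, conj_trivial]
    push_cast
    ring
  · simp only [Set.indicator_of_notMem hξ, smul_zero]

theorem norm_kernel_Ioi_le_one {w : ℂ} (hw : w.im < 0) (ξ : ℝ) : ‖(Set.Ioi (0 : ℝ)).indicator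
    (fun ξ : ℝ => Complex.exp (-(2 * Real.pi * Complex.I * w) * ξ)) ξ‖ ≤ 1 := by
  by_cases hξ : ξ ∈ Set.Ioi (0 : ℝ)
  · rw [Set.indicator_of_mem hξ, Complex.norm_exp, Complex.re_mul_ofReal, Complex.neg_re,
      re_kernel_exponent, neg_neg, Real.exp_le_one_iff]
    have : 2 * Real.pi * w.im ≤ 0 := mul_nonpos_of_nonneg_of_nonpos (by positivity) hw.le
    exact mul_nonpos_of_nonpos_of_nonneg this (le_of_lt hξ)
  · simp [Set.indicator_of_notMem hξ]

theorem fourierInv_kernel_Ioi {w : ℂ} (hw : w.im < 0) (x : ℝ) :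
    𝓕⁻ ((Set.Ioi (0 : ℝ)).indicator
      fun ξ : ℝ => Complex.exp (-(2 * Real.pi * Complex.I * w) * ξ)) x =
        -(2 * Real.pi * Complex.I)⁻¹ * ((x : ℂ) - w)⁻¹ := by
  have hc : (2 * Real.pi * Complex.I * (x - w) : ℂ).re < 0 := by
    rw [re_kernel_exponent, neg_lt_zero]
    simp only [Complex.sub_im, Complex.ofReal_im, zero_sub]
    nlinarith [Real.pi_pos]
  rw [fourierInv_kernel measurableSet_Ioi, integral_exp_mul_complex_Ioi hc 0]
  simp only [Complex.ofReal_zero, mul_zero, Complex.exp_zero, mul_inv, div_eq_mul_inv]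
  ring

/-- For `Im w < 0` the Cauchy kernel `1 / (x - w)` belongs to `L²₊`. -/
theorem exists_cauchyKernel_of_im_neg {w : ℂ} (hw : w.im < 0) :
    ∃ r : hardy, (r : L2) =ᵐ[volume] fun x : ℝ => ((x : ℂ) - w)⁻¹ := by
  set k := (Set.Ioi (0 : ℝ)).indicator
    fun ξ : ℝ => Complex.exp (-(2 * Real.pi * Complex.I * w) * ξ) with hk
  have h1 : Integrable k := integrable_kernel_Ioi hw
  have h2 : MemLp k 2 := memLp_two_of_bounded h1 (norm_kernel_Ioi_le_one hw)
  have h3 : ∀ x : ℝ, 𝓕⁻ k x = -(2 * Real.pi * Complex.I)⁻¹ * ((x : ℂ) - w)⁻¹ :=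
    fourierInv_kernel_Ioi hw
  have h4 : (h2.toLp k : L2) = 𝓕 (𝓕⁻ (h2.toLp k) : L2) :=
    (FourierTransform.fourier_fourierInv_eq _).symm
  have h5 : (𝓕⁻ (h2.toLp k) : L2) ∈ hardy := by
    rw [mem_hardy, ← h4]
    filter_upwards [h2.coeFn_toLp] with ξ h hξ
    rw [h, hk, Set.indicator_of_notMem (by simpa using hξ.le)]
  refine ⟨-(2 * Real.pi * Complex.I : ℂ) • ⟨_, h5⟩, ?_⟩
  rw [Submodule.coe_smul]
  filter_upwards [Lp.coeFn_smul (-(2 * Real.pi * Complex.I : ℂ)) (𝓕⁻ (h2.toLp k) : L2),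
    fourierInv_toLp_ae h1 h2] with x h6 h7
  rw [h6, Pi.smul_apply, h7, h3, smul_eq_mul, ← mul_assoc, neg_mul_neg, mul_inv_cancel₀, one_mul]
  simp [Real.pi_ne_zero]

theorem norm_kernel_Iic_le_one {w : ℂ} (hw : 0 < w.im) (ξ : ℝ) : ‖(Set.Iic (0 : ℝ)).indicator
    (fun ξ : ℝ => Complex.exp (-(2 * Real.pi * Complex.I * w) * ξ)) ξ‖ ≤ 1 := by
  by_cases hξ : ξ ∈ Set.Iic (0 : ℝ)
  · rw [Set.indicator_of_mem hξ, Complex.norm_exp, Complex.re_mul_ofReal, Complex.neg_re,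
      re_kernel_exponent, neg_neg, Real.exp_le_one_iff]
    exact mul_nonpos_of_nonneg_of_nonpos (by positivity) hξ
  · simp [Set.indicator_of_notMem hξ]

/-- For `Im w > 0` the Fourier transform of `1 / (x - w)` is carried by `(-∞, 0]`. -/
theorem exists_cauchyKernel_of_im_pos {w : ℂ} (hw : 0 < w.im) :
    ∃ r : L2, r =ᵐ[volume] (fun x : ℝ => ((x : ℂ) - w)⁻¹) ∧ (𝓕 r : L2) =ᵐ[volume] fun ξ : ℝ =>
      2 * Real.pi * Complex.I * (Set.Iic (0 : ℝ)).indicator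
        (fun ξ : ℝ => Complex.exp (-(2 * Real.pi * Complex.I * w) * ξ)) ξ := by
  set k := (Set.Iic (0 : ℝ)).indicator
    fun ξ : ℝ => Complex.exp (-(2 * Real.pi * Complex.I * w) * ξ) with hk
  have h1 : Integrable k := integrable_kernel_Iic hw
  have h2 : MemLp k 2 := memLp_two_of_bounded h1 (norm_kernel_Iic_le_one hw)
  have h3 : ∀ x : ℝ, 𝓕⁻ k x = (2 * Real.pi * Complex.I)⁻¹ * ((x : ℂ) - w)⁻¹ := by
    intro x
    have hc : 0 < (2 * Real.pi * Complex.I * (x - w) : ℂ).re := by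
      rw [re_kernel_exponent]
      simp only [Complex.sub_im, Complex.ofReal_im, zero_sub]
      nlinarith [Real.pi_pos]
    rw [hk, fourierInv_kernel measurableSet_Iic, integral_exp_mul_complex_Iic hc 0]
    simp only [Complex.ofReal_zero, mul_zero, Complex.exp_zero, mul_inv, div_eq_mul_inv]
    ring
  have h4 : 𝓕 (𝓕⁻ (h2.toLp k) : L2) = (h2.toLp k : L2) := FourierTransform.fourier_fourierInv_eq _
  refine ⟨(2 * Real.pi * Complex.I : ℂ) • 𝓕⁻ (h2.toLp k), ?_, ?_⟩
  · filter_upwards [Lp.coeFn_smul (2 * Real.pi * Complex.I : ℂ) (𝓕⁻ (h2.toLp k) : L2),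
      fourierInv_toLp_ae h1 h2] with x h6 h7
    rw [h6, Pi.smul_apply, h7, h3, smul_eq_mul, ← mul_assoc, mul_inv_cancel₀, one_mul]
    simp [Real.pi_ne_zero]
  · rw [fourier_smul', h4]
    filter_upwards [Lp.coeFn_smul (2 * Real.pi * Complex.I : ℂ) (h2.toLp k : L2),
      h2.coeFn_toLp] with ξ h6 h7
    rw [h6, Pi.smul_apply, h7, smul_eq_mul]

theorem integral_cauchyKernel_mul {w : ℂ} (hw : w.im < 0) (f : L2) :
    ∫ x : ℝ, ((x : ℂ) - w)⁻¹ * f x = -(2 * Real.pi * Complex.I) *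
      ∫ ξ : ℝ, (Set.Iic (0 : ℝ)).indicator
        (fun ξ : ℝ => Complex.exp (2 * Real.pi * Complex.I * w * ξ)) ξ * (𝓕 f : L2) ξ := by
  obtain ⟨r, hr, hr'⟩ := exists_cauchyKernel_of_im_pos (w := starRingEnd ℂ w)
    (by rw [Complex.conj_im]; linarith)
  have e := Lp.inner_fourier_eq r f
  rw [L2.inner_def, L2.inner_def] at e
  rw [← integral_const_mul]
  refine Eq.trans ?_ (e.symm.trans ?_)
  · refine integral_congr_ae ?_
    filter_upwards [hr] with x hx
    rw [hx, RCLike.inner_apply, map_inv₀, map_sub, Complex.conj_conj, Complex.conj_ofReal, mul_comm]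
  · refine integral_congr_ae ?_
    filter_upwards [hr'] with ξ hξ
    rw [hξ, RCLike.inner_apply]
    by_cases h : ξ ∈ Set.Iic (0 : ℝ)
    · rw [Set.indicator_of_mem h, Set.indicator_of_mem h, map_mul, ← Complex.exp_conj]
      simp only [map_mul, map_neg, Complex.conj_I, Complex.conj_ofReal, Complex.conj_conj, map_ofNat,
        mul_neg, neg_mul, neg_neg]
      ring
    · simp only [Set.indicator_of_notMem h, mul_zero, map_zero, zero_mul]

theorem integral_cauchyKernel_mul_eq_zero {w : ℂ} (hw : w.im < 0) (f : hardy) :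
    ∫ x : ℝ, ((x : ℂ) - w)⁻¹ * (f : L2) x = 0 := by
  rw [integral_cauchyKernel_mul hw, integral_eq_zero_of_ae, mul_zero]
  filter_upwards [mem_hardy.1 f.2, Measure.ae_ne volume (0 : ℝ)] with ξ h h0
  rcases lt_or_gt_of_ne h0 with h1 | h1
  · rw [h h1, mul_zero, Pi.zero_apply]
  · rw [Set.indicator_of_notMem (by simpa using h1), zero_mul, Pi.zero_apply]

/-- Vanishing of the Cauchy integrals on one horizontal line of the lower half-plane characterizes
`L²₊`: on the Fourier side they are the inverse Fourier transform of
`1_{ξ ≤ 0} exp(2πcξ) f̂(ξ)`. -/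
theorem mem_hardy_of_integral_eq_zero {f : L2} {c : ℝ} (hc : 0 < c)
    (h : ∀ w : ℂ, w.im = -c → ∫ x : ℝ, ((x : ℂ) - w)⁻¹ * f x = 0) : f ∈ hardy := by
  have hpi := Real.pi_pos
  set k := (Set.Iic (0 : ℝ)).indicator
    fun ξ : ℝ => Complex.exp (-(2 * Real.pi * Complex.I * (Complex.I * c)) * ξ) with hk
  have him : 0 < (Complex.I * c : ℂ).im := by simpa using hc
  have hk1 : Integrable k := integrable_kernel_Iic him
  have hkb : ∀ ξ, ‖k ξ‖ ≤ 1 := norm_kernel_Iic_le_one him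
  have hk2 : MemLp k 2 := memLp_two_of_bounded hk1 hkb
  have h1 : Integrable fun ξ => k ξ * (𝓕 f : L2) ξ := hk2.integrable_mul (Lp.memLp (𝓕 f : L2))
  have h2 : MemLp (fun ξ => k ξ * (𝓕 f : L2) ξ) 2 := by
    refine (Lp.memLp (𝓕 f : L2)).of_le h1.1 (.of_forall fun ξ => ?_)
    rw [norm_mul]
    exact mul_le_of_le_one_left (norm_nonneg _) (hkb ξ)
  have h3 : ∀ x, 𝓕⁻ (fun ξ => k ξ * (𝓕 f : L2) ξ) x = 0 := by
    intro x
    have e := h (x - Complex.I * c) (by simp)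
    rw [integral_cauchyKernel_mul (by simpa using hc), mul_eq_zero] at e
    rw [← e.resolve_left (by simp [hpi.ne']), Real.fourierInv_eq']
    congr 1 with ξ
    by_cases hξ : ξ ∈ Set.Iic (0 : ℝ)
    · rw [hk, Set.indicator_of_mem hξ, Set.indicator_of_mem hξ, smul_eq_mul, ← mul_assoc,
        ← Complex.exp_add]
      congr 2
      simp only [RCLike.inner_apply, conj_trivial]
      push_cast
      ring
    · simp only [hk, Set.indicator_of_notMem hξ, zero_mul, smul_zero]
  rw [mem_hardy]
  filter_upwards [ae_eq_zero_of_fourierInv_eq_zero h1 h2 h3] with ξ h4 hξ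
  rw [Pi.zero_apply, hk, Set.indicator_of_mem (by simpa using hξ.le), mul_eq_zero] at h4
  exact h4.resolve_left (Complex.exp_ne_zero _)

open Polynomial

/-! ### Functions of Hardy class and rational multipliers -/

/-- The function `F` represents an element of `L²₊`. -/
def InHardy (F : ℝ → ℂ) : Prop := ∃ f : hardy, (f : L2) =ᵐ[volume] F

theorem inHardy_coe (f : hardy) : InHardy (f : L2) := ⟨f, .rfl⟩

theorem InHardy.memLp {F : ℝ → ℂ} (hF : InHardy F) : MemLp F 2 := by
  obtain ⟨f, hf⟩ := hF
  exact (memLp_congr_ae hf).1 (Lp.memLp _)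

theorem InHardy.congr {F G : ℝ → ℂ} (hF : InHardy F) (h : F =ᵐ[volume] G) : InHardy G := by
  obtain ⟨f, hf⟩ := hF
  exact ⟨f, hf.trans h⟩

theorem InHardy.add {F G : ℝ → ℂ} (hF : InHardy F) (hG : InHardy G) :
    InHardy fun x => F x + G x := by
  obtain ⟨f, hf⟩ := hF
  obtain ⟨g, hg⟩ := hG
  refine ⟨f + g, ?_⟩
  filter_upwards [hf, hg, Lp.coeFn_add (f : L2) (g : L2)] with x h1 h2 h3
  rw [Submodule.coe_add, h3, Pi.add_apply, h1, h2]

theorem InHardy.const_mul {F : ℝ → ℂ} (hF : InHardy F) (c : ℂ) : InHardy fun x => c * F x := by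
  obtain ⟨f, hf⟩ := hF
  refine ⟨c • f, ?_⟩
  filter_upwards [hf, Lp.coeFn_smul c (f : L2)] with x h1 h3
  rw [Submodule.coe_smul, h3, Pi.smul_apply, h1, smul_eq_mul]

theorem InHardy.sub {F G : ℝ → ℂ} (hF : InHardy F) (hG : InHardy G) :
    InHardy fun x => F x - G x := by
  refine (hF.add (hG.const_mul (-1))).congr (.of_forall fun x => ?_)
  ring

theorem inHardy_cauchyKernel {w : ℂ} (hw : w.im < 0) : InHardy fun x : ℝ => ((x : ℂ) - w)⁻¹ :=
  exists_cauchyKernel_of_im_neg hw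

theorem InHardy.integral_eq_zero {F : ℝ → ℂ} (hF : InHardy F) {w : ℂ} (hw : w.im < 0) :
    ∫ x : ℝ, ((x : ℂ) - w)⁻¹ * F x = 0 := by
  obtain ⟨f, hf⟩ := hF
  rw [← integral_cauchyKernel_mul_eq_zero hw f]
  refine integral_congr_ae ?_
  filter_upwards [hf] with x hx
  rw [hx]

theorem inHardy_of_integral_eq_zero {F : ℝ → ℂ} (hF : MemLp F 2) {c : ℝ} (hc : 0 < c)
    (h : ∀ w : ℂ, w.im = -c → ∫ x : ℝ, ((x : ℂ) - w)⁻¹ * F x = 0) : InHardy F := by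
  refine ⟨⟨hF.toLp F, mem_hardy_of_integral_eq_zero hc fun w hw => ?_⟩, hF.coeFn_toLp⟩
  rw [← h w hw]
  refine integral_congr_ae ?_
  filter_upwards [hF.coeFn_toLp] with x hx
  rw [hx]

theorem norm_cauchyKernel_le {w : ℂ} (hw : w.im ≠ 0) (x : ℝ) : ‖((x : ℂ) - w)⁻¹‖ ≤ |w.im|⁻¹ := by
  rw [norm_inv]
  refine inv_anti₀ (abs_pos.2 hw) (le_trans (le_of_eq ?_) (Complex.abs_im_le_norm _))
  simp

theorem memLp_cauchyKernel_mul {w : ℂ} (hw : w.im ≠ 0) {F : ℝ → ℂ} (hF : MemLp F 2) :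
    MemLp (fun x : ℝ => ((x : ℂ) - w)⁻¹ * F x) 2 := by
  refine (hF.const_mul ((|w.im|⁻¹ : ℝ) : ℂ)).of_le
    (.mul (Measurable.aestronglyMeasurable (by fun_prop)) hF.1) (.of_forall fun x => ?_)
  rw [norm_mul, norm_mul, Complex.norm_real, Real.norm_of_nonneg (by positivity)]
  exact mul_le_mul_of_nonneg_right (norm_cauchyKernel_le hw x) (norm_nonneg _)

theorem integrable_cauchyKernel_mul {w : ℂ} (hw : w.im < 0) {F : ℝ → ℂ} (hF : MemLp F 2) :
    Integrable (fun x : ℝ => ((x : ℂ) - w)⁻¹ * F x) :=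
  (inHardy_cauchyKernel hw).memLp.integrable_mul hF

/-- If the Cauchy integral of `F ∈ L²₊` at `z` vanishes, then `F / (x - z)` is again in `L²₊`. By
partial fractions its Cauchy integral at `w ≠ z` is a multiple of the difference of those of `F` at
`w` and `z`. For `Im z > 0` the hypothesis says that the holomorphic extension of `F` vanishes at
`z`. -/
theorem InHardy.cauchyKernel_mul_of_integral_eq_zero {F : ℝ → ℂ} (hF : InHardy F) {z : ℂ}
    (hz : z.im ≠ 0) (hi : Integrable fun x : ℝ => ((x : ℂ) - z)⁻¹ * F x)
    (h : ∫ x : ℝ, ((x : ℂ) - z)⁻¹ * F x = 0) : InHardy fun x : ℝ => ((x : ℂ) - z)⁻¹ * F x := by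
  have hc : 0 < |z.im| + 1 := by positivity
  refine inHardy_of_integral_eq_zero (memLp_cauchyKernel_mul hz hF.memLp) hc fun w hw => ?_
  have hw0 : w.im < 0 := by rw [hw]; linarith
  have hwz : w - z ≠ 0 := by
    intro e
    have e2 : w.im = z.im := by rw [sub_eq_zero.1 e]
    have := neg_abs_le z.im
    linarith
  have e : ∀ x : ℝ, ((x : ℂ) - w)⁻¹ * (((x : ℂ) - z)⁻¹ * F x) =
      (w - z)⁻¹ * (((x : ℂ) - w)⁻¹ * F x - ((x : ℂ) - z)⁻¹ * F x) := by
    intro x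
    have h1 := sub_ne_zero_of_im_ne_zero hw0.ne x
    have h2 := sub_ne_zero_of_im_ne_zero hz x
    field_simp
    ring
  simp only [e]
  rw [integral_const_mul, integral_sub (integrable_cauchyKernel_mul hw0 hF.memLp) hi, h,
    hF.integral_eq_zero hw0, sub_zero, mul_zero]

theorem InHardy.cauchyKernel_mul {F : ℝ → ℂ} (hF : InHardy F) {z : ℂ} (hz : z.im < 0) :
    InHardy fun x : ℝ => ((x : ℂ) - z)⁻¹ * F x :=
  hF.cauchyKernel_mul_of_integral_eq_zero hz.ne (integrable_cauchyKernel_mul hz hF.memLp)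
    (hF.integral_eq_zero hz)

/-- A monic polynomial all of whose roots lie in the open lower half-plane. -/
structure LowerMonic (Q : Polynomial ℂ) : Prop where
  monic : Q.Monic
  roots_im_neg : ∀ z : ℂ, Q.IsRoot z → z.im < 0

theorem LowerMonic.exists_eq_mul {Q : ℂ[X]} (hQ : LowerMonic Q) (h : Q.natDegree ≠ 0) :
    ∃ z Q₁, z.im < 0 ∧ LowerMonic Q₁ ∧ Q = (X - C z) * Q₁ ∧ Q.natDegree = Q₁.natDegree + 1 := by
  obtain ⟨z, hz⟩ := IsAlgClosed.exists_root Q (fun h0 => h (natDegree_eq_of_degree_eq_some h0))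
  obtain ⟨Q₁, hQ₁⟩ := dvd_iff_isRoot.2 hz
  have hm : Q₁.Monic := (monic_X_sub_C z).of_mul_monic_left (hQ₁ ▸ hQ.monic)
  refine ⟨z, Q₁, hQ.roots_im_neg z hz, ⟨hm, fun w hw => hQ.roots_im_neg w ?_⟩, hQ₁, ?_⟩
  · rw [hQ₁, IsRoot.def, eval_mul, hw.eq_zero, mul_zero]
  · rw [hQ₁, (monic_X_sub_C z).natDegree_mul hm, natDegree_X_sub_C, add_comm]

theorem LowerMonic.induction {p : ℂ[X] → Prop} (one : p 1)
    (mul : ∀ z Q, z.im < 0 → LowerMonic Q → p Q → p ((X - C z) * Q)) {Q : ℂ[X]}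
    (hQ : LowerMonic Q) : p Q := by
  induction hn : Q.natDegree generalizing Q with
  | zero =>
    rw [hQ.monic.natDegree_eq_zero.1 hn]
    exact one
  | succ n ih =>
    obtain ⟨z, Q₁, hz, h1, h2, h3⟩ := hQ.exists_eq_mul (by omega)
    rw [h2]
    exact mul z Q₁ hz h1 (ih h1 (by omega))

theorem LowerMonic.eval_ne_zero {Q : Polynomial ℂ} (hQ : LowerMonic Q) (x : ℝ) :
    Q.eval (x : ℂ) ≠ 0 := fun h => by
  have := hQ.roots_im_neg x h
  simp at this

/-- Multiplication by a rational function that is bounded at infinity and has its poles in the open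
lower half-plane preserves `L²₊`. -/
theorem InHardy.rational_mul {Q : ℂ[X]} (hQ : LowerMonic Q) {P : ℂ[X]}
    (hP : P.natDegree ≤ Q.natDegree) {F : ℝ → ℂ} (hF : InHardy F) :
    InHardy fun x : ℝ => P.eval (x : ℂ) / Q.eval (x : ℂ) * F x := by
  refine hQ.induction (p := fun Q => ∀ P : ℂ[X], P.natDegree ≤ Q.natDegree → ∀ F, InHardy F →
    InHardy fun x : ℝ => P.eval (x : ℂ) / Q.eval (x : ℂ) * F x) ?_ ?_ P hP F hF
  · intro P hP F hF
    rw [natDegree_one, Nat.le_zero, natDegree_eq_zero] at hP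
    obtain ⟨c, rfl⟩ := hP
    simpa using hF.const_mul c
  · intro z Q hz hQ ih P hP F hF
    have hd : ((X - C z) * Q).natDegree = Q.natDegree + 1 := by
      rw [(monic_X_sub_C z).natDegree_mul hQ.monic, natDegree_X_sub_C, add_comm]
    have h1 : (P /ₘ (X - C z)).natDegree ≤ Q.natDegree := by
      rw [natDegree_divByMonic _ (monic_X_sub_C z), natDegree_X_sub_C]
      omega
    have h2 : (1 : ℂ[X]).natDegree ≤ Q.natDegree := by simp
    refine ((ih _ h1 F hF).add (((ih _ h2 F hF).cauchyKernel_mul hz).const_mul (P.eval z))).congr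
      (.of_forall fun x => ?_)
    have h3 := hQ.eval_ne_zero x
    have h4 := sub_ne_zero_of_im_ne_zero hz.ne x
    have h5 := congrArg (fun R : ℂ[X] => R.eval (x : ℂ)) (modByMonic_add_div P (X - C z))
    simp only [modByMonic_X_sub_C_eq_C_eval, eval_add, eval_C, eval_mul, eval_sub, eval_X] at h5
    simp only [eval_mul, eval_sub, eval_X, eval_C, eval_one, ← h5]
    field_simp
    ring

/-- A rational function `P / Q` vanishing at infinity, with poles in the open lower half-plane, is in
`L²₊` and its product with any element of `L²₊` has integral zero. Splitting off one root `z` of `Q`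
reduces both claims to the Cauchy kernel `1 / (x - z)`. -/
theorem inHardy_rational_and_integral {Q : ℂ[X]} (hQ : LowerMonic Q) {P : ℂ[X]}
    (hP : P.natDegree < Q.natDegree) :
    InHardy (fun x : ℝ => P.eval (x : ℂ) / Q.eval (x : ℂ)) ∧
      ∀ F, InHardy F → ∫ x : ℝ, P.eval (x : ℂ) / Q.eval (x : ℂ) * F x = 0 := by
  obtain ⟨z, Q₁, hz, hQ₁, rfl, hd⟩ := hQ.exists_eq_mul (by omega)
  have hP1 : P.natDegree ≤ Q₁.natDegree := by omega
  constructor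
  · refine ((inHardy_cauchyKernel hz).rational_mul hQ₁ hP1).congr (.of_forall fun x => ?_)
    have h3 := hQ₁.eval_ne_zero x
    have h4 := sub_ne_zero_of_im_ne_zero hz.ne x
    simp only [eval_mul, eval_sub, eval_X, eval_C]
    field_simp
  · intro F hF
    rw [← (hF.rational_mul hQ₁ hP1).integral_eq_zero hz]
    congr 1 with x
    have h3 := hQ₁.eval_ne_zero x
    have h4 := sub_ne_zero_of_im_ne_zero hz.ne x
    simp only [eval_mul, eval_sub, eval_X, eval_C]
    field_simp

theorem inHardy_rational {Q : Polynomial ℂ} (hQ : LowerMonic Q) {P : Polynomial ℂ}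
    (hP : P.natDegree < Q.natDegree) : InHardy fun x : ℝ => P.eval (x : ℂ) / Q.eval (x : ℂ) :=
  (inHardy_rational_and_integral hQ hP).1

theorem integral_rational_mul_eq_zero {Q : Polynomial ℂ} (hQ : LowerMonic Q) {P : Polynomial ℂ}
    (hP : P.natDegree < Q.natDegree) {F : ℝ → ℂ} (hF : InHardy F) :
    ∫ x : ℝ, P.eval (x : ℂ) / Q.eval (x : ℂ) * F x = 0 :=
  (inHardy_rational_and_integral hQ hP).2 F hF

/-! ### The inner function and the decomposition of `L²₊` -/

/-- The polynomial whose coefficients are the conjugates of those of `Q`. -/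
abbrev conjPoly (Q : Polynomial ℂ) : Polynomial ℂ := Q.map (starRingEnd ℂ)

theorem eval_conjPoly (Q : Polynomial ℂ) (x : ℝ) :
    (conjPoly Q).eval (x : ℂ) = starRingEnd ℂ (Q.eval (x : ℂ)) := by
  rw [← Polynomial.eval_map_apply, Complex.conj_ofReal]

theorem conjPoly_conjPoly (Q : Polynomial ℂ) : conjPoly (conjPoly Q) = Q := by
  ext n
  simp

theorem natDegree_conjPoly (Q : Polynomial ℂ) : (conjPoly Q).natDegree = Q.natDegree :=
  Polynomial.natDegree_map _

theorem LowerMonic.eval_conjPoly_ne_zero {Q : Polynomial ℂ} (hQ : LowerMonic Q) (x : ℝ) :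
    (conjPoly Q).eval (x : ℂ) ≠ 0 := by
  rw [eval_conjPoly]
  simpa using hQ.eval_ne_zero x

theorem norm_innerFunction {Q : Polynomial ℂ} (hQ : LowerMonic Q) (x : ℝ) :
    ‖innerFunction Q x‖ = 1 := by
  have h := hQ.eval_ne_zero x
  rw [innerFunction, norm_div, eval_conjPoly, RCLike.norm_conj, div_self (norm_ne_zero_iff.2 h)]

theorem InHardy.innerFunction_mul {Q : Polynomial ℂ} (hQ : LowerMonic Q) {F : ℝ → ℂ}
    (hF : InHardy F) : InHardy fun x => innerFunction Q x * F x :=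
  hF.rational_mul hQ (natDegree_conjPoly Q).le

/-- The decomposition for a single Blaschke factor: subtract the multiple of `1 / (x - z)` with the
same Cauchy integral at `z̄`, and divide by the Blaschke factor. -/
theorem InHardy.exists_blaschke_decomposition {F : ℝ → ℂ} (hF : InHardy F) {z : ℂ} (hz : z.im < 0) :
    ∃ (G : ℝ → ℂ) (c : ℂ), InHardy G ∧ ∀ x : ℝ,
      F x = ((x : ℂ) - starRingEnd ℂ z) / ((x : ℂ) - z) * G x + c / ((x : ℂ) - z) := by
  have hz' : (starRingEnd ℂ z).im ≠ 0 := by simpa using hz.ne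
  have hL : ∀ G : ℝ → ℂ, InHardy G → Integrable fun x : ℝ => ((x : ℂ) - starRingEnd ℂ z)⁻¹ * G x := by
    intro G hG
    refine MemLp.integrable_mul ((inHardy_cauchyKernel hz).memLp.star) hG.memLp |>.congr
      (.of_forall fun x => ?_)
    simp
  have hr := inHardy_cauchyKernel hz
  have hne : ∫ x : ℝ, ((x : ℂ) - starRingEnd ℂ z)⁻¹ * ((x : ℂ) - z)⁻¹ ≠ 0 := by
    have e : ∀ x : ℝ, ((x : ℂ) - starRingEnd ℂ z)⁻¹ * ((x : ℂ) - z)⁻¹ =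
        ((‖((x : ℂ) - z)⁻¹‖ ^ 2 : ℝ) : ℂ) := by
      intro x
      rw [Complex.ofReal_pow, ← Complex.conj_mul', map_inv₀, map_sub, Complex.conj_ofReal]
    simp only [e]
    rw [integral_complex_ofReal, Complex.ofReal_ne_zero]
    refine ((integral_pos_iff_support_of_nonneg (fun x => by positivity)
      ((memLp_two_iff_integrable_sq_norm hr.memLp.1).1 hr.memLp)).2 ?_).ne'
    have : (Function.support fun x : ℝ => ‖((x : ℂ) - z)⁻¹‖ ^ 2) = Set.univ := by
      ext x
      simp [sub_ne_zero_of_im_ne_zero hz.ne x]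
    rw [this]
    simp
  set I := ∫ x : ℝ, ((x : ℂ) - starRingEnd ℂ z)⁻¹ * ((x : ℂ) - z)⁻¹ with hI
  set c := (∫ x : ℝ, ((x : ℂ) - starRingEnd ℂ z)⁻¹ * F x) / I with hc
  have hF1 : InHardy fun x : ℝ => F x - c * ((x : ℂ) - z)⁻¹ := hF.sub (hr.const_mul c)
  have h0 : ∫ x : ℝ, ((x : ℂ) - starRingEnd ℂ z)⁻¹ * (F x - c * ((x : ℂ) - z)⁻¹) = 0 := by
    have e : ∀ x : ℝ, ((x : ℂ) - starRingEnd ℂ z)⁻¹ * (F x - c * ((x : ℂ) - z)⁻¹) =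
        ((x : ℂ) - starRingEnd ℂ z)⁻¹ * F x -
          c * (((x : ℂ) - starRingEnd ℂ z)⁻¹ * ((x : ℂ) - z)⁻¹) := fun x => by ring
    simp only [e]
    rw [integral_sub (hL F hF) ((hL _ hr).const_mul c), integral_const_mul, hc,
      div_mul_cancel₀ _ hne, sub_self]
  have hG := hF1.cauchyKernel_mul_of_integral_eq_zero hz' (hL _ hF1) h0
  refine ⟨_, c, hF1.add (hG.const_mul (starRingEnd ℂ z - z)), fun x => ?_⟩
  have h1 := sub_ne_zero_of_im_ne_zero hz.ne x
  have h2 := sub_ne_zero_of_im_ne_zero hz' x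
  field_simp
  ring

theorem conjPoly_X_sub_C_mul (z : ℂ) (Q : ℂ[X]) :
    conjPoly ((X - C z) * Q) = (X - C (starRingEnd ℂ z)) * conjPoly Q := by
  simp [conjPoly]

/-- `L²₊ = Θ_Q L²₊ + ℂ_{<deg Q}[X] / Q`, by induction on the number of roots of `Q`. -/
theorem InHardy.exists_decomposition {Q : ℂ[X]} (hQ : LowerMonic Q) {F : ℝ → ℂ} (hF : InHardy F) :
    ∃ (H : ℝ → ℂ) (P : ℂ[X]), InHardy H ∧ P.degree < Q.natDegree ∧ ∀ x : ℝ,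
      F x = innerFunction Q x * H x + P.eval (x : ℂ) / Q.eval (x : ℂ) := by
  refine hQ.induction (p := fun Q => ∀ F, InHardy F → ∃ (H : ℝ → ℂ) (P : ℂ[X]), InHardy H ∧
    P.degree < Q.natDegree ∧ ∀ x : ℝ,
      F x = innerFunction Q x * H x + P.eval (x : ℂ) / Q.eval (x : ℂ)) ?_ ?_ F hF
  · intro F hF
    exact ⟨F, 0, hF, by simp, fun x => by simp [innerFunction]⟩
  · intro z Q hz hQ ih F hF
    obtain ⟨G, c, hG, h1⟩ := hF.exists_blaschke_decomposition hz
    obtain ⟨H, P, hH, hP, h2⟩ := ih G hG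
    have hd : ((X - C z) * Q).natDegree = Q.natDegree + 1 := by
      rw [(monic_X_sub_C z).natDegree_mul hQ.monic, natDegree_X_sub_C, add_comm]
    refine ⟨H, (X - C (starRingEnd ℂ z)) * P + C c * Q, hH, ?_, fun x => ?_⟩
    · rw [hd]
      refine (degree_add_le _ _).trans_lt (max_lt ?_ ?_)
      · rw [degree_mul, degree_X_sub_C, add_comm, Nat.cast_add, Nat.cast_one]
        exact WithBot.add_lt_add_right (by simp) hP
      · refine (degree_le_of_natDegree_le
          (natDegree_C_mul_le c Q)).trans_lt ?_
        exact_mod_cast Nat.lt_succ_self _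
    · have h3 := sub_ne_zero_of_im_ne_zero hz.ne x
      have h4 := hQ.eval_ne_zero x
      rw [h1, h2]
      have e := conjPoly_X_sub_C_mul z Q
      rw [conjPoly, conjPoly] at e
      simp only [innerFunction, e, eval_mul, eval_add, eval_sub, eval_X, eval_C]
      field_simp
      ring

/-- Multiplication by the inner function `Θ_Q`, as an isometry of `L²₊`. -/
def mulInner {Q : Polynomial ℂ} (hQ : LowerMonic Q) : hardy →ₗᵢ[ℂ] hardy where
  toFun h := ((inHardy_coe h).innerFunction_mul hQ).choose
  map_add' f g := by
    ext1
    apply Lp.ext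
    filter_upwards [((inHardy_coe (f + g)).innerFunction_mul hQ).choose_spec,
      ((inHardy_coe f).innerFunction_mul hQ).choose_spec,
      ((inHardy_coe g).innerFunction_mul hQ).choose_spec, Lp.coeFn_add (f : L2) (g : L2),
      Lp.coeFn_add (((inHardy_coe f).innerFunction_mul hQ).choose : L2)
        ((inHardy_coe g).innerFunction_mul hQ).choose] with x h1 h2 h3 h4 h5
    rw [h1, Submodule.coe_add, Submodule.coe_add, h4, h5, Pi.add_apply, Pi.add_apply, h2, h3,
      mul_add]
  map_smul' c f := by
    ext1
    apply Lp.ext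
    filter_upwards [((inHardy_coe (c • f)).innerFunction_mul hQ).choose_spec,
      ((inHardy_coe f).innerFunction_mul hQ).choose_spec, Lp.coeFn_smul c (f : L2),
      Lp.coeFn_smul c (((inHardy_coe f).innerFunction_mul hQ).choose : L2)] with x h1 h2 h3 h4
    rw [h1, RingHom.id_apply, Submodule.coe_smul, Submodule.coe_smul, h3, h4, Pi.smul_apply,
      Pi.smul_apply, h2, smul_eq_mul, smul_eq_mul, mul_left_comm]
  norm_map' h := by
    have e := ((inHardy_coe h).innerFunction_mul hQ).choose_spec
    refine le_antisymm (Lp.norm_le_norm_of_ae_le ?_) (Lp.norm_le_norm_of_ae_le ?_)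
    all_goals
      filter_upwards [e] with x hx
      exact le_of_eq (by simp [hx, norm_innerFunction hQ])

theorem mulInner_coe {Q : Polynomial ℂ} (hQ : LowerMonic Q) (h : hardy) :
    (mulInner hQ h : L2) =ᵐ[volume] fun x => innerFunction Q x * (h : L2) x :=
  ((inHardy_coe h).innerFunction_mul hQ).choose_spec

theorem mem_innerRange_iff {Q : Polynomial ℂ} (hQ : LowerMonic Q) {f : hardy} :
    f ∈ innerRange Q ↔ ∃ h, mulInner hQ h = f := by
  constructor
  · rintro ⟨h, hf⟩
    refine ⟨h, ?_⟩
    ext1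
    exact Lp.ext ((mulInner_coe hQ h).trans hf.symm)
  · rintro ⟨h, rfl⟩
    exact ⟨h, mulInner_coe hQ h⟩

theorem inHardy_rational_of_degree_lt {Q : Polynomial ℂ} (hQ : LowerMonic Q) {P : Polynomial ℂ}
    (hP : P.degree < Q.natDegree) : InHardy fun x : ℝ => P.eval (x : ℂ) / Q.eval (x : ℂ) := by
  by_cases h : P = 0
  · refine ⟨0, ?_⟩
    simp only [h, Polynomial.eval_zero, zero_div]
    exact Lp.coeFn_zero ℂ 2 (volume : Measure ℝ)
  · exact inHardy_rational hQ ((Polynomial.natDegree_lt_iff_degree_lt h).2 hP)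

theorem integral_rational_mul_eq_zero_of_degree_lt {Q : Polynomial ℂ} (hQ : LowerMonic Q)
    {P : Polynomial ℂ} (hP : P.degree < Q.natDegree) {F : ℝ → ℂ} (hF : InHardy F) :
    ∫ x : ℝ, P.eval (x : ℂ) / Q.eval (x : ℂ) * F x = 0 := by
  by_cases h : P = 0
  · simp [h]
  · exact integral_rational_mul_eq_zero hQ ((Polynomial.natDegree_lt_iff_degree_lt h).2 hP) hF

theorem degree_conjPoly (P : Polynomial ℂ) : (conjPoly P).degree = P.degree :=
  Polynomial.degree_map _ _

theorem inner_mulInner_rational {Q : Polynomial ℂ} (hQ : LowerMonic Q) {P : Polynomial ℂ}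
    (hP : P.degree < Q.natDegree) {f : hardy}
    (hf : (f : L2) =ᵐ[volume] fun x : ℝ => P.eval (x : ℂ) / Q.eval (x : ℂ)) (h : hardy) :
    inner ℂ (mulInner hQ h) f = 0 := by
  rw [Submodule.coe_inner, L2.inner_def]
  have e := integral_rational_mul_eq_zero_of_degree_lt hQ (P := conjPoly P)
    (by rwa [degree_conjPoly]) (inHardy_coe h)
  rw [← map_zero (starRingEnd ℂ), ← e, ← integral_conj]
  refine integral_congr_ae ?_
  filter_upwards [hf, mulInner_coe hQ h] with x h1 h2
  have h3 := hQ.eval_ne_zero x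
  have h4 := hQ.eval_conjPoly_ne_zero x
  rw [h1, h2, RCLike.inner_apply, innerFunction]
  simp only [map_mul, map_div₀, ← eval_conjPoly, conjPoly_conjPoly]
  field_simp

theorem exists_mulInner_add_rational {Q : Polynomial ℂ} (hQ : LowerMonic Q) (f : hardy) :
    ∃ (h p : hardy) (P : Polynomial ℂ), P.degree < Q.natDegree ∧
      (p : L2) =ᵐ[volume] (fun x : ℝ => P.eval (x : ℂ) / Q.eval (x : ℂ)) ∧
      f = mulInner hQ h + p := by
  obtain ⟨H, P, ⟨h, hH⟩, hP, hd⟩ := (inHardy_coe f).exists_decomposition hQ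
  obtain ⟨p, hp⟩ := inHardy_rational_of_degree_lt hQ hP
  refine ⟨h, p, P, hP, hp, ?_⟩
  ext1
  apply Lp.ext
  rw [Submodule.coe_add]
  filter_upwards [Lp.coeFn_add (mulInner hQ h : L2) (p : L2), mulInner_coe hQ h, hH, hp]
    with x h1 h2 h3 h4
  rw [h1, Pi.add_apply, h2, h3, h4, hd]

/-- `K_{Θ_Q} = ℂ_{<deg Q}[X] / Q`: the quotients are orthogonal to `Θ_Q L²₊`, and together the two
spaces span `L²₊`. -/
theorem mem_modelSpace_iff {Q : Polynomial ℂ} (hQ : LowerMonic Q) {f : hardy} :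
    f ∈ modelSpace Q ↔ ∃ P : Polynomial ℂ, P.degree < Q.natDegree ∧
      (f : L2) =ᵐ[volume] fun x : ℝ => P.eval (x : ℂ) / Q.eval (x : ℂ) := by
  constructor
  · intro hf
    obtain ⟨h, p, P, hP, hp, e⟩ := exists_mulInner_add_rational hQ f
    have h1 : inner ℂ (mulInner hQ h) f = 0 :=
      hf _ ((mem_innerRange_iff hQ).2 ⟨h, rfl⟩)
    rw [e, inner_add_right, inner_mulInner_rational hQ hP hp, add_zero, inner_self_eq_zero] at h1
    rw [h1, zero_add] at e
    exact ⟨P, hP, e ▸ hp⟩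
  · rintro ⟨P, hP, hf⟩ g hg
    obtain ⟨h, rfl⟩ := (mem_innerRange_iff hQ).1 hg
    exact inner_mulInner_rational hQ hP hf h

theorem exists_mulInner_add_modelSpace {Q : Polynomial ℂ} (hQ : LowerMonic Q) (f : hardy) :
    ∃ h, ∃ k ∈ modelSpace Q, f = mulInner hQ h + k := by
  obtain ⟨h, p, P, hP, hp, e⟩ := exists_mulInner_add_rational hQ f
  exact ⟨h, p, (mem_modelSpace_iff hQ).2 ⟨P, hP, hp⟩, e⟩

theorem polynomial_eq_of_ae_eq {P R : Polynomial ℂ}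
    (h : ∀ᵐ x : ℝ, P.eval (x : ℂ) = R.eval (x : ℂ)) : P = R := by
  have e : (fun x : ℝ => P.eval (x : ℂ)) = fun x : ℝ => R.eval (x : ℂ) :=
    (Continuous.ae_eq_iff_eq volume (by fun_prop) (by fun_prop)).1 h
  refine Polynomial.eq_of_infinite_eval_eq P R ?_
  refine (Set.infinite_range_of_injective Complex.ofReal_injective).mono ?_
  rintro _ ⟨x, rfl⟩
  exact congrFun e x

/-- The linear map `P ↦ P / Q` from the polynomials of degree less than `deg Q` onto `K_{Θ_Q}`. -/
def rationalEquiv {Q : Polynomial ℂ} (hQ : LowerMonic Q) :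
    Polynomial.degreeLT ℂ Q.natDegree ≃ₗ[ℂ] modelSpace Q :=
  LinearEquiv.ofBijective
    { toFun := fun P => ⟨(inHardy_rational_of_degree_lt hQ (Polynomial.mem_degreeLT.1 P.2)).choose,
        (mem_modelSpace_iff hQ).2 ⟨P, Polynomial.mem_degreeLT.1 P.2,
          (inHardy_rational_of_degree_lt hQ (Polynomial.mem_degreeLT.1 P.2)).choose_spec⟩⟩
      map_add' := fun P R => by
        ext1; ext1
        apply Lp.ext
        simp only [Submodule.coe_add]
        have h := fun P : Polynomial.degreeLT ℂ Q.natDegree =>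
          (inHardy_rational_of_degree_lt hQ (Polynomial.mem_degreeLT.1 P.2)).choose_spec
        filter_upwards [h (P + R), h P, h R, Lp.coeFn_add (_ : L2) (_ : L2)] with x h1 h2 h3 h4
        refine h1.trans (Eq.trans ?_ h4.symm)
        rw [Pi.add_apply, h2, h3, Submodule.coe_add, Polynomial.eval_add, add_div]
      map_smul' := fun c P => by
        ext1; ext1
        apply Lp.ext
        simp only [Submodule.coe_smul]
        have h := fun P : Polynomial.degreeLT ℂ Q.natDegree =>
          (inHardy_rational_of_degree_lt hQ (Polynomial.mem_degreeLT.1 P.2)).choose_spec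
        filter_upwards [h (c • P), h P, Lp.coeFn_smul c (_ : L2)] with x h1 h2 h4
        refine h1.trans (Eq.trans ?_ h4.symm)
        rw [Pi.smul_apply, h2, Submodule.coe_smul, Polynomial.eval_smul,
          smul_eq_mul, smul_eq_mul, mul_div_assoc] }
    (by
      have h := fun P : Polynomial.degreeLT ℂ Q.natDegree =>
        (inHardy_rational_of_degree_lt hQ (Polynomial.mem_degreeLT.1 P.2)).choose_spec
      constructor
      · intro P R hPR
        have e := congrArg (fun k : modelSpace Q => ((k : hardy) : L2)) hPR
        ext1
        apply polynomial_eq_of_ae_eq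
        have e2 := (h P).symm.trans ((Lp.ext_iff.1 e).trans (h R))
        filter_upwards [e2] with x hx
        exact (div_left_inj' (hQ.eval_ne_zero x)).1 hx
      · intro k
        obtain ⟨P, hP, hk⟩ := (mem_modelSpace_iff hQ).1 k.2
        refine ⟨⟨P, Polynomial.mem_degreeLT.2 hP⟩, ?_⟩
        ext1; ext1
        exact Lp.ext ((h _).trans hk.symm))

theorem finrank_modelSpace {Q : Polynomial ℂ} (hQ : LowerMonic Q) :
    Module.finrank ℂ (modelSpace Q) = Q.natDegree := by
  rw [← (rationalEquiv hQ).finrank_eq, (Polynomial.degreeLTEquiv ℂ Q.natDegree).finrank_eq]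
  simp

theorem finiteDimensional_modelSpace {Q : Polynomial ℂ} (hQ : LowerMonic Q) :
    FiniteDimensional ℂ (modelSpace Q) := by
  have : FiniteDimensional ℂ (Polynomial.degreeLT ℂ Q.natDegree) :=
    (Polynomial.degreeLTEquiv ℂ Q.natDegree).symm.finiteDimensional
  exact (rationalEquiv hQ).finiteDimensional

/-! ### Derivatives of rational functions as distributions -/

theorem hasTemperateGrowth_eval (P : Polynomial ℂ) :
    (fun x : ℝ => P.eval (x : ℂ)).HasTemperateGrowth := by
  induction P using Polynomial.induction_on' with
  | add P R hP hR => simpa only [Polynomial.eval_add] using! hP.add hR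
  | monomial n c =>
    simp only [Polynomial.eval_monomial]
    exact (Function.HasTemperateGrowth.const c).mul (Function.HasTemperateGrowth.pow (by fun_prop) n)

theorem hasTemperateGrowth_cauchyKernel {w : ℂ} (hw : w.im ≠ 0) :
    (fun x : ℝ => ((x : ℂ) - w)⁻¹).HasTemperateGrowth := by
  have h1 : (fun x : ℝ => ((x - w.re) / w.im : ℝ)).HasTemperateGrowth := by
    simp only [div_eq_mul_inv]
    fun_prop
  have h2 : (fun x : ℝ => (1 + ‖(x - w.re) / w.im‖ ^ 2) ^ (-1 : ℝ)).HasTemperateGrowth :=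
    (Function.hasTemperateGrowth_one_add_norm_sq_rpow ℝ (-1)).comp h1
  have h3 : (fun x : ℝ => (((1 + ‖(x - w.re) / w.im‖ ^ 2) ^ (-1 : ℝ) : ℝ) : ℂ)).HasTemperateGrowth :=
    (Function.Complex.hasTemperateGrowth_ofReal).comp h2
  have h4 : (fun x : ℝ => ((w.im ^ 2)⁻¹ : ℂ) * ((x : ℂ) - starRingEnd ℂ w)).HasTemperateGrowth := by
    fun_prop
  refine Eq.mp (congrArg Function.HasTemperateGrowth (funext fun x => ?_)) (h4.mul h3)
  have h5 := sub_ne_zero_of_im_ne_zero hw x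
  have h6 : (x : ℂ) - starRingEnd ℂ w ≠ 0 :=
    sub_ne_zero_of_im_ne_zero (by rwa [Complex.conj_im, neg_ne_zero]) x
  have h7 : ((x : ℂ) - w) * ((x : ℂ) - starRingEnd ℂ w) =
      (w.im ^ 2 * (1 + ‖(x - w.re) / w.im‖ ^ 2) : ℝ) := by
    have e : w.im ^ 2 * (1 + ‖(x - w.re) / w.im‖ ^ 2) = (x - w.re) ^ 2 + w.im ^ 2 := by
      rw [Real.norm_eq_abs, sq_abs]
      field_simp
      ring
    rw [e]
    apply Complex.ext
    · simp [sq]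
    · simp [sq]
      ring
  simp only [Pi.mul_apply]
  rw [Real.rpow_neg_one, Complex.ofReal_inv, mul_right_comm, ← mul_inv, ← Complex.ofReal_pow,
    ← Complex.ofReal_mul, ← h7]
  field_simp

theorem LowerMonic.hasTemperateGrowth_inv {Q : Polynomial ℂ} (hQ : LowerMonic Q) :
    (fun x : ℝ => (Q.eval (x : ℂ))⁻¹).HasTemperateGrowth := by
  refine hQ.induction (p := fun Q => (fun x : ℝ => (Q.eval (x : ℂ))⁻¹).HasTemperateGrowth) ?_ ?_
  · simp
  · intro z Q hz hQ ih
    simp only [Polynomial.eval_mul, mul_inv, Polynomial.eval_sub, Polynomial.eval_X,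
      Polynomial.eval_C]
    exact (hasTemperateGrowth_cauchyKernel hz.ne).mul ih

theorem LowerMonic.hasTemperateGrowth_div {Q : Polynomial ℂ} (hQ : LowerMonic Q)
    (P : Polynomial ℂ) : (fun x : ℝ => P.eval (x : ℂ) / Q.eval (x : ℂ)).HasTemperateGrowth := by
  simp only [div_eq_mul_inv]
  exact (hasTemperateGrowth_eval P).mul hQ.hasTemperateGrowth_inv

theorem LowerMonic.mul {Q R : Polynomial ℂ} (hQ : LowerMonic Q) (hR : LowerMonic R) :
    LowerMonic (Q * R) :=
  ⟨hQ.monic.mul hR.monic, fun z hz => by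
    rcases Polynomial.root_mul.1 hz with h | h
    exacts [hQ.roots_im_neg z h, hR.roots_im_neg z h]⟩

theorem LowerMonic.hasDerivAt_div {Q : ℂ[X]} (hQ : LowerMonic Q) (P : ℂ[X]) (x : ℝ) :
    HasDerivAt (fun x : ℝ => P.eval (x : ℂ) / Q.eval (x : ℂ))
      ((derivative P * Q - P * derivative Q).eval (x : ℂ) / (Q * Q).eval (x : ℂ)) x := by
  have h := ((P.hasDerivAt (x : ℂ)).comp_ofReal).fun_div ((Q.hasDerivAt (x : ℂ)).comp_ofReal)
    (hQ.eval_ne_zero x)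
  simpa only [eval_sub, eval_mul, sq] using h

/-- A pointwise derivative in `L²` of a function in `L²` is its distributional derivative. -/
theorem deriv_eq_of_hasDerivAt {f g : L2} {F F' : ℝ → ℂ} (hd : ∀ x, HasDerivAt F (F' x) x)
    (hf : f =ᵐ[volume] F) (hg : g =ᵐ[volume] fun x => -Complex.I * F' x) :
    (g : 𝓢'(ℝ, ℂ)) = -Complex.I • ∂_{(1 : ℝ)} (f : 𝓢'(ℝ, ℂ)) := by
  have hF : MemLp F 2 := (memLp_congr_ae hf).1 (Lp.memLp f)
  have hF' : MemLp F' 2 := by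
    have h := ((memLp_congr_ae hg).1 (Lp.memLp g)).const_mul Complex.I
    refine (memLp_congr_ae (.of_forall fun x => ?_)).1 h
    linear_combination (-F' x) * Complex.I_sq
  ext φ
  have hφ : ∀ x, HasDerivAt φ (∂_{(1 : ℝ)} φ x) x := by
    intro x
    rw [SchwartzMap.lineDerivOp_apply_eq_fderiv, fderiv_eq_smul_deriv, one_smul]
    exact φ.differentiableAt.hasDerivAt
  have e := integral_mul_deriv_eq_deriv_mul_of_integrable (fun x _ => hd x) (fun x _ => hφ x)
    (hF.integrable_mul ((∂_{(1 : ℝ)} φ).memLp 2 volume)) (hF'.integrable_mul (φ.memLp 2 volume))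
    (hF.integrable_mul (φ.memLp 2 volume))
  simp only [_root_.smul_apply, TemperedDistribution.lineDerivOp_apply_apply,
    Lp.toTemperedDistribution_apply, neg_apply, smul_eq_mul]
  have e1 : ∫ x, φ x * g x = -Complex.I * ∫ x, F' x * φ x := by
    rw [← integral_const_mul]
    refine integral_congr_ae ?_
    filter_upwards [hg] with x hx
    rw [hx]
    ring
  have e2 : ∫ x, -∂_{(1 : ℝ)} φ x * f x = -∫ x, F x * ∂_{(1 : ℝ)} φ x := by
    rw [← integral_neg]
    refine integral_congr_ae ?_
    filter_upwards [hf] with x hx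
    rw [hx]
    ring
  rw [e1, e2, e]
  ring

/-! ### The action of the Lax operator on `Θ L²₊` and on `K_Θ` -/

/-- If `-i f' = d` and `u f = t + s̄` with `t ∈ L²₊` and `s̄ ⟂ L²₊`, then `L_u f = d - t`. -/
theorem laxOperator_eq {u : Lp ℝ 2 (volume : Measure ℝ)} {f d t : hardy} {s : ℝ → ℂ}
    (hd : ((d : L2) : 𝓢'(ℝ, ℂ)) = -Complex.I • ∂_{(1 : ℝ)} ((f : L2) : 𝓢'(ℝ, ℂ)))
    (hs : MemLp s 2) (hs0 : ∀ F, InHardy F → ∫ x, s x * F x = 0)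
    (h : ∀ᵐ x, (u x : ℂ) * (f : L2) x = (t : L2) x + starRingEnd ℂ (s x)) :
    ∃ hm : f ∈ (laxOperator u).domain, laxOperator u ⟨f, hm⟩ = d - t := by
  obtain ⟨F, hF, hFd⟩ := exists_hardySobolev_of_deriv f.2 hd
  have e : (F : hardy) = f := Subtype.ext hF
  subst e
  refine ⟨F.2, ?_⟩
  change opD F - toeplitz u F = d - t
  congr 1
  · exact Subtype.ext hFd
  · refine szego_eq_of_forall_inner fun g => ?_
    rw [Submodule.coe_inner, L2.inner_def, L2.inner_def]
    have hi1 : Integrable fun x => inner ℂ ((t : L2) x) ((g : L2) x) := L2.integrable_inner _ _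
    have hi2 : Integrable fun x => s x * (g : L2) x := hs.integrable_mul (Lp.memLp _)
    have h0 : ∫ x, inner ℂ ((t : L2) x) ((g : L2) x) =
        (∫ x, inner ℂ ((t : L2) x) ((g : L2) x)) + ∫ x, s x * (g : L2) x := by
      rw [hs0 _ (inHardy_coe g), add_zero]
    rw [h0, ← integral_add hi1 hi2]
    refine integral_congr_ae ?_
    filter_upwards [(memLp_mul u F).coeFn_toLp, h] with x h1 h2
    rw [h1, h2]
    simp only [RCLike.inner_apply, map_add, Complex.conj_conj]
    ring

/-- The explicit form `u = i Q' / Q - i Q̄' / Q̄`, almost everywhere, of a multi-soliton whose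
characteristic polynomial is `Q`. -/
def IsSolitonOf (u : Lp ℝ 2 (volume : Measure ℝ)) (Q : Polynomial ℂ) : Prop :=
  ∀ᵐ x : ℝ, (u x : ℂ) = Complex.I * (Q.derivative.eval (x : ℂ) / Q.eval (x : ℂ)) -
    Complex.I * ((conjPoly Q).derivative.eval (x : ℂ) / (conjPoly Q).eval (x : ℂ))

theorem natDegree_wronskian_le {Q : ℂ[X]} (hQ : LowerMonic Q) {P : ℂ[X]}
    (hP : P.natDegree ≤ Q.natDegree) :
    (derivative P * Q - P * derivative Q).natDegree ≤ (Q * Q).natDegree := by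
  rw [hQ.monic.natDegree_mul hQ.monic]
  refine (natDegree_sub_le _ _).trans (max_le ?_ ?_)
  · refine natDegree_mul_le.trans ?_
    have := natDegree_derivative_le P
    omega
  · refine natDegree_mul_le.trans ?_
    have := natDegree_derivative_le Q
    omega

theorem natDegree_lt_of_degree_lt {Q P : ℂ[X]} (hN : Q.natDegree ≠ 0) (hP : P.degree < Q.natDegree) :
    P.natDegree < Q.natDegree := by
  by_cases h0 : P = 0
  · rw [h0, natDegree_zero]
    omega
  · exact (natDegree_lt_iff_degree_lt h0).2 hP

/-- `L_u (Θ h) = Θ D h` for `h ∈ H¹₊`, because `-i Θ' = u Θ`. -/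
theorem laxOperator_mulInner {Q : ℂ[X]} (hQ : LowerMonic Q) {u : Lp ℝ 2 (volume : Measure ℝ)}
    (hu : IsSolitonOf u Q) (h : hardySobolev) :
    ∃ hm : mulInner hQ (h : hardy) ∈ (laxOperator u).domain,
      laxOperator u ⟨mulInner hQ (h : hardy), hm⟩ = mulInner hQ (opD h) := by
  set Qb := conjPoly Q with hQb
  set W := derivative Qb * Q - Qb * derivative Q with hW
  obtain ⟨t, ht⟩ : InHardy fun x : ℝ =>
      -Complex.I * (W.eval (x : ℂ) / (Q * Q).eval (x : ℂ) * ((h : hardy) : L2) x) :=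
    ((inHardy_coe (h : hardy)).rational_mul (hQ.mul hQ)
      (natDegree_wronskian_le hQ (natDegree_conjPoly Q).le)).const_mul _
  obtain ⟨hm, e⟩ : ∃ hm : mulInner hQ (h : hardy) ∈ (laxOperator u).domain,
      laxOperator u ⟨mulInner hQ (h : hardy), hm⟩ = mulInner hQ (opD h) + t - t := by
    refine laxOperator_eq (s := 0) ?_ MemLp.zero (by simp) ?_
    · refine deriv_mul (hQ.hasTemperateGrowth_div Qb) ((hQ.mul hQ).hasTemperateGrowth_div W)
        (fun x => hQ.hasDerivAt_div Qb x) (opD_spec h) (mulInner_coe hQ _) ?_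
      rw [Submodule.coe_add]
      filter_upwards [Lp.coeFn_add (mulInner hQ (opD h) : L2) (t : L2), mulInner_coe hQ (opD h), ht]
        with x h1 h2 h3
      rw [h1, Pi.add_apply, h2, h3, innerFunction]
      ring
    · filter_upwards [hu, mulInner_coe hQ (h : hardy), ht] with x h1 h2 h3
      have h4 := hQ.eval_ne_zero x
      have h5 := hQ.eval_conjPoly_ne_zero x
      rw [h1, h2, h3, innerFunction, hW]
      simp only [Pi.zero_apply, map_zero, add_zero, eval_sub, eval_mul]
      rw [← hQb] at h5 ⊢
      field_simp
      ring
  exact ⟨hm, by rw [e, add_sub_cancel_right]⟩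

/-- If `Q̄' P = A Q + B Q̄`, then `L_u (P / Q) = i (B - P') / Q`. -/
theorem laxOperator_rational {Q : ℂ[X]} (hQ : LowerMonic Q) {u : Lp ℝ 2 (volume : Measure ℝ)}
    (hu : IsSolitonOf u Q) (hN : Q.natDegree ≠ 0) {P A B : ℂ[X]}
    (hP : P.degree < Q.natDegree)
    (hA : A.degree < Q.natDegree) (hB : B.degree < Q.natDegree)
    (h : derivative (conjPoly Q) * P = A * Q + B * conjPoly Q) {f g : hardy}
    (hf : (f : L2) =ᵐ[volume] fun x : ℝ => P.eval (x : ℂ) / Q.eval (x : ℂ))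
    (hg : (g : L2) =ᵐ[volume] fun x : ℝ =>
      (C Complex.I * (B - derivative P)).eval (x : ℂ) / Q.eval (x : ℂ)) :
    ∃ hm : f ∈ (laxOperator u).domain, laxOperator u ⟨f, hm⟩ = g := by
  have h1 := natDegree_derivative_le P
  have h2 := natDegree_derivative_le Q
  have hP' := natDegree_lt_of_degree_lt hN hP
  have hQQ : (Q * Q).natDegree = Q.natDegree + Q.natDegree := hQ.monic.natDegree_mul hQ.monic
  set W := derivative P * Q - P * derivative Q with hW
  have hd : InHardy fun x : ℝ => -Complex.I * (W.eval (x : ℂ) / (Q * Q).eval (x : ℂ)) := by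
    refine (inHardy_rational (hQ.mul hQ) ?_).const_mul _
    refine (natDegree_sub_le _ _).trans_lt (max_lt ?_ ?_)
    · refine natDegree_mul_le.trans_lt ?_
      omega
    · refine natDegree_mul_le.trans_lt ?_
      omega
  have ht : InHardy fun x : ℝ =>
      Complex.I * ((derivative Q * P).eval (x : ℂ) / (Q * Q).eval (x : ℂ)) -
        Complex.I * (B.eval (x : ℂ) / Q.eval (x : ℂ)) := by
    refine ((inHardy_rational (hQ.mul hQ) ?_).const_mul _).sub
      ((inHardy_rational_of_degree_lt hQ hB).const_mul _)
    refine natDegree_mul_le.trans_lt ?_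
    omega
  have hA' : (conjPoly A).degree < Q.natDegree := by rwa [degree_conjPoly]
  have hs := (inHardy_rational_of_degree_lt hQ hA').const_mul Complex.I
  obtain ⟨d, hd⟩ := hd
  obtain ⟨t, ht⟩ := ht
  obtain ⟨hm, e⟩ : ∃ hm : f ∈ (laxOperator u).domain, laxOperator u ⟨f, hm⟩ = d - t := by
    refine laxOperator_eq (deriv_eq_of_hasDerivAt (fun x => hQ.hasDerivAt_div P x) hf hd)
      hs.memLp ?_ ?_
    · intro F hF
      simp only [mul_assoc]
      rw [integral_const_mul, integral_rational_mul_eq_zero_of_degree_lt hQ hA' hF, mul_zero]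
    · filter_upwards [hu, hf, ht] with x h3 h4 h5
      have h7 := hQ.eval_ne_zero x
      have h8 := hQ.eval_conjPoly_ne_zero x
      have h9 := congrArg (fun R : ℂ[X] => R.eval (x : ℂ)) h
      simp only [eval_add, eval_mul] at h9
      rw [h3, h4, h5]
      simp only [map_mul, map_div₀, ← eval_conjPoly, conjPoly_conjPoly, Complex.conj_I, eval_mul]
      field_simp
      linear_combination (-1 : ℂ) * Q.eval (x : ℂ) * h9
  refine ⟨hm, e.trans ?_⟩
  ext1
  apply Lp.ext
  rw [Submodule.coe_sub]
  filter_upwards [Lp.coeFn_sub (d : L2) (t : L2), hd, ht, hg] with x h3 h4 h5 h6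
  have h7 := hQ.eval_ne_zero x
  rw [h3, Pi.sub_apply, h4, h5, h6, hW]
  simp only [eval_sub, eval_mul, eval_C]
  field_simp
  ring

/-! ### Symmetry of the Lax operator -/

theorem inner_toeplitz (u : Lp ℝ 2 (volume : Measure ℝ)) (f g : hardySobolev) :
    inner ℂ (toeplitz u f) (g : hardy) = inner ℂ (f : hardy) (toeplitz u g) := by
  have h1 : inner ℂ (toeplitz u f) (g : hardy) =
      inner ℂ ((memLp_mul u f).toLp _ : L2) ((g : hardy) : L2) := inner_szego _ _
  have h2 : inner ℂ (toeplitz u g) (f : hardy) =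
      inner ℂ ((memLp_mul u g).toLp _ : L2) ((f : hardy) : L2) := inner_szego _ _
  rw [h1, ← inner_conj_symm (f : hardy), h2, inner_conj_symm, L2.inner_def, L2.inner_def]
  refine integral_congr_ae ?_
  filter_upwards [(memLp_mul u f).coeFn_toLp, (memLp_mul u g).coeFn_toLp] with x h3 h4
  rw [h3, h4]
  simp only [RCLike.inner_apply, map_mul, Complex.conj_ofReal]
  ring

theorem laxOperator_symmetric (u : Lp ℝ 2 (volume : Measure ℝ)) (f g : (laxOperator u).domain) :
    inner ℂ (laxOperator u f) (g : hardy) = inner ℂ (f : hardy) (laxOperator u g) := by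
  change inner ℂ (opD f - toeplitz u f) (g : hardy) = inner ℂ (f : hardy) (opD g - toeplitz u g)
  rw [inner_sub_left, inner_sub_right]
  exact congrArg₂ (· - ·) (opD_symmetric f g) (inner_toeplitz u f g)

/-! ### Partial fractions -/

theorem LowerMonic.monic_conjPoly {Q : ℂ[X]} (hQ : LowerMonic Q) : (conjPoly Q).Monic :=
  hQ.monic.map _

theorem LowerMonic.isCoprime_conjPoly {Q : ℂ[X]} (hQ : LowerMonic Q) :
    IsCoprime Q (conjPoly Q) := by
  rw [isCoprime_iff_aeval_ne_zero_of_isAlgClosed ℂ ℂ]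
  intro z
  by_contra! h
  obtain ⟨h1, h2⟩ := h
  rw [coe_aeval_eq_eval] at h1 h2
  have h3 : Q.eval (starRingEnd ℂ z) = 0 := by
    have := congrArg (starRingEnd ℂ) h2
    rw [map_zero, ← eval_map_apply] at this
    exact conjPoly_conjPoly Q ▸ this
  have h4 := hQ.roots_im_neg z h1
  have h5 := hQ.roots_im_neg _ h3
  rw [Complex.conj_im] at h5
  linarith

/-- Partial fractions for `R / (Q Q̄)`, the roots of `Q` and `Q̄` lying in opposite half-planes. -/
theorem LowerMonic.exists_partialFraction {Q : ℂ[X]} (hQ : LowerMonic Q) (hN : Q.natDegree ≠ 0)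
    {R : ℂ[X]} (hR : R.natDegree < Q.natDegree + Q.natDegree) :
    ∃ A B : ℂ[X], A.degree < Q.natDegree ∧ B.degree < Q.natDegree ∧
      R = A * Q + B * conjPoly Q := by
  obtain ⟨a, b, hab⟩ := hQ.isCoprime_conjPoly
  set B := (b * R) %ₘ Q with hB
  set A := a * R + (b * R) /ₘ Q * conjPoly Q with hA
  have hBd : B.degree < Q.natDegree := by
    rw [← degree_eq_natDegree hQ.monic.ne_zero]
    exact degree_modByMonic_lt _ hQ.monic
  have e : R = A * Q + B * conjPoly Q := by
    have h1 := modByMonic_add_div (b * R) Q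
    rw [hA]
    linear_combination (-R) * hab - conjPoly Q * h1
  refine ⟨A, B, ?_, hBd, e⟩
  by_cases h0 : A = 0
  · rw [h0, degree_zero]
    exact WithBot.bot_lt_coe _
  rw [← natDegree_lt_iff_degree_lt h0]
  have h1 : (A * Q).natDegree < Q.natDegree + Q.natDegree := by
    rw [show A * Q = R - B * conjPoly Q by rw [e]; ring]
    refine (natDegree_sub_le _ _).trans_lt (max_lt hR ?_)
    refine natDegree_mul_le.trans_lt ?_
    rw [natDegree_conjPoly]
    have := natDegree_lt_of_degree_lt hN hBd
    omega
  rw [mul_comm, hQ.monic.natDegree_mul' h0] at h1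
  omega

theorem degree_X_mul_sub_lt {Q P : ℂ[X]} (hQ : Q.Monic) (hN : Q.natDegree ≠ 0)
    (hP : P.degree < Q.natDegree) :
    (X * P - C (P.coeff (Q.natDegree - 1)) * Q).degree < (Q.natDegree : WithBot ℕ) := by
  obtain ⟨n, hn⟩ := Nat.exists_eq_succ_of_ne_zero hN
  rw [degree_lt_iff_coeff_zero] at hP ⊢
  intro m hm
  obtain ⟨k, rfl⟩ := Nat.exists_eq_succ_of_ne_zero (show m ≠ 0 by omega)
  rw [coeff_sub, Nat.succ_eq_add_one, coeff_X_mul, coeff_C_mul]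
  rcases hm.eq_or_lt with h | h
  · rw [show Q.natDegree - 1 = k by omega, show k + 1 = Q.natDegree by omega, hQ.coeff_natDegree,
      mul_one, sub_self]
  · rw [hP k (by omega), coeff_eq_zero_of_natDegree_lt h, mul_zero, sub_zero]

/-- Removing the leading behaviour `b / x` of `B / Q` at infinity by `b / (x + i)` leaves an
integrable function of Hardy class, whose integral vanishes. -/
theorem integral_rational_sub_eq_zero {Q B : ℂ[X]} (hQ : LowerMonic Q) (hN : Q.natDegree ≠ 0)
    (hB : B.degree < Q.natDegree) :
    Integrable (fun x : ℝ => B.eval (x : ℂ) / Q.eval (x : ℂ) -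
      B.coeff (Q.natDegree - 1) * ((x : ℂ) + Complex.I)⁻¹) ∧
    ∫ x : ℝ, (B.eval (x : ℂ) / Q.eval (x : ℂ) -
      B.coeff (Q.natDegree - 1) * ((x : ℂ) + Complex.I)⁻¹) = 0 := by
  set b := B.coeff (Q.natDegree - 1)
  have hI : (-Complex.I).im < 0 := by simp
  have h1 : (X * B - C b * Q + C Complex.I * B).degree < (Q.natDegree : WithBot ℕ) :=
    (degree_add_le _ _).trans_lt (max_lt (degree_X_mul_sub_lt hQ.monic hN hB)
      ((degree_C_mul Complex.I_ne_zero).trans_lt hB))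
  have h2 := inHardy_rational_of_degree_lt hQ h1
  have e : (fun x : ℝ => B.eval (x : ℂ) / Q.eval (x : ℂ) - b * ((x : ℂ) + Complex.I)⁻¹) =
      fun x : ℝ => ((x : ℂ) - -Complex.I)⁻¹ *
        ((X * B - C b * Q + C Complex.I * B).eval (x : ℂ) / Q.eval (x : ℂ)) := by
    funext x
    have h3 := hQ.eval_ne_zero x
    have h4 := sub_ne_zero_of_im_ne_zero hI.ne x
    rw [sub_neg_eq_add] at h4 ⊢
    simp only [eval_add, eval_sub, eval_mul, eval_X, eval_C]
    field_simp
    ring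
  rw [e]
  exact ⟨integrable_cauchyKernel_mul hI h2.memLp, h2.integral_eq_zero hI⟩

theorem eval_conjPoly_div {Q A : ℂ[X]} (x : ℝ) :
    A.eval (x : ℂ) / (conjPoly Q).eval (x : ℂ) =
      starRingEnd ℂ ((conjPoly A).eval (x : ℂ) / Q.eval (x : ℂ)) := by
  rw [map_div₀, ← eval_conjPoly, ← eval_conjPoly, conjPoly_conjPoly]

/-- The sum of the two fractions decays like `x⁻²`. Comparing each with a multiple of `1 / (x ± i)`
reduces its integral to that of `1 / (1 + x²)`. -/
theorem integral_partialFraction {Q A B : ℂ[X]} (hQ : LowerMonic Q) (hN : Q.natDegree ≠ 0)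
    (hA : A.degree < Q.natDegree) (hB : B.degree < Q.natDegree)
    (hab : A.coeff (Q.natDegree - 1) + B.coeff (Q.natDegree - 1) = 0) :
    ∫ x : ℝ, (A.eval (x : ℂ) / (conjPoly Q).eval (x : ℂ) + B.eval (x : ℂ) / Q.eval (x : ℂ)) =
      2 * Real.pi * Complex.I * A.coeff (Q.natDegree - 1) := by
  set a := A.coeff (Q.natDegree - 1) with ha
  set b := B.coeff (Q.natDegree - 1) with hb
  obtain ⟨hi1, h1⟩ := integral_rational_sub_eq_zero hQ hN hB
  obtain ⟨hi2, h2⟩ := integral_rational_sub_eq_zero hQ hN (B := conjPoly A)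
    (by rwa [degree_conjPoly])
  have h3 : ∫ x : ℝ, starRingEnd ℂ ((conjPoly A).eval (x : ℂ) / Q.eval (x : ℂ) -
      (conjPoly A).coeff (Q.natDegree - 1) * ((x : ℂ) + Complex.I)⁻¹) = 0 := by
    rw [integral_conj, h2, map_zero]
  have hi3 : Integrable fun x : ℝ => starRingEnd ℂ ((conjPoly A).eval (x : ℂ) / Q.eval (x : ℂ) -
      (conjPoly A).coeff (Q.natDegree - 1) * ((x : ℂ) + Complex.I)⁻¹) :=
    (Complex.conjLIE.toLinearIsometry.toContinuousLinearMap).integrable_comp hi2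
  have hi4 : Integrable fun x : ℝ => 2 * Complex.I * a * (((1 + x ^ 2)⁻¹ : ℝ) : ℂ) :=
    (integrable_inv_one_add_sq.ofReal).const_mul _
  have h4 : ∫ x : ℝ, 2 * Complex.I * a * (((1 + x ^ 2)⁻¹ : ℝ) : ℂ) =
      2 * Real.pi * Complex.I * a := by
    rw [integral_const_mul, integral_complex_ofReal, integral_univ_inv_one_add_sq]
    ring
  rw [← h4, ← zero_add (∫ x : ℝ, 2 * Complex.I * a * (((1 + x ^ 2)⁻¹ : ℝ) : ℂ)), ← add_zero (0 : ℂ)]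
  nth_rw 1 [← h3]
  rw [← h1, ← integral_add hi3 hi1]
  refine Eq.trans (integral_congr_ae (.of_forall fun x => ?_)) (integral_add (hi3.add hi1) hi4)
  simp only
  have h5 : (x : ℂ) + Complex.I ≠ 0 := by
    simpa using sub_ne_zero_of_im_ne_zero (w := -Complex.I) (by simp) x
  have h6 : (x : ℂ) - Complex.I ≠ 0 := sub_ne_zero_of_im_ne_zero (w := Complex.I) (by simp) x
  have h7 : (1 + (x : ℂ) ^ 2) = ((x : ℂ) + Complex.I) * ((x : ℂ) - Complex.I) := by
    linear_combination Complex.I_sq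
  rw [map_sub, ← eval_conjPoly_div, coeff_map, map_mul, Complex.conj_conj, map_inv₀, map_add,
    Complex.conj_ofReal, Complex.conj_I, ← sub_eq_add_neg, ← ha, ← hb, eq_neg_of_add_eq_zero_right hab]
  push_cast
  rw [h7]
  field_simp
  ring

/-- The coefficients of `X ^ (2 deg Q - 1)` in `Q̄' P = A Q + B Q̄`. -/
theorem coeff_partialFraction {Q : ℂ[X]} (hQ : LowerMonic Q) (hN : Q.natDegree ≠ 0) {P A B : ℂ[X]}
    (hP : P.degree < Q.natDegree) (hA : A.degree < Q.natDegree) (hB : B.degree < Q.natDegree)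
    (h : derivative (conjPoly Q) * P = A * Q + B * conjPoly Q) :
    A.coeff (Q.natDegree - 1) + B.coeff (Q.natDegree - 1) = 0 := by
  have hP' := natDegree_lt_of_degree_lt hN hP
  have hA' := natDegree_lt_of_degree_lt hN hA
  have hB' := natDegree_lt_of_degree_lt hN hB
  have e := congrArg (fun R : ℂ[X] => R.coeff (Q.natDegree - 1 + Q.natDegree)) h
  have h1 : (Q.natDegree - 1 + Q.natDegree) > (derivative (conjPoly Q) * P).natDegree := by
    refine natDegree_mul_le.trans_lt ?_
    have := natDegree_derivative_le (conjPoly Q)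
    rw [natDegree_conjPoly] at this
    omega
  have h2 : (conjPoly Q).coeff Q.natDegree = 1 := by
    rw [← natDegree_conjPoly Q, hQ.monic_conjPoly.coeff_natDegree]
  simp only [coeff_add] at e
  rw [coeff_eq_zero_of_natDegree_lt h1, coeff_mul_add_eq_of_natDegree_le (by omega) le_rfl,
    coeff_mul_add_eq_of_natDegree_le (by omega) (natDegree_conjPoly Q).le, hQ.monic.coeff_natDegree, h2,
    mul_one, mul_one] at e
  exact e.symm

/-! ### The eigenvalue identity -/

theorem derivative_conjPoly (Q : ℂ[X]) : derivative (conjPoly Q) = conjPoly (derivative Q) :=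
  derivative_map _ _

/-- The pairing of `P / Q` with `Π u = i Q' / Q`. -/
theorem inner_rational_derivative {Q : ℂ[X]} (hQ : LowerMonic Q) (hN : Q.natDegree ≠ 0)
    {P A B : ℂ[X]} (hP : P.degree < Q.natDegree) (hA : A.degree < Q.natDegree)
    (hB : B.degree < Q.natDegree)
    (h : derivative (conjPoly Q) * P = A * Q + B * conjPoly Q) {f w : hardy}
    (hf : (f : L2) =ᵐ[volume] fun x : ℝ => P.eval (x : ℂ) / Q.eval (x : ℂ))
    (hw : (w : L2) =ᵐ[volume] fun x : ℝ =>
      Complex.I * ((derivative Q).eval (x : ℂ) / Q.eval (x : ℂ))) :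
    inner ℂ w f = 2 * Real.pi * A.coeff (Q.natDegree - 1) := by
  have e := integral_partialFraction hQ hN hA hB (coeff_partialFraction hQ hN hP hA hB h)
  have e2 : inner ℂ w f = -Complex.I * ∫ x : ℝ,
      (A.eval (x : ℂ) / (conjPoly Q).eval (x : ℂ) + B.eval (x : ℂ) / Q.eval (x : ℂ)) := by
    rw [Submodule.coe_inner, L2.inner_def, ← integral_const_mul]
    refine integral_congr_ae ?_
    filter_upwards [hf, hw] with x h1 h2
    have h3 := hQ.eval_ne_zero x
    have h4 := hQ.eval_conjPoly_ne_zero x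
    have h5 := congrArg (fun R : ℂ[X] => R.eval (x : ℂ)) h
    simp only [eval_add, eval_mul, derivative_conjPoly] at h5
    rw [h1, h2, RCLike.inner_apply, map_mul, Complex.conj_I, map_div₀, ← eval_conjPoly,
      ← eval_conjPoly]
    field_simp
    linear_combination (-1 : ℂ) * h5
  rw [e2, e]
  linear_combination (-2 * Real.pi * A.coeff (Q.natDegree - 1)) * Complex.I_sq

/-- The Hilbert space part of the eigenvalue identity: here `f` is an eigenvector of a symmetric
operator with eigenvalue `t`, `k` is another vector with image `g`, and `g - t k` is expressed
through `f` and `w`. -/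
theorem norm_sq_eq_of_commutator {E : Type*} [NormedAddCommGroup E] [InnerProductSpace ℂ E]
    {f g k w : E} {t : ℝ} {p : ℂ} (hsym : inner ℂ ((t : ℂ) • f) k = inner ℂ f g)
    (hcomm : g - (t : ℂ) • k = -Complex.I • f + p • w)
    (hwf : inner ℂ w f = 2 * Real.pi * (Complex.I * t * p)) :
    ‖f‖ ^ 2 = -(2 * Real.pi * t) * ‖p‖ ^ 2 := by
  have h0 : inner ℂ f (g - (t : ℂ) • k) = 0 := by
    rw [inner_smul_left, Complex.conj_ofReal] at hsym
    rw [inner_sub_right, inner_smul_right, ← hsym, sub_self]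
  rw [hcomm, inner_add_right, inner_smul_right, inner_smul_right, ← inner_conj_symm f w, hwf,
    inner_self_eq_norm_sq_to_K] at h0
  simp only [map_mul, Complex.conj_I, Complex.conj_ofReal, map_ofNat, Complex.coe_algebraMap] at h0
  have h14 : p * starRingEnd ℂ p = (‖p‖ ^ 2 : ℝ) := by
    rw [Complex.mul_conj']; push_cast; rfl
  have h15 : ((‖f‖ ^ 2 : ℝ) : ℂ) = ((-(2 * Real.pi * t) * ‖p‖ ^ 2 : ℝ) : ℂ) := by
    rw [Complex.ofReal_mul, ← h14]
    push_cast
    have h16 : Complex.I * ((‖f‖ : ℂ) ^ 2 + 2 * Real.pi * t * (p * starRingEnd ℂ p)) = 0 := by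
      linear_combination (-1 : ℂ) * h0
    have h17 := (mul_eq_zero.1 h16).resolve_left Complex.I_ne_zero
    linear_combination h17
  exact_mod_cast h15

/-- For an eigenvector `f = P / Q` of `L_u` with eigenvalue `t` one has `‖f‖² = -2πt |p|²`, where `p`
is the coefficient of `X ^ (deg Q - 1)` in `P`. This follows from the commutator identity
`[L_u, G] f = -i f + p Π u` with `G f = (X P - p Q) / Q`, paired with `f`. -/
theorem norm_sq_eq_of_eigenvector {Q : ℂ[X]} (hQ : LowerMonic Q) (hN : Q.natDegree ≠ 0)
    {u : Lp ℝ 2 (volume : Measure ℝ)} (hu : IsSolitonOf u Q) {P : ℂ[X]}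
    (hP : P.degree < Q.natDegree) {f : hardy}
    (hf : (f : L2) =ᵐ[volume] fun x : ℝ => P.eval (x : ℂ) / Q.eval (x : ℂ)) {t : ℝ}
    (hm : f ∈ (laxOperator u).domain) (ht : laxOperator u ⟨f, hm⟩ = (t : ℂ) • f) :
    ‖f‖ ^ 2 = -(2 * Real.pi * t) * ‖P.coeff (Q.natDegree - 1)‖ ^ 2 := by
  have hP' := natDegree_lt_of_degree_lt hN hP
  obtain ⟨A, B, hA, hB, h⟩ := hQ.exists_partialFraction hN (R := derivative (conjPoly Q) * P) (by
    refine natDegree_mul_le.trans_lt ?_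
    have := natDegree_derivative_le (conjPoly Q)
    rw [natDegree_conjPoly] at this
    omega)
  set p := P.coeff (Q.natDegree - 1) with hp
  set a := A.coeff (Q.natDegree - 1) with ha
  set b := B.coeff (Q.natDegree - 1) with hb
  have hab : a + b = 0 := coeff_partialFraction hQ hN hP hA hB h
  have hPd : (derivative P).degree < (Q.natDegree : WithBot ℕ) := (degree_derivative_le).trans_lt hP
  have hdeg : ∀ R S : ℂ[X], R.degree < (Q.natDegree : WithBot ℕ) →
      S.degree < (Q.natDegree : WithBot ℕ) →
      (C Complex.I * (R - S)).degree < (Q.natDegree : WithBot ℕ) := fun R S hR hS =>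
    (degree_C_mul Complex.I_ne_zero).trans_lt ((degree_sub_le _ _).trans_lt (max_lt hR hS))
  -- the eigenvalue equation as an identity of polynomials
  have heig : C Complex.I * (B - derivative P) = C (t : ℂ) * P := by
    obtain ⟨g, hg⟩ := inHardy_rational_of_degree_lt hQ (hdeg B _ hB hPd)
    obtain ⟨hm', e⟩ := laxOperator_rational hQ hu hN hP hA hB h hf hg
    rw [ht] at e
    apply polynomial_eq_of_ae_eq
    rw [← e] at hg
    filter_upwards [hg, hf, Lp.coeFn_smul (t : ℂ) (f : L2)] with x h1 h2 h3
    rw [Submodule.coe_smul, h3, Pi.smul_apply, h2, smul_eq_mul, ← mul_div_assoc,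
      div_left_inj' (hQ.eval_ne_zero x)] at h1
    rw [← h1, eval_mul, eval_C]
  have hbt : Complex.I * b = t * p := by
    have e := congrArg (fun R : ℂ[X] => R.coeff (Q.natDegree - 1)) heig
    have h0 : (derivative P).coeff (Q.natDegree - 1) = 0 := by
      rw [coeff_derivative, coeff_eq_zero_of_natDegree_lt (by omega), zero_mul]
    simp only [coeff_C_mul, coeff_sub, h0, sub_zero] at e
    exact e
  -- the vector `G f` and its image under `L_u`
  have hP2 := degree_X_mul_sub_lt hQ.monic hN hP
  have hB2 := degree_X_mul_sub_lt hQ.monic hN hB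
  have hA2 : (X * A - C a * conjPoly Q - C p * derivative (conjPoly Q)).degree <
      (Q.natDegree : WithBot ℕ) := by
    have e := degree_X_mul_sub_lt hQ.monic_conjPoly (by rwa [natDegree_conjPoly])
      (by rwa [natDegree_conjPoly] : A.degree < ((conjPoly Q).natDegree : WithBot ℕ))
    rw [natDegree_conjPoly] at e
    refine (degree_sub_le _ _).trans_lt (max_lt e ?_)
    rw [← smul_eq_C_mul]
    refine (degree_smul_le _ _).trans_lt ?_
    rw [← natDegree_conjPoly, ← degree_eq_natDegree hQ.monic_conjPoly.ne_zero]
    exact degree_derivative_lt hQ.monic_conjPoly.ne_zero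
  have h2 : derivative (conjPoly Q) * (X * P - C p * Q) =
      (X * A - C a * conjPoly Q - C p * derivative (conjPoly Q)) * Q +
        (X * B - C b * Q) * conjPoly Q := by
    have e : (C a + C b : ℂ[X]) = 0 := by rw [← C_add, hab, C_0]
    linear_combination X * h + conjPoly Q * Q * e
  obtain ⟨k, hk⟩ := inHardy_rational_of_degree_lt hQ hP2
  obtain ⟨g, hg⟩ := inHardy_rational_of_degree_lt hQ
    (hdeg _ (derivative (X * P - C p * Q)) hB2 ((degree_derivative_le).trans_lt hP2))
  obtain ⟨hkm, hkg⟩ := laxOperator_rational hQ hu hN hP2 hA2 hB2 h2 hk hg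
  obtain ⟨w, hw⟩ : InHardy fun x : ℝ =>
      Complex.I * ((derivative Q).eval (x : ℂ) / Q.eval (x : ℂ)) := by
    refine (inHardy_rational_of_degree_lt hQ ?_).const_mul _
    rw [← degree_eq_natDegree hQ.monic.ne_zero]
    exact degree_derivative_lt hQ.monic.ne_zero
  have hcomm : g - (t : ℂ) • k = -Complex.I • f + p • w := by
    ext1
    apply Lp.ext
    simp only [Submodule.coe_sub, Submodule.coe_add, Submodule.coe_smul]
    filter_upwards [hk, hg, hw, hf, Lp.coeFn_sub (g : L2) ((t : ℂ) • (k : L2)),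
      Lp.coeFn_smul (t : ℂ) (k : L2), Lp.coeFn_add (-Complex.I • (f : L2)) (p • (w : L2)),
      Lp.coeFn_smul (-Complex.I) (f : L2), Lp.coeFn_smul p (w : L2)]
      with x h3 h4 h5 h6 h7 h8 h9 h10 h11
    have h12 := hQ.eval_ne_zero x
    have h13 := congrArg (fun R : ℂ[X] => R.eval (x : ℂ)) heig
    simp only [eval_mul, eval_C, eval_sub] at h13
    rw [h7, h9, Pi.sub_apply, Pi.add_apply, h8, h10, h11, Pi.smul_apply, Pi.smul_apply,
      Pi.smul_apply, h3, h4, h5, h6]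
    simp only [derivative_sub, derivative_mul, derivative_X, derivative_C, eval_mul, eval_C,
      eval_sub, eval_add, eval_X, eval_one, smul_eq_mul, eval_zero, ← hp, ← hb]
    field_simp
    linear_combination x * h13 - Q.eval (x : ℂ) * hbt
  have hwf : inner ℂ w f = 2 * Real.pi * a := inner_rational_derivative hQ hN hP hA hB h hf hw
  have hat : a = Complex.I * t * p := by
    linear_combination hab + Complex.I * hbt - b * Complex.I_sq
  have hsym := laxOperator_symmetric u ⟨f, hm⟩ ⟨k, hkm⟩
  rw [ht, hkg] at hsym
  exact norm_sq_eq_of_commutator hsym hcomm (hwf.trans (by rw [hat]))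

/-! ### Multi-solitons and their characteristic polynomial -/

theorem derivative_prod_div {N : ℕ} (z : Fin N → ℂ) (hz : ∀ j, (z j).im ≠ 0) (x : ℝ)
    (s : Finset (Fin N)) :
    (derivative (∏ j ∈ s, (X - C (z j)))).eval (x : ℂ) / (∏ j ∈ s, (X - C (z j))).eval (x : ℂ) =
      ∑ j ∈ s, ((x : ℂ) - z j)⁻¹ := by
  induction s using Finset.induction_on with
  | empty => simp
  | insert i s hi ih =>
    have h1 : (∏ j ∈ s, (X - C (z j))).eval (x : ℂ) ≠ 0 := by
      rw [eval_prod, Finset.prod_ne_zero_iff]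
      intro j _
      simpa using sub_ne_zero_of_im_ne_zero (hz j) x
    have h2 := sub_ne_zero_of_im_ne_zero (hz i) x
    rw [Finset.prod_insert hi, Finset.sum_insert hi, ← ih, derivative_mul]
    simp only [derivative_sub, derivative_X, derivative_C, sub_zero, one_mul, eval_add, eval_mul,
      eval_sub, eval_X, eval_C]
    field_simp

/-- Partial fractions of a single soliton, with poles `a ∓ i / c`. -/
theorem solitonProfile_eq {c a : ℝ} (hc : 0 < c) (x : ℝ) :
    ((c * solitonProfile (c * (x - a)) : ℝ) : ℂ) =
      Complex.I * ((x : ℂ) - (a - Complex.I / c))⁻¹ -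
        Complex.I * ((x : ℂ) - (a + Complex.I / c))⁻¹ := by
  have hc' : (c : ℂ) ≠ 0 := by exact_mod_cast hc.ne'
  have h1 : (x : ℂ) - (a - Complex.I / c) ≠ 0 := by
    apply sub_ne_zero_of_im_ne_zero
    simp [Complex.div_im, hc.ne']
  have h2 : (x : ℂ) - (a + Complex.I / c) ≠ 0 := by
    apply sub_ne_zero_of_im_ne_zero
    simp [Complex.div_im, hc.ne']
  have h3 : (1 + (c * (x - a)) ^ 2 : ℂ) ≠ 0 := by
    have : (1 + (c * (x - a)) ^ 2 : ℝ) ≠ 0 := by positivity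
    exact_mod_cast this
  rw [solitonProfile]
  push_cast
  have h4 : (1 + (c * (x - a)) ^ 2 : ℂ) =
      c ^ 2 * (((x : ℂ) - (a - Complex.I / c)) * ((x : ℂ) - (a + Complex.I / c))) := by
    field_simp
    linear_combination Complex.I_sq
  have h5 : ((x : ℂ) - (a + Complex.I / c)) - (x - (a - Complex.I / c)) = -2 * Complex.I / c := by
    ring
  rw [h4]
  generalize (x : ℂ) - (a - Complex.I / c) = D₁ at *
  generalize (x : ℂ) - (a + Complex.I / c) = D₂ at *
  rw [eq_div_iff hc'] at h5
  field_simp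
  linear_combination (-Complex.I) * h5 + 2 * Complex.I_sq

theorem exists_isSolitonOf {N : ℕ} {u : Lp ℝ 2 (volume : Measure ℝ)} (hu : u ∈ multiSolitons N) :
    ∃ Q : ℂ[X], LowerMonic Q ∧ Q.natDegree = N ∧ IsSolitonOf u Q := by
  obtain ⟨c, a, hc, hu⟩ := hu
  set z : Fin N → ℂ := fun j => a j - Complex.I / c j with hz
  have him : ∀ j, (z j).im < 0 := by
    intro j
    have := hc j
    simp only [hz, Complex.sub_im, Complex.ofReal_im, Complex.div_ofReal_im, Complex.I_im]
    rw [zero_sub, neg_lt_zero]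
    positivity
  refine ⟨∏ j, (X - C (z j)), ⟨monic_prod_of_monic _ _ fun j _ => monic_X_sub_C _, ?_⟩, ?_, ?_⟩
  · intro w hw
    rw [IsRoot.def, eval_prod, Finset.prod_eq_zero_iff] at hw
    obtain ⟨j, -, hj⟩ := hw
    rw [eval_sub, eval_X, eval_C, sub_eq_zero] at hj
    rw [hj]
    exact him j
  · rw [natDegree_prod_of_monic _ _ fun j _ => monic_X_sub_C _]
    simp
  · have e : conjPoly (∏ j, (X - C (z j))) = ∏ j, (X - C (starRingEnd ℂ (z j))) := by
      rw [conjPoly, Polynomial.map_prod]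
      simp
    unfold IsSolitonOf
    rw [e]
    filter_upwards [hu] with x hx
    rw [hx, derivative_prod_div _ (fun j => (him j).ne),
      derivative_prod_div (fun j => starRingEnd ℂ (z j)) (fun j => by
        rw [Complex.conj_im, neg_ne_zero]; exact (him j).ne), Finset.mul_sum, Finset.mul_sum,
      ← Finset.sum_sub_distrib, Complex.ofReal_sum]
    refine Finset.sum_congr rfl fun j _ => ?_
    rw [solitonProfile_eq (hc j), hz]
    simp [neg_div]

/-- `Π u = i Q' / Q`, the remaining part of `u` being orthogonal to `L²₊`. -/
theorem szego_eq_of_isSolitonOf {Q : ℂ[X]} (hQ : LowerMonic Q) {u : Lp ℝ 2 (volume : Measure ℝ)}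
    (hu : IsSolitonOf u Q) : (szego (Complex.ofRealCLM.compLp u) : L2) =ᵐ[volume]
      fun x : ℝ => Complex.I * Q.derivative.eval (x : ℂ) / Q.eval (x : ℂ) := by
  have hd : (derivative Q).degree < Q.natDegree := by
    rw [← degree_eq_natDegree hQ.monic.ne_zero]
    exact degree_derivative_lt hQ.monic.ne_zero
  obtain ⟨w, hw⟩ := (inHardy_rational_of_degree_lt hQ hd).const_mul Complex.I
  have e : szego (Complex.ofRealCLM.compLp u) = w := by
    refine szego_eq_of_forall_inner fun g => ?_
    have h0 := integral_rational_mul_eq_zero_of_degree_lt hQ hd (inHardy_coe g)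
    have hi : Integrable fun x : ℝ => (derivative Q).eval (x : ℂ) / Q.eval (x : ℂ) * (g : L2) x :=
      (inHardy_rational_of_degree_lt hQ hd).memLp.integrable_mul (Lp.memLp _)
    rw [Submodule.coe_inner, ← add_zero (inner ℂ (w : L2) (g : L2)), ← mul_zero Complex.I, ← h0,
      L2.inner_def, L2.inner_def, ← integral_const_mul,
      ← integral_add (L2.integrable_inner _ _) (hi.const_mul _)]
    refine integral_congr_ae ?_
    filter_upwards [hu, hw, ContinuousLinearMap.coeFn_compLp Complex.ofRealCLM u] with x h1 h2 h3
    rw [h3, Complex.ofRealCLM_apply, h1, h2]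
    simp only [RCLike.inner_apply, map_sub, map_mul, map_div₀, ← eval_conjPoly, Complex.conj_I,
      derivative_conjPoly, conjPoly_conjPoly]
    ring
  rw [e]
  filter_upwards [hw] with x hx
  rw [hx, mul_div_assoc]

theorem IsCharPoly.lowerMonic {N : ℕ} {u : Lp ℝ 2 (volume : Measure ℝ)} {Q : ℂ[X]}
    (h : IsCharPoly N u Q) : LowerMonic Q := ⟨h.monic, h.roots_im_neg⟩

/-- A monic polynomial without real roots is determined by its logarithmic derivative. -/
theorem IsCharPoly.eq {N : ℕ} {u : Lp ℝ 2 (volume : Measure ℝ)} {Q R : ℂ[X]}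
    (hQ : IsCharPoly N u Q) (hR : IsCharPoly N u R) : Q = R := by
  have h1 : derivative Q * R - Q * derivative R = 0 := by
    apply polynomial_eq_of_ae_eq
    filter_upwards [hQ.szego_eq, hR.szego_eq] with x h2 h3
    have h4 := hQ.lowerMonic.eval_ne_zero x
    have h5 := hR.lowerMonic.eval_ne_zero x
    rw [h2, div_eq_div_iff h4 h5] at h3
    simp only [eval_sub, eval_mul, eval_zero]
    have h6 : Complex.I * ((derivative Q).eval (x : ℂ) * R.eval (x : ℂ) -
        Q.eval (x : ℂ) * (derivative R).eval (x : ℂ)) = 0 := by linear_combination h3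
    exact (mul_eq_zero.1 h6).resolve_left Complex.I_ne_zero
  have h2 : ∀ x : ℝ, HasDerivAt (fun x : ℝ => Q.eval (x : ℂ) / R.eval (x : ℂ)) 0 x := by
    intro x
    simpa [h1] using hR.lowerMonic.hasDerivAt_div Q x
  set c := Q.eval ((0 : ℝ) : ℂ) / R.eval ((0 : ℝ) : ℂ) with hc
  have h3 : Q = C c * R := by
    apply polynomial_eq_of_ae_eq
    refine .of_forall fun x => ?_
    have e := is_const_of_deriv_eq_zero (fun x => (h2 x).differentiableAt) (fun x => (h2 x).deriv) x 0
    rw [← hc, div_eq_iff (hR.lowerMonic.eval_ne_zero x)] at e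
    rw [e, eval_mul, eval_C]
  have h4 := congrArg leadingCoeff h3
  rw [leadingCoeff_mul, leadingCoeff_C, hQ.monic.leadingCoeff, hR.monic.leadingCoeff, mul_one] at h4
  rw [h3, ← h4, C_1, one_mul]

/-! ### Uniqueness of the spectral measure -/

theorem integrable_resolvent (μ : Measure ℝ) [IsFiniteMeasure μ] {z : ℂ} (hz : z.im ≠ 0) :
    Integrable (fun t : ℝ => ((t : ℂ) - z)⁻¹) μ :=
  .of_bound (Measurable.aestronglyMeasurable (by fun_prop)) _ (.of_forall (norm_cauchyKernel_le hz))

/-- The Stieltjes transform of `μ` on the line `Im z = 1` is the inverse Fourier transform of the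
characteristic function of `μ` times a damping factor. -/
theorem fourierInv_kernel_mul_charFun (μ : Measure ℝ) [IsFiniteMeasure μ] (x : ℝ) :
    𝓕⁻ (fun ξ : ℝ => (Set.Ioi (0 : ℝ)).indicator
        (fun ξ : ℝ => Complex.exp (-(2 * Real.pi * Complex.I * -Complex.I) * ξ)) ξ *
          charFun μ (-(2 * Real.pi * ξ))) x =
      (2 * Real.pi * Complex.I)⁻¹ * ∫ t : ℝ, ((t : ℂ) - (x + Complex.I))⁻¹ ∂μ := by
  have him : (-Complex.I).im < 0 := by simp
  set k := (Set.Ioi (0 : ℝ)).indicator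
    fun ξ : ℝ => Complex.exp (-(2 * Real.pi * Complex.I * -Complex.I) * ξ) with hk
  have hki : Integrable k := integrable_kernel_Ioi him
  set G : ℝ → ℝ → ℂ := fun ξ t => Complex.exp (((2 * Real.pi * (ξ * (x - t)) : ℝ) : ℂ) * Complex.I) * k ξ
    with hG
  have hGi : Integrable (Function.uncurry G) (volume.prod μ) := by
    have h1 : Integrable (fun p : ℝ × ℝ => k p.1 * (1 : ℂ)) (volume.prod μ) :=
      hki.mul_prod (integrable_const 1)
    refine h1.mono ?_ (.of_forall fun p => ?_)
    · refine AEStronglyMeasurable.mul (Measurable.aestronglyMeasurable ?_) ?_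
      · fun_prop
      · simpa using h1.1
    · rw [Function.uncurry, hG]
      simp only
      rw [norm_mul, Complex.norm_exp_ofReal_mul_I, one_mul, mul_one]
  have e1 : 𝓕⁻ (fun ξ : ℝ => k ξ * charFun μ (-(2 * Real.pi * ξ))) x = ∫ ξ, ∫ t, G ξ t ∂μ := by
    rw [Real.fourierInv_eq']
    congr 1 with ξ
    rw [charFun_apply_real, smul_eq_mul, mul_left_comm, ← integral_const_mul, ← integral_const_mul]
    congr 1 with t
    rw [hG, ← Complex.exp_add, mul_comm (k ξ)]
    congr 2
    simp only [RCLike.inner_apply, conj_trivial]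
    push_cast
    ring
  have e2 : ∀ t : ℝ, ∫ ξ, G ξ t = (2 * Real.pi * Complex.I)⁻¹ * ((t : ℂ) - (x + Complex.I))⁻¹ := by
    intro t
    have h1 := fourierInv_kernel_Ioi him (x - t)
    rw [← hk, Real.fourierInv_eq'] at h1
    refine Eq.trans ?_ (h1.trans ?_)
    · congr 1 with ξ
      rw [hG, smul_eq_mul]
      simp only [RCLike.inner_apply, conj_trivial]
      congr 4
      ring
    · rw [neg_mul, ← mul_neg, ← inv_neg]
      congr 2
      push_cast
      ring
  rw [e1, integral_integral_swap hGi]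
  simp only [e2]
  rw [integral_const_mul]

/-- A finite measure is determined by its Stieltjes transform. On the line `Im z = 1` the transform
determines the characteristic function on a half-line, and complex conjugation gives the other
half. -/
theorem measure_eq_of_stieltjes_eq {μ ν : Measure ℝ} [IsFiniteMeasure μ] [IsFiniteMeasure ν]
    (h : ∀ z : ℂ, z.im ≠ 0 → ∫ t : ℝ, ((t : ℂ) - z)⁻¹ ∂μ = ∫ t : ℝ, ((t : ℂ) - z)⁻¹ ∂ν) :
    μ = ν := by
  have him : (-Complex.I).im < 0 := by simp
  set k := (Set.Ioi (0 : ℝ)).indicator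
    fun ξ : ℝ => Complex.exp (-(2 * Real.pi * Complex.I * -Complex.I) * ξ) with hk
  have hki : Integrable k := integrable_kernel_Ioi him
  have hk2 : MemLp k 2 := memLp_two_of_bounded hki (norm_kernel_Ioi_le_one him)
  have hb : ∀ (ρ : Measure ℝ) [IsFiniteMeasure ρ], ∀ ξ : ℝ,
      ‖k ξ * charFun ρ (-(2 * Real.pi * ξ))‖ ≤ ρ.real Set.univ * ‖k ξ‖ := by
    intro ρ _ ξ
    rw [norm_mul, mul_comm]
    gcongr
    exact norm_charFun_le _
  have hm : ∀ (ρ : Measure ℝ) [IsFiniteMeasure ρ],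
      AEStronglyMeasurable (fun ξ => k ξ * charFun ρ (-(2 * Real.pi * ξ))) volume := fun ρ _ =>
    hki.1.mul (continuous_charFun.comp (by fun_prop)).aestronglyMeasurable
  have hi : ∀ (ρ : Measure ℝ) [IsFiniteMeasure ρ],
      Integrable fun ξ => k ξ * charFun ρ (-(2 * Real.pi * ξ)) := fun ρ _ =>
    (hki.norm.const_mul (ρ.real Set.univ)).mono' (hm ρ) (.of_forall (hb ρ))
  have hi2 : ∀ (ρ : Measure ℝ) [IsFiniteMeasure ρ],
      MemLp (fun ξ => k ξ * charFun ρ (-(2 * Real.pi * ξ))) 2 := fun ρ _ =>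
    (hk2.norm.const_mul (ρ.real Set.univ)).of_le (hm ρ) (.of_forall fun ξ => by
      refine (hb ρ ξ).trans (le_of_eq ?_)
      rw [norm_mul, norm_norm, Real.norm_of_nonneg measureReal_nonneg])
  have h0 := ae_eq_zero_of_fourierInv_eq_zero ((hi μ).sub (hi ν)) ((hi2 μ).sub (hi2 ν)) (by
    intro x
    have e : 𝓕⁻ ((fun ξ => k ξ * charFun μ (-(2 * Real.pi * ξ))) -
        fun ξ => k ξ * charFun ν (-(2 * Real.pi * ξ))) x =
        𝓕⁻ (fun ξ => k ξ * charFun μ (-(2 * Real.pi * ξ))) x -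
          𝓕⁻ (fun ξ => k ξ * charFun ν (-(2 * Real.pi * ξ))) x := by
      have hexp : ∀ (ρ : Measure ℝ) [IsFiniteMeasure ρ], Integrable fun ξ : ℝ =>
          Complex.exp (((2 * Real.pi * inner ℝ ξ x : ℝ) : ℂ) * Complex.I) •
            (k ξ * charFun ρ (-(2 * Real.pi * ξ))) := fun ρ _ =>
        (hi ρ).mono ((show Measurable fun ξ : ℝ =>
            Complex.exp (((2 * Real.pi * inner ℝ ξ x : ℝ) : ℂ) * Complex.I) by
          fun_prop).aestronglyMeasurable.smul (hm ρ))
          (.of_forall fun ξ => by rw [norm_smul, Complex.norm_exp_ofReal_mul_I, one_mul])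
      simp only [Real.fourierInv_eq', Pi.sub_apply, smul_sub]
      exact integral_sub (hexp μ) (hexp ν)
    rw [e, fourierInv_kernel_mul_charFun, fourierInv_kernel_mul_charFun, h _ (by simp), sub_self])
  have hpos : Set.EqOn (fun ξ : ℝ => charFun μ (-(2 * Real.pi * ξ)))
      (fun ξ : ℝ => charFun ν (-(2 * Real.pi * ξ))) (Set.Ioi 0) := by
    refine Measure.eqOn_open_of_ae_eq (μ := volume) ?_ isOpen_Ioi
      (continuous_charFun.comp (by fun_prop)).continuousOn
      (continuous_charFun.comp (by fun_prop)).continuousOn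
    rw [Filter.EventuallyEq, ae_restrict_iff' measurableSet_Ioi]
    filter_upwards [h0] with ξ h1 h2
    rw [Pi.sub_apply, Pi.zero_apply, ← mul_sub, mul_eq_zero, hk, Set.indicator_of_mem h2] at h1
    exact sub_eq_zero.1 (h1.resolve_left (Complex.exp_ne_zero _))
  have hneg : ∀ s : ℝ, s < 0 → charFun μ s = charFun ν s := by
    intro s hs
    have e : s = -(2 * Real.pi * (-s / (2 * Real.pi))) := by field_simp
    have h1 : -s / (2 * Real.pi) ∈ Set.Ioi (0 : ℝ) := div_pos (neg_pos.2 hs) (by positivity)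
    have h2 := hpos h1
    simp only at h2
    rwa [← e] at h2
  have hne : Set.EqOn (charFun μ) (charFun ν) {0}ᶜ := by
    intro s hs
    rcases lt_or_gt_of_ne hs with h1 | h1
    · exact hneg s h1
    · rw [← neg_neg s, charFun_neg, hneg (-s) (neg_lt_zero.2 h1), ← charFun_neg]
  exact Measure.ext_of_charFun (continuous_charFun.ext_on (dense_compl_singleton 0)
    continuous_charFun hne)

/-! ### Symmetric operators with a resolvent -/

section Symmetric

variable {E : Type*} [NormedAddCommGroup E] [InnerProductSpace ℂ E]

theorem eq_zero_of_symmetric {A : E →ₗ.[ℂ] E}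
    (hA : ∀ x y : A.domain, inner ℂ (A x) (y : E) = inner ℂ (x : E) (A y)) {z : ℂ} (hz : z.im ≠ 0)
    {φ : A.domain} (h : A φ = z • (φ : E)) : (φ : E) = 0 := by
  have e := hA φ φ
  rw [h, inner_smul_left, inner_smul_right, ← sub_eq_zero, ← sub_mul, mul_eq_zero,
    inner_self_eq_zero] at e
  refine e.resolve_left fun h0 => hz ?_
  have := congrArg Complex.im h0
  simp at this
  linarith

theorem resolvent_unique {A : E →ₗ.[ℂ] E}
    (hA : ∀ x y : A.domain, inner ℂ (A x) (y : E) = inner ℂ (x : E) (A y)) {z : ℂ} (hz : z.im ≠ 0)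
    {φ φ' : A.domain} (h : A φ - z • (φ : E) = A φ' - z • (φ' : E)) : φ = φ' := by
  have e : A (φ - φ') = z • ((φ - φ' : A.domain) : E) := by
    rw [LinearPMap.map_sub, Submodule.coe_sub, smul_sub]
    rw [sub_eq_sub_iff_add_eq_add] at h ⊢
    rw [h, add_comm]
  have := eq_zero_of_symmetric hA hz e
  rwa [Submodule.coe_sub, sub_eq_zero, Subtype.coe_inj] at this

theorem IsSpectralMeasure.unique {A : E →ₗ.[ℂ] E}
    (hA : ∀ x y : A.domain, inner ℂ (A x) (y : E) = inner ℂ (x : E) (A y)) {ψ : E} {μ ν : Measure ℝ}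
    (hμ : IsSpectralMeasure A ψ μ) (hν : IsSpectralMeasure A ψ ν) : μ = ν := by
  have := hμ.finite
  have := hν.finite
  refine measure_eq_of_stieltjes_eq fun z hz => ?_
  obtain ⟨φ, h1, h2⟩ := hμ.cauchy z hz
  obtain ⟨φ', h3, h4⟩ := hν.cauchy z hz
  rw [← h2, ← h4, resolvent_unique hA hz (h1.trans h3.symm)]

/-- Only the zero vector has zero spectral measure: with `φ = (A - i)⁻¹ ψ` the imaginary part of
`⟨ψ, φ⟩ = 0` is `‖φ‖²`. -/
theorem IsSpectralMeasure.eq_zero {A : E →ₗ.[ℂ] E}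
    (hA : ∀ x y : A.domain, inner ℂ (A x) (y : E) = inner ℂ (x : E) (A y)) {ψ : E}
    (h : IsSpectralMeasure A ψ 0) : ψ = 0 := by
  obtain ⟨φ, h1, h2⟩ := h.cauchy Complex.I (by simp)
  rw [integral_zero_measure, ← h1, inner_sub_left, inner_smul_left, Complex.conj_I] at h2
  have h3 := hA φ φ
  have h4 : inner ℂ (A φ) (φ : E) = starRingEnd ℂ (inner ℂ (A φ) (φ : E)) := by
    rw [inner_conj_symm, h3]
  have h5 := congrArg Complex.im h2
  have h6 : (inner ℂ (A φ) (φ : E) : ℂ).im = 0 := Complex.conj_eq_iff_im.1 h4.symm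
  rw [inner_self_eq_norm_sq_to_K] at h5
  simp [h6] at h5
  have h7 : (φ : E) = 0 := by
    simpa [← Complex.ofReal_pow] using h5
  rw [← h1, show φ = 0 from Subtype.ext h7]
  simp

/-- A symmetric operator `A` such that `A - z` is onto for all nonreal `z` is self-adjoint. -/
theorem isSelfAdjoint_of_surjective [CompleteSpace E] {A : E →ₗ.[ℂ] E}
    (hA : ∀ x y : A.domain, inner ℂ (A x) (y : E) = inner ℂ (x : E) (A y))
    (hs : ∀ z : ℂ, z.im ≠ 0 → ∀ ψ, ∃ φ : A.domain, A φ - z • (φ : E) = ψ) : IsSelfAdjoint A := by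
  have hI : Complex.I.im ≠ 0 := by simp
  have hI' : (-Complex.I).im ≠ 0 := by simp
  have hd : Dense (A.domain : Set E) := by
    rw [Submodule.dense_iff_topologicalClosure_eq_top, Submodule.topologicalClosure_eq_top_iff,
      Submodule.eq_bot_iff]
    intro ψ hψ
    obtain ⟨φ, hφ⟩ := hs Complex.I hI ψ
    have h0 : ∀ x : A.domain, inner ℂ (x : E) ψ = 0 := fun x => hψ x x.2
    obtain ⟨x, hx⟩ := hs (-Complex.I) hI' φ
    have h1 : inner ℂ (A x - -Complex.I • (x : E)) (φ : E) = inner ℂ (x : E) ψ := by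
      rw [← hφ, inner_sub_left, inner_sub_right, inner_smul_left, inner_smul_right, hA]
      simp
    rw [hx, h0, inner_self_eq_zero] at h1
    have h2 : φ = 0 := Subtype.ext h1
    rw [← hφ, h2, LinearPMap.map_zero, Submodule.coe_zero, smul_zero, sub_zero]
  rw [LinearPMap.isSelfAdjoint_def]
  have hle : A ≤ A.adjoint := LinearPMap.IsFormalAdjoint.le_adjoint hd fun x y => hA x y
  refine (LinearPMap.eq_of_le_of_domain_eq hle (le_antisymm hle.1 fun y hy => ?_)).symm
  obtain ⟨φ, hφ⟩ := hs Complex.I hI (A.adjoint ⟨y, hy⟩ - Complex.I • y)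
  obtain ⟨x, hx⟩ := hs (-Complex.I) hI' (y - φ)
  have h1 : inner ℂ (A.adjoint ⟨y, hy⟩) (x : E) = inner ℂ y (A x) :=
    LinearPMap.adjoint_isFormalAdjoint hd ⟨y, hy⟩ x
  have h2 : inner ℂ (y - (φ : E)) (A x - -Complex.I • (x : E)) = 0 := by
    have h3 : inner ℂ y (A x - -Complex.I • (x : E)) =
        inner ℂ (A.adjoint ⟨y, hy⟩ - Complex.I • y) (x : E) := by
      rw [inner_sub_left, inner_sub_right, inner_smul_left, inner_smul_right, h1]
      simp
    have h4 : inner ℂ (φ : E) (A x - -Complex.I • (x : E)) =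
        inner ℂ (A φ - Complex.I • (φ : E)) (x : E) := by
      rw [inner_sub_left, inner_sub_right, inner_smul_left, inner_smul_right, hA]
      simp
    rw [inner_sub_left, h3, h4, hφ, sub_self]
  rw [hx, inner_self_eq_zero, sub_eq_zero] at h2
  rw [h2]
  exact φ.2

end Symmetric

/-! ### Operators with purely absolutely continuous part and finitely many eigenvalues -/

section Model

variable {E : Type*} [NormedAddCommGroup E] [InnerProductSpace ℂ E]

/-- The spectral properties of an unbounded operator `D` with purely absolutely continuous
spectrum `[0, ∞)`. -/
structure IsHalfLineOperator (D : E →ₗ.[ℂ] E) : Prop where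
  resolvent : ∀ z : ℂ, z ∉ (fun t : ℝ => (t : ℂ)) '' Set.Ici 0 → ∃ d : ℝ, 0 < d ∧
    (∀ ψ, ∃ φ : D.domain, D φ - z • (φ : E) = ψ) ∧
    ∀ φ : D.domain, d * ‖(φ : E)‖ ≤ ‖D φ - z • (φ : E)‖
  approx : ∀ t : ℝ, 0 ≤ t → ∀ ε : ℝ, 0 < ε →
    ∃ φ : D.domain, (φ : E) ≠ 0 ∧ ‖D φ - (t : ℂ) • (φ : E)‖ ≤ ε * ‖(φ : E)‖
  eq_zero : ∀ (z : ℂ) (φ : D.domain), D φ - z • (φ : E) = 0 → (φ : E) = 0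
  exists_measure : ∀ ψ, ∃ μ : Measure ℝ, IsSpectralMeasure D ψ μ ∧ μ ≪ volume

/-- The symmetric operator `A` is the orthogonal sum of the copy `V D V*` of the operator `D` and of
the diagonal operator with eigenvalues `ev i` and orthonormal eigenvectors `e i`. -/
structure SpectralModel {ι : Type*} [Fintype ι] (A D : E →ₗ.[ℂ] E) (V : E →ₗᵢ[ℂ] E) (e : ι → E)
    (ev : ι → ℝ) : Prop where
  symmetric : ∀ x y : A.domain, inner ℂ (A x) (y : E) = inner ℂ (x : E) (A y)
  apply_isometry : ∀ h : D.domain, ∃ hm, A ⟨V h, hm⟩ = V (D h)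
  apply_eigenvector : ∀ i, ∃ hm, A ⟨e i, hm⟩ = (ev i : ℂ) • e i
  inner_eq_zero : ∀ h i, inner ℂ (V h) (e i) = 0
  orthonormal : Orthonormal ℂ e
  exists_eq : ∀ f, ∃ h, ∃ c : ι → ℂ, f = V h + ∑ i, c i • e i

theorem mem_eigenspace_iff {A : E →ₗ.[ℂ] E} {z : ℂ} {f : E} :
    f ∈ eigenspace A z ↔ ∃ hm, A ⟨f, hm⟩ = z • f := by
  simp only [eigenspace, Submodule.mem_map, LinearMap.mem_ker]
  constructor
  · rintro ⟨φ, h, rfl⟩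
    exact ⟨φ.2, sub_eq_zero.1 h⟩
  · rintro ⟨hm, h⟩
    exact ⟨⟨f, hm⟩, sub_eq_zero.2 h, rfl⟩

theorem spectrumOn_zero (A : E →ₗ.[ℂ] E) : spectrumOn A {0} = ∅ := by
  ext z
  simp only [spectrumOn, Set.mem_ofPred_eq, Set.mem_empty_iff_false, iff_false, not_not]
  refine ⟨?_, 0, ?_⟩
  · rintro ψ rfl
    refine ⟨0, ⟨by simp, by simp⟩, ?_⟩
    rintro φ ⟨h, -⟩
    exact Subtype.ext h
  · intro φ h
    rw [Set.mem_singleton_iff.1 h]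
    simp

theorem isSpectralMeasure_zero (A : E →ₗ.[ℂ] E) : IsSpectralMeasure A 0 0 :=
  ⟨inferInstance, fun z _ => ⟨0, by simp, by simp⟩⟩

namespace SpectralModel

variable {ι : Type*} [Fintype ι] {A D : E →ₗ.[ℂ] E} {V : E →ₗᵢ[ℂ] E} {e : ι → E} {ev : ι → ℝ}

/-- The component along `e i` vanishes when the spectral measure has no mass at `ev i`. -/
theorem coeff_eq_zero_of_measure_singleton {μ : Measure ℝ} {c : ι → ℂ} {i : ι}
    (h : (μ + ∑ i, ENNReal.ofReal (‖c i‖ ^ 2) • Measure.dirac (ev i)) {ev i} = 0) : c i = 0 := by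
  rw [Measure.add_apply, add_eq_zero, Measure.finsetSum_apply, Finset.sum_eq_zero_iff] at h
  have h1 := h.2 i (Finset.mem_univ i)
  rw [Measure.smul_apply, Measure.dirac_apply_of_mem (Set.mem_singleton _), smul_eq_mul, mul_one,
    ENNReal.ofReal_eq_zero] at h1
  simpa using le_antisymm h1 (by positivity)

section

variable (H : SpectralModel A D V e ev)
include H

theorem inner_add (h h' : E) (c c' : ι → ℂ) :
    inner ℂ (V h + ∑ i, c i • e i) (V h' + ∑ i, c' i • e i) =
      inner ℂ h h' + ∑ i, starRingEnd ℂ (c i) * c' i := by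
  have h1 : ∀ (h : E) (c : ι → ℂ), inner ℂ (V h) (∑ i, c i • e i) = 0 := fun h c => by
    simp [H.inner_eq_zero]
  rw [inner_add_left, inner_add_right, inner_add_right, h1, V.inner_map_map, H.orthonormal.inner_sum,
    ← inner_conj_symm (∑ i, c i • e i) (V h'), h1]
  simp

theorem norm_sq_add (h : E) (c : ι → ℂ) :
    ‖V h + ∑ i, c i • e i‖ ^ 2 = ‖h‖ ^ 2 + ∑ i, ‖c i‖ ^ 2 := by
  have h1 := H.inner_add h h c c
  simp only [inner_self_eq_norm_sq_to_K, Complex.conj_mul'] at h1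
  refine Complex.ofReal_injective ?_
  push_cast
  exact h1

theorem norm_le_left (h : E) (c : ι → ℂ) : ‖h‖ ≤ ‖V h + ∑ i, c i • e i‖ := by
  refine le_of_sq_le_sq ?_ (norm_nonneg _)
  rw [H.norm_sq_add]
  exact le_add_of_nonneg_right (Finset.sum_nonneg fun i _ => by positivity)

theorem norm_le_coeff (h : E) (c : ι → ℂ) (i : ι) : ‖c i‖ ≤ ‖V h + ∑ i, c i • e i‖ := by
  refine le_of_sq_le_sq ?_ (norm_nonneg _)
  rw [H.norm_sq_add]
  have := Finset.single_le_sum (f := fun i => ‖c i‖ ^ 2) (fun i _ => by positivity) (Finset.mem_univ i)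
  exact this.trans (le_add_of_nonneg_left (by positivity))

theorem eq_zero_of_add_eq_zero {h : E} {c : ι → ℂ} (h0 : V h + ∑ i, c i • e i = 0) :
    h = 0 ∧ ∀ i, c i = 0 := by
  refine ⟨norm_le_zero_iff.1 ?_, fun i => norm_le_zero_iff.1 ?_⟩
  · simpa [h0] using H.norm_le_left h c
  · simpa [h0] using H.norm_le_coeff h c i

theorem apply_add (h : D.domain) (c : ι → ℂ) :
    ∃ hm, ∀ z : ℂ, A ⟨V h + ∑ i, c i • e i, hm⟩ - z • (V h + ∑ i, c i • e i) =
      V (D h - z • (h : E)) + ∑ i, ((ev i - z) * c i) • e i := by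
  obtain ⟨hV, h1⟩ := H.apply_isometry h
  choose he h2 using H.apply_eigenvector
  have e0 : V (h : E) + ∑ i, c i • e i =
      ((⟨V h, hV⟩ + ∑ i, c i • ⟨e i, he i⟩ : A.domain) : E) := by simp
  refine ⟨e0 ▸ Subtype.property _, fun z => ?_⟩
  have e1 : A ⟨V h + ∑ i, c i • e i, e0 ▸ Subtype.property _⟩ =
      A (⟨V h, hV⟩ + ∑ i, c i • ⟨e i, he i⟩) := by
    congr 1
    exact Subtype.ext e0
  have e2 : A (∑ i, c i • ⟨e i, he i⟩) = ∑ i, c i • A ⟨e i, he i⟩ := by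
    change A.toFun _ = _
    rw [map_sum]
    simp only [map_smul]
    rfl
  rw [e1, LinearPMap.map_add, e2, h1]
  simp only [h2, map_sub, map_smul, smul_add, Finset.smul_sum, sub_mul, sub_smul,
    Finset.sum_sub_distrib, smul_smul, mul_comm (c _)]
  abel

theorem exists_sub_eq {z : ℂ} (hz : ∀ ψ, ∃ φ : D.domain, D φ - z • (φ : E) = ψ)
    (hev : ∀ i, (ev i : ℂ) ≠ z) (ψ : E) : ∃ φ : A.domain, A φ - z • (φ : E) = ψ := by
  obtain ⟨h, c, rfl⟩ := H.exists_eq ψ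
  obtain ⟨g, rfl⟩ := hz h
  obtain ⟨hm, h1⟩ := H.apply_add g fun i => (ev i - z)⁻¹ * c i
  refine ⟨_, (h1 z).trans ?_⟩
  simp only [mul_inv_cancel_left₀ (sub_ne_zero.2 (hev _))]

theorem surjective_of_im_ne_zero (hD : IsHalfLineOperator D) {z : ℂ} (hz : z.im ≠ 0) (ψ : E) :
    ∃ φ : A.domain, A φ - z • (φ : E) = ψ := by
  obtain ⟨d, -, h, -⟩ := hD.resolvent z (by rintro ⟨t, -, rfl⟩; simp at hz)
  exact H.exists_sub_eq h (fun i hi => hz (by simp [← hi])) ψ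

/-- The domain of `A` consists of the vectors whose component in the range of `V` comes from the
domain of `D`. -/
theorem exists_domain_eq (hD : IsHalfLineOperator D) (φ : A.domain) :
    ∃ h : D.domain, ∃ c : ι → ℂ, (φ : E) = V h + ∑ i, c i • e i ∧
      ∀ z : ℂ, A φ - z • (φ : E) = V (D h - z • (h : E)) + ∑ i, ((ev i - z) * c i) • e i := by
  have hI : Complex.I.im ≠ 0 := by simp
  obtain ⟨d, -, hd, -⟩ := hD.resolvent Complex.I (by rintro ⟨t, -, ht⟩; simp [← ht] at hI)
  obtain ⟨h, c, hc⟩ := H.exists_eq (A φ - Complex.I • (φ : E))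
  obtain ⟨g, rfl⟩ := hd h
  obtain ⟨hm, h1⟩ := H.apply_add g fun i => (ev i - Complex.I)⁻¹ * c i
  -- both sides have the same image under the injective operator `A - i`
  have h2 : φ = ⟨_, hm⟩ := by
    refine resolvent_unique H.symmetric hI (hc.trans ((h1 _).trans ?_).symm)
    have hev : ∀ i, (ev i : ℂ) - Complex.I ≠ 0 := fun i h0 => by
      simpa using congrArg Complex.im h0
    simp only [mul_inv_cancel_left₀ (hev _)]
  exact ⟨g, _, by rw [h2], fun z => by rw [h2]; exact h1 z⟩

theorem isSelfAdjoint [CompleteSpace E] (hD : IsHalfLineOperator D) : IsSelfAdjoint A :=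
  isSelfAdjoint_of_surjective H.symmetric fun _ hz => H.surjective_of_im_ne_zero hD hz

/-! ### The spectra of the model -/

theorem pointSpectrum_eq (hD : IsHalfLineOperator D) :
    pointSpectrum A = Set.range fun i => (ev i : ℂ) := by
  ext z
  simp only [pointSpectrum, Set.mem_ofPred_eq, Set.mem_range]
  constructor
  · intro h
    by_contra! hz
    refine h (Submodule.eq_bot_iff _ |>.2 fun f hf => ?_)
    obtain ⟨hm, h1⟩ := mem_eigenspace_iff.1 hf
    obtain ⟨g, c, h2, h3⟩ := H.exists_domain_eq hD ⟨f, hm⟩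
    have h4 := H.eq_zero_of_add_eq_zero ((h3 z).symm.trans (sub_eq_zero.2 h1))
    have hc : ∀ i, c i = 0 := fun i => (mul_eq_zero.1 (h4.2 i)).resolve_left (sub_ne_zero.2 (hz i))
    change f = _ at h2
    rw [h2, hD.eq_zero z g h4.1]
    simp [hc]
  · rintro ⟨i, rfl⟩ h
    have h1 : e i ∈ eigenspace A (ev i) := mem_eigenspace_iff.2 (H.apply_eigenvector i)
    rw [h, Submodule.mem_bot] at h1
    exact H.orthonormal.ne_zero i h1

theorem finrank_eigenspace (hD : IsHalfLineOperator D) (hev : Function.Injective ev) (i : ι) :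
    Module.finrank ℂ (eigenspace A (ev i)) = 1 := by
  have : eigenspace A (ev i) = Submodule.span ℂ {e i} := by
    apply le_antisymm
    · intro f hf
      obtain ⟨hm, h1⟩ := mem_eigenspace_iff.1 hf
      obtain ⟨g, c, h2, h3⟩ := H.exists_domain_eq hD ⟨f, hm⟩
      have h4 := H.eq_zero_of_add_eq_zero ((h3 (ev i)).symm.trans (sub_eq_zero.2 h1))
      have hc : ∀ j, j ≠ i → c j = 0 := fun j hj => by
        refine (mul_eq_zero.1 (h4.2 j)).resolve_left (sub_ne_zero.2 fun h0 => hj (hev ?_))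
        exact_mod_cast h0
      change f = _ at h2
      rw [h2, hD.eq_zero _ g h4.1, map_zero, zero_add, Finset.sum_eq_single i
        (fun j _ hj => by rw [hc j hj, zero_smul]) (by simp)]
      exact Submodule.smul_mem _ _ (Submodule.mem_span_singleton_self _)
    · rw [Submodule.span_singleton_le_iff_mem]
      exact mem_eigenspace_iff.2 (H.apply_eigenvector i)
  rw [this]
  exact finrank_span_singleton (H.orthonormal.ne_zero i)

/-- On the range of `V`, the operator `A - t` is not bounded below when `t ≥ 0`. -/
theorem exists_lt_norm (hD : IsHalfLineOperator D) {t : ℝ} (ht : 0 ≤ t) (C : ℝ) :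
    ∃ h, ∃ hm, C * ‖A ⟨V h, hm⟩ - (t : ℂ) • V h‖ < ‖V h‖ := by
  obtain ⟨φ, h1, h2⟩ := hD.approx t ht (|C| + 1)⁻¹ (by positivity)
  obtain ⟨hm, h3⟩ := H.apply_isometry φ
  refine ⟨φ, hm, ?_⟩
  rw [h3, ← map_smul, ← map_sub, V.norm_map, V.norm_map]
  have h4 : 0 < ‖(φ : E)‖ := norm_pos_iff.2 h1
  have h5 : |C| * (|C| + 1)⁻¹ < 1 := by
    rw [← div_eq_mul_inv, div_lt_one (by positivity)]
    exact lt_add_one _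
  calc C * ‖D φ - (t : ℂ) • (φ : E)‖ ≤ |C| * ((|C| + 1)⁻¹ * ‖(φ : E)‖) :=
        mul_le_mul (le_abs_self C) h2 (norm_nonneg _) (abs_nonneg C)
    _ = |C| * (|C| + 1)⁻¹ * ‖(φ : E)‖ := (mul_assoc _ _ _).symm
    _ < ‖(φ : E)‖ := mul_lt_of_lt_one_left h4 h5

theorem spectrumOn_univ (hD : IsHalfLineOperator D) : spectrumOn A Set.univ =
    (fun t : ℝ => (t : ℂ)) '' Set.Ici 0 ∪ Set.range fun i => (ev i : ℂ) := by
  ext z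
  simp only [spectrumOn, Set.mem_ofPred_eq, Set.mem_univ, true_and, forall_true_left]
  constructor
  · contrapose!
    intro hz
    rw [Set.mem_union, not_or] at hz
    obtain ⟨d, hd, hs, hn⟩ := hD.resolvent z hz.1
    have hev : ∀ i, (ev i : ℂ) - z ≠ 0 := fun i h => hz.2 ⟨i, sub_eq_zero.1 h⟩
    -- the norms of the resolvent on the range of `V` and on the lines `ℂ e i`, added up
    have hb : ∀ φ : A.domain,
        ‖(φ : E)‖ ≤ (d⁻¹ + ∑ i, ‖(ev i : ℂ) - z‖⁻¹) * ‖A φ - z • (φ : E)‖ := by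
      intro φ
      obtain ⟨g, c, h2, h3⟩ := H.exists_domain_eq hD φ
      have h4 : ‖(g : E)‖ ≤ d⁻¹ * ‖A φ - z • (φ : E)‖ := by
        rw [inv_mul_eq_div, le_div_iff₀' hd, h3]
        exact (hn g).trans (H.norm_le_left _ _)
      have h5 : ∀ i, ‖c i‖ ≤ ‖(ev i : ℂ) - z‖⁻¹ * ‖A φ - z • (φ : E)‖ := by
        intro i
        rw [inv_mul_eq_div, le_div_iff₀' (norm_pos_iff.2 (hev i)), h3, ← norm_mul]
        exact H.norm_le_coeff _ (fun i => (ev i - z) * c i) i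
      have h6 : ‖(φ : E)‖ ≤ ‖V (g : E)‖ + ‖∑ i, c i • e i‖ := h2 ▸ norm_add_le _ _
      rw [add_mul, Finset.sum_mul]
      refine h6.trans (add_le_add ?_ ?_)
      · rwa [V.norm_map]
      · refine norm_sum_le_of_le _ fun i _ => ?_
        rw [norm_smul, H.orthonormal.norm_eq_one, mul_one]
        exact h5 i
    refine ⟨fun ψ => ?_, _, hb⟩
    obtain ⟨φ, hφ⟩ := H.exists_sub_eq hs (fun i => sub_ne_zero.1 (hev i)) ψ
    refine ⟨φ, hφ, fun φ' hφ' => ?_⟩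
    have h1 : A (φ' - φ) - z • ((φ' - φ : A.domain) : E) = 0 := by
      rw [LinearPMap.map_sub, Submodule.coe_sub, smul_sub, sub_sub_sub_comm, hφ, hφ', sub_self]
    have h2 := hb (φ' - φ)
    rw [h1, norm_zero, mul_zero, norm_le_zero_iff, Submodule.coe_sub, sub_eq_zero] at h2
    exact Subtype.ext h2
  · rintro (⟨t, ht, rfl⟩ | ⟨i, rfl⟩) ⟨h1, C, hC⟩
    · obtain ⟨φ, hm, h2⟩ := H.exists_lt_norm hD ht C
      exact h2.not_ge (hC ⟨V φ, hm⟩)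
    · obtain ⟨hm, h2⟩ := H.apply_eigenvector i
      have h3 := (h1 0).unique (y₁ := ⟨e i, hm⟩) (y₂ := 0) (by simp [h2]) (by simp)
      exact H.orthonormal.ne_zero i (congrArg Subtype.val h3)

theorem spectrumOn_range (hD : IsHalfLineOperator D) :
    spectrumOn A (Set.range V) = (fun t : ℝ => (t : ℂ)) '' Set.Ici 0 := by
  ext z
  simp only [spectrumOn, Set.mem_ofPred_eq]
  constructor
  · contrapose!
    intro hz
    obtain ⟨d, hd, hs, hn⟩ := hD.resolvent z hz
    have hb : ∀ φ : A.domain, (φ : E) ∈ Set.range V →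
        ‖(φ : E)‖ ≤ d⁻¹ * ‖A φ - z • (φ : E)‖ := by
      rintro φ ⟨h, hφ⟩
      obtain ⟨g, c, h2, h3⟩ := H.exists_domain_eq hD φ
      have h4 : V ((g : E) - h) + ∑ i, c i • e i = 0 := by
        rw [map_sub, hφ, h2]
        abel
      have h5 : (g : E) = h := sub_eq_zero.1 (H.eq_zero_of_add_eq_zero h4).1
      rw [inv_mul_eq_div, le_div_iff₀' hd, h3, ← hφ, V.norm_map, ← h5]
      exact (hn g).trans (H.norm_le_left _ _)
    refine ⟨?_, _, hb⟩
    rintro _ ⟨h, rfl⟩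
    obtain ⟨g, rfl⟩ := hs h
    obtain ⟨hm, h1⟩ := H.apply_isometry g
    refine ⟨⟨V g, hm⟩, ⟨⟨g, rfl⟩, by rw [h1, map_sub, map_smul]⟩, ?_⟩
    rintro φ' ⟨⟨h', h2⟩, h3⟩
    have h4 : A (φ' - ⟨V g, hm⟩) - z • ((φ' - ⟨V g, hm⟩ : A.domain) : E) = 0 := by
      rw [LinearPMap.map_sub, Submodule.coe_sub, smul_sub, sub_sub_sub_comm, h3, h1, map_sub, map_smul,
        sub_self]
    have h5 := hb (φ' - ⟨V g, hm⟩) ⟨h' - g, by rw [map_sub, h2, Submodule.coe_sub]⟩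
    rw [h4, norm_zero, mul_zero, norm_le_zero_iff, Submodule.coe_sub, sub_eq_zero] at h5
    exact Subtype.ext h5
  · rintro ⟨t, ht, rfl⟩ ⟨-, C, hC⟩
    obtain ⟨φ, hm, h2⟩ := H.exists_lt_norm hD ht C
    exact h2.not_ge (hC ⟨V φ, hm⟩ ⟨φ, rfl⟩)

/-! ### The spectral measures of the model -/

/-- The spectral measure at `V h + ∑ cᵢ eᵢ` is that of `D` at `h` plus the atoms `|cᵢ|² δ_{ev i}`. -/
theorem isSpectralMeasure_add {h : E} {μ : Measure ℝ} (hμ : IsSpectralMeasure D h μ) (c : ι → ℂ) :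
    IsSpectralMeasure A (V h + ∑ i, c i • e i)
      (μ + ∑ i, ENNReal.ofReal (‖c i‖ ^ 2) • Measure.dirac (ev i)) := by
  have := hμ.finite
  have hfin : ∀ i, IsFiniteMeasure (ENNReal.ofReal (‖c i‖ ^ 2) • Measure.dirac (ev i)) := fun i =>
    ⟨by simp⟩
  refine ⟨⟨?_⟩, fun z hz => ?_⟩
  · simp [ENNReal.sum_lt_top]
  · obtain ⟨g, h1, h2⟩ := hμ.cauchy z hz
    obtain ⟨hm, h3⟩ := H.apply_add g fun i => (ev i - z)⁻¹ * c i
    have hev : ∀ i, (ev i : ℂ) - z ≠ 0 := fun i h0 => hz (by simpa using congrArg Complex.im h0)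
    refine ⟨_, (h3 z).trans ?_, ?_⟩
    · simp only [mul_inv_cancel_left₀ (hev _), h1]
    · rw [H.inner_add, h2, integral_add_measure (integrable_resolvent μ hz)
        (integrable_finsetSum_measure.2 fun i _ => integrable_resolvent _ hz),
        integral_finsetSum_measure fun i _ => integrable_resolvent _ hz]
      congr 2 with i
      rw [integral_smul_measure, integral_dirac, ENNReal.toReal_ofReal (by positivity), mul_left_comm,
        Complex.conj_mul', Complex.real_smul, mul_comm]
      push_cast
      rfl

theorem acSubspace_eq (hD : IsHalfLineOperator D) : acSubspace A = Set.range V := by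
  ext ψ
  constructor
  · rintro ⟨ν, h1, h2⟩
    obtain ⟨h, c, rfl⟩ := H.exists_eq ψ
    obtain ⟨μ, h3, -⟩ := hD.exists_measure h
    have h4 := h1.unique H.symmetric (H.isSpectralMeasure_add h3 c)
    have hc : ∀ i, c i = 0 := fun i =>
      coeff_eq_zero_of_measure_singleton (μ := μ) (h4 ▸ h2 Real.volume_singleton)
    exact ⟨h, by simp [hc]⟩
  · rintro ⟨h, rfl⟩
    obtain ⟨μ, h1, h2⟩ := hD.exists_measure h
    have h3 := H.isSpectralMeasure_add h1 0
    simp only [Pi.zero_apply, zero_smul, Finset.sum_const_zero, add_zero, norm_zero, ne_eq,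
      OfNat.ofNat_ne_zero, not_false_eq_true, zero_pow, ENNReal.ofReal_zero] at h3
    exact ⟨μ, h3, h2⟩

theorem scSubspace_eq (hD : IsHalfLineOperator D) : scSubspace A = {0} := by
  ext ψ
  rw [Set.mem_singleton_iff]
  constructor
  · rintro ⟨ν, h1, h2, h3⟩
    obtain ⟨h, c, rfl⟩ := H.exists_eq ψ
    obtain ⟨μ, h4, h5⟩ := hD.exists_measure h
    have h6 := h1.unique H.symmetric (H.isSpectralMeasure_add h4 c)
    have hc : ∀ i, c i = 0 := fun i =>
      coeff_eq_zero_of_measure_singleton (μ := μ) (h6 ▸ h3 (ev i))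
    simp only [hc, norm_zero, ne_eq, OfNat.ofNat_ne_zero, not_false_eq_true, zero_pow,
      ENNReal.ofReal_zero, zero_smul, Finset.sum_const_zero, add_zero] at h6
    subst h6
    rw [Measure.eq_zero_of_absolutelyContinuous_of_mutuallySingular h5 h2] at h1
    exact h1.eq_zero H.symmetric
  · rintro rfl
    exact ⟨0, isSpectralMeasure_zero A, Measure.MutuallySingular.zero_left, by simp⟩

theorem ppSubspace_eq (hD : IsHalfLineOperator D) :
    ppSubspace A = {ψ | ∀ h, inner ℂ (V h) ψ = 0} := by
  ext ψ
  obtain ⟨h, c, rfl⟩ := H.exists_eq ψ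
  rw [Set.mem_ofPred_eq]
  constructor
  · rintro ⟨ν, h1, S, hS, h2⟩
    obtain ⟨μ, h3, h4⟩ := hD.exists_measure h
    rw [h1.unique H.symmetric (H.isSpectralMeasure_add h3 c), Measure.add_apply, add_eq_zero] at h2
    have hμ : μ = 0 := by
      rw [← Measure.measure_univ_eq_zero, ← Set.union_compl_self S]
      exact measure_union_null (h4 (hS.measure_zero volume)) h2.1
    have h5 := H.isSpectralMeasure_add (hμ ▸ h3) 0
    simp only [Pi.zero_apply, zero_smul, Finset.sum_const_zero, add_zero, norm_zero, ne_eq,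
      OfNat.ofNat_ne_zero, not_false_eq_true, zero_pow, ENNReal.ofReal_zero] at h5
    intro g
    rw [h5.eq_zero H.symmetric, zero_add]
    simp [H.inner_eq_zero]
  · intro h1
    have h2 : h = 0 := by
      have h3 := h1 h
      have h4 : inner ℂ (V h) (∑ i, c i • e i) = 0 := by
        simp [H.inner_eq_zero]
      rwa [inner_add_right, V.inner_map_map, h4, add_zero, inner_self_eq_zero] at h3
    refine ⟨_, H.isSpectralMeasure_add (h2 ▸ isSpectralMeasure_zero D) c, Set.range ev,
      Set.countable_range ev, ?_⟩
    simp [Measure.finsetSum_apply]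

end

end SpectralModel

/-- A finite-dimensional subspace invariant under a symmetric operator has an orthonormal basis of
eigenvectors. -/
theorem exists_eigenvectors {A : E →ₗ.[ℂ] E}
    (hA : ∀ x y : A.domain, inner ℂ (A x) (y : E) = inner ℂ (x : E) (A y)) (K : Submodule ℂ E)
    [FiniteDimensional ℂ K] {n : ℕ} (hn : Module.finrank ℂ K = n)
    (hK : ∀ k ∈ K, ∃ hm, A ⟨k, hm⟩ ∈ K) :
    ∃ (e : Fin n → E) (ev : Fin n → ℝ), Orthonormal ℂ e ∧ (∀ i, e i ∈ K) ∧ Monotone ev ∧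
      (∀ i, ∃ hm, A ⟨e i, hm⟩ = (ev i : ℂ) • e i) ∧ ∀ k ∈ K, ∃ c : Fin n → ℂ, k = ∑ i, c i • e i := by
  have hle : K ≤ A.domain := fun k hk => (hK k hk).1
  let T : K →ₗ[ℂ] K := (A.toFun ∘ₗ Submodule.inclusion hle).codRestrict K fun k => (hK k k.2).2
  have hT : T.IsSymmetric := fun x y =>
    hA (Submodule.inclusion hle x) (Submodule.inclusion hle y)
  -- `eigenvalues` lists the eigenvalues in decreasing order
  let b := (hT.eigenvectorBasis hn).reindex Fin.revPerm
  refine ⟨fun i => b i, fun i => hT.eigenvalues hn (Fin.rev i), b.orthonormal.comp_linearIsometry K.subtypeₗᵢ,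
    fun i => (b i).2, fun i j hij => hT.eigenvalues_antitone hn (Fin.rev_le_rev.2 hij), fun i => ?_,
    fun k hk => ⟨fun i => b.repr ⟨k, hk⟩ i, ?_⟩⟩
  · refine ⟨hle (b i).2, ?_⟩
    have h := hT.apply_eigenvectorBasis hn (Fin.rev i)
    have h2 := congrArg Subtype.val h
    simp only [b, OrthonormalBasis.reindex_apply]
    exact h2
  · have h := congrArg Subtype.val (b.sum_repr ⟨k, hk⟩)
    simp only [Submodule.coe_sum, Submodule.coe_smul] at h
    exact h.symm

end Model

/-! ### The spectral model of the Lax operator -/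

theorem exists_pos_le_norm_sub {z : ℂ} (hz : z ∉ (fun t : ℝ => (t : ℂ)) '' Set.Ici 0) :
    ∃ d : ℝ, 0 < d ∧ ∀ ξ : ℝ, 0 ≤ ξ → d ≤ ‖(2 * Real.pi * ξ - z : ℂ)‖ := by
  have hc : IsClosed ((fun t : ℝ => (t : ℂ)) '' Set.Ici 0) :=
    Complex.isometry_ofReal.isClosedEmbedding.isClosedMap _ isClosed_Ici
  refine ⟨_, (hc.notMem_iff_infDist_pos ⟨0, 0, Set.self_mem_Ici, by simp⟩).1 hz, fun ξ hξ => ?_⟩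
  have h : (2 * Real.pi * ξ : ℂ) ∈ (fun t : ℝ => (t : ℂ)) '' Set.Ici 0 :=
    ⟨2 * Real.pi * ξ, Set.mem_Ici.2 (by positivity), by push_cast; ring⟩
  rw [← dist_eq_norm, dist_comm]
  exact Metric.infDist_le_dist_of_mem h

theorem isHalfLineOperator_freeOperator : IsHalfLineOperator freeOperator where
  resolvent z hz := by
    obtain ⟨d, hd, h⟩ := exists_pos_le_norm_sub hz
    refine ⟨d, hd, fun ψ => ?_, norm_opD_sub_ge hd.le h⟩
    obtain ⟨f, hf, -⟩ := exists_opD_sub_eq hd h ψ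
    exact ⟨f, hf⟩
  approx t ht ε hε := exists_norm_opD_sub_le ht hε
  eq_zero z φ h := eq_zero_of_opD_eq_smul h
  exists_measure ψ := ⟨freeSpectralMeasure ψ, isSpectralMeasure_freeOperator ψ,
    freeSpectralMeasure_absolutelyContinuous ψ⟩

section Soliton

variable {Q : ℂ[X]} {u : Lp ℝ 2 (volume : Measure ℝ)}

theorem laxOperator_mem_modelSpace (hQ : LowerMonic Q) (hN : Q.natDegree ≠ 0) (hu : IsSolitonOf u Q)
    {k : hardy} (hk : k ∈ modelSpace Q) : ∃ hm, laxOperator u ⟨k, hm⟩ ∈ modelSpace Q := by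
  obtain ⟨P, hP, hf⟩ := (mem_modelSpace_iff hQ).1 hk
  have hP' := natDegree_lt_of_degree_lt hN hP
  obtain ⟨A, B, hA, hB, h⟩ := hQ.exists_partialFraction hN (R := derivative (conjPoly Q) * P) (by
    refine natDegree_mul_le.trans_lt ?_
    have := natDegree_derivative_le (conjPoly Q)
    rw [natDegree_conjPoly] at this
    omega)
  have hd : (C Complex.I * (B - derivative P)).degree < Q.natDegree := by
    rw [degree_C_mul Complex.I_ne_zero]
    exact (degree_sub_le _ _).trans_lt (max_lt hB (degree_derivative_le.trans_lt hP))
  obtain ⟨g, hg⟩ := inHardy_rational_of_degree_lt hQ hd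
  obtain ⟨hm, h1⟩ := laxOperator_rational hQ hu hN hP hA hB h hf hg
  exact ⟨hm, h1 ▸ (mem_modelSpace_iff hQ).2 ⟨_, hd, hg⟩⟩

/-- The eigenvalues of `L_u` on the model space are negative. -/
theorem eigenvalue_neg (hQ : LowerMonic Q) (hN : Q.natDegree ≠ 0) (hu : IsSolitonOf u Q) {f : hardy}
    (hf : f ∈ modelSpace Q) (h0 : f ≠ 0) {t : ℝ} {hm : f ∈ (laxOperator u).domain}
    (ht : laxOperator u ⟨f, hm⟩ = (t : ℂ) • f) : t < 0 := by
  obtain ⟨P, hP, hf⟩ := (mem_modelSpace_iff hQ).1 hf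
  have h1 := norm_sq_eq_of_eigenvector hQ hN hu hP hf hm ht
  have h2 : 0 < ‖f‖ ^ 2 := by
    have := norm_pos_iff.2 h0
    positivity
  by_contra! h3
  have h4 : 0 ≤ 2 * Real.pi * t * ‖P.coeff (Q.natDegree - 1)‖ ^ 2 := by positivity
  linarith

/-- Two eigenvectors of `L_u` in the model space with the same eigenvalue are proportional: the
combination whose numerator has no term of degree `deg Q - 1` vanishes. -/
theorem exists_smul_eq_smul (hQ : LowerMonic Q) (hN : Q.natDegree ≠ 0) (hu : IsSolitonOf u Q)
    {f g : hardy} (hf : f ∈ modelSpace Q) (hg : g ∈ modelSpace Q) (h0 : g ≠ 0) {t : ℝ}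
    {hmf : f ∈ (laxOperator u).domain} (htf : laxOperator u ⟨f, hmf⟩ = (t : ℂ) • f)
    {hmg : g ∈ (laxOperator u).domain} (htg : laxOperator u ⟨g, hmg⟩ = (t : ℂ) • g) :
    ∃ a b : ℂ, a ≠ 0 ∧ a • f = b • g := by
  obtain ⟨P, hP, hf⟩ := (mem_modelSpace_iff hQ).1 hf
  obtain ⟨R, hR, hg⟩ := (mem_modelSpace_iff hQ).1 hg
  set p := P.coeff (Q.natDegree - 1) with hp
  set r := R.coeff (Q.natDegree - 1) with hr
  have hr0 : r ≠ 0 := by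
    intro h
    have h1 := norm_sq_eq_of_eigenvector hQ hN hu hR hg hmg htg
    rw [← hr, h] at h1
    simp at h1
    exact h0 h1
  refine ⟨r, p, hr0, ?_⟩
  have hC : ∀ (a : ℂ) (P : ℂ[X]), (C a * P).degree ≤ P.degree := fun a P => by
    rw [← smul_eq_C_mul]
    exact degree_smul_le a P
  have hS : (C r * P - C p * R).degree < Q.natDegree :=
    (degree_sub_le _ _).trans_lt (max_lt ((hC _ _).trans_lt hP)
      ((hC _ _).trans_lt hR))
  have hSf : ((r • f - p • g : hardy) : L2) =ᵐ[volume]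
      fun x : ℝ => (C r * P - C p * R).eval (x : ℂ) / Q.eval (x : ℂ) := by
    rw [Submodule.coe_sub, Submodule.coe_smul, Submodule.coe_smul]
    filter_upwards [hf, hg, Lp.coeFn_sub (r • (f : L2)) (p • (g : L2)), Lp.coeFn_smul r (f : L2),
      Lp.coeFn_smul p (g : L2)] with x h1 h2 h3 h4 h5
    simp only [h3, Pi.sub_apply, h4, h5, Pi.smul_apply, h1, h2, eval_sub, eval_mul, eval_C, smul_eq_mul]
    ring
  have hm : r • f - p • g ∈ (laxOperator u).domain :=
    Submodule.sub_mem _ (Submodule.smul_mem _ _ hmf) (Submodule.smul_mem _ _ hmg)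
  have ht : laxOperator u ⟨r • f - p • g, hm⟩ = (t : ℂ) • (r • f - p • g) := by
    have e : (⟨r • f - p • g, hm⟩ : (laxOperator u).domain) = r • ⟨f, hmf⟩ - p • ⟨g, hmg⟩ := rfl
    rw [e, LinearPMap.map_sub, LinearPMap.map_smul, LinearPMap.map_smul, htf, htg, smul_sub,
      smul_comm r, smul_comm p]
  have h1 := norm_sq_eq_of_eigenvector hQ hN hu hS hSf hm ht
  have h2 : (C r * P - C p * R).coeff (Q.natDegree - 1) = 0 := by
    rw [coeff_sub, coeff_C_mul, coeff_C_mul, ← hp, ← hr]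
    ring
  rw [h2, norm_zero, zero_pow two_ne_zero, mul_zero, sq_eq_zero_iff, norm_eq_zero] at h1
  exact sub_eq_zero.1 h1

theorem not_smul_eq_smul_of_orthonormal {E ι : Type*} [NormedAddCommGroup E] [InnerProductSpace ℂ E]
    {e : ι → E} (he : Orthonormal ℂ e) {i j : ι} (hij : i ≠ j) {a b : ℂ} (ha : a ≠ 0) :
    a • e i ≠ b • e j := by
  intro h
  have h1 := congrArg (inner ℂ (e i)) h
  rw [inner_smul_right, inner_smul_right, he.2 hij, inner_self_eq_norm_sq_to_K, he.1 i] at h1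
  simp [ha] at h1

/-- `L_u` is the orthogonal sum of `Θ D Θ*` and of a diagonal operator on the model space. -/
theorem exists_spectralModel (hQ : LowerMonic Q) {N : ℕ} (hd : Q.natDegree = N) (hN : N ≠ 0)
    (hu : IsSolitonOf u Q) : ∃ (e : Fin N → hardy) (ev : Fin N → ℝ), StrictMono ev ∧ (∀ j, ev j < 0) ∧
      SpectralModel (laxOperator u) freeOperator (mulInner hQ) e ev := by
  subst hd
  have := finiteDimensional_modelSpace hQ
  obtain ⟨e, ev, h1, h2, h3, h4, h5⟩ := exists_eigenvectors (laxOperator_symmetric u) (modelSpace Q)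
    (finrank_modelSpace hQ) fun k hk => laxOperator_mem_modelSpace hQ hN hu hk
  refine ⟨e, ev, h3.strictMono_of_injective fun i j hij => ?_, fun j => ?_, ?_⟩
  · by_contra hne
    obtain ⟨hmi, hi⟩ := h4 i
    obtain ⟨hmj, hj⟩ := h4 j
    obtain ⟨a, b, ha, hab⟩ := exists_smul_eq_smul hQ hN hu (h2 i) (h2 j) (h1.ne_zero j) hi (hij ▸ hj)
    exact not_smul_eq_smul_of_orthonormal h1 hne ha hab
  · obtain ⟨hm, h⟩ := h4 j
    exact eigenvalue_neg hQ hN hu (h2 j) (h1.ne_zero j) h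
  · exact
      { symmetric := laxOperator_symmetric u
        apply_isometry := laxOperator_mulInner hQ hu
        apply_eigenvector := h4
        inner_eq_zero := fun h i => h2 i _ ((mem_innerRange_iff hQ).2 ⟨h, rfl⟩)
        orthonormal := h1
        exists_eq := fun f => by
          obtain ⟨h, k, hk, rfl⟩ := exists_mulInner_add_modelSpace hQ f
          obtain ⟨c, rfl⟩ := h5 k hk
          exact ⟨h, c, rfl⟩ }

theorem range_mulInner (hQ : LowerMonic Q) : Set.range (mulInner hQ) = innerRange Q := by
  ext f
  exact (mem_innerRange_iff hQ).symm

theorem setOf_inner_mulInner_eq_zero (hQ : LowerMonic Q) :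
    {ψ | ∀ h, inner ℂ (mulInner hQ h) ψ = 0} = (modelSpace Q : Set hardy) := by
  ext f
  constructor
  · intro hf g hg
    obtain ⟨h, rfl⟩ := (mem_innerRange_iff hQ).1 hg
    exact hf h
  · exact fun hf h => hf _ ((mem_innerRange_iff hQ).2 ⟨h, rfl⟩)

theorem modelSpace_eq_polyQuotients (hQ : LowerMonic Q) :
    (modelSpace Q : Set hardy) = polyQuotients Q.natDegree Q := by
  ext f
  simp only [SetLike.mem_coe, mem_modelSpace_iff hQ, polyQuotients, mem_degreeLT, Set.mem_ofPred_eq]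

end Soliton

end BenjaminOno
end

theorem mainTheorem5 (N : ℕ) (hN : 0 < N)
    (u : MeasureTheory.Lp ℝ 2 (MeasureTheory.volume : MeasureTheory.Measure ℝ))
    (hu : u ∈ BenjaminOno.multiSolitons N) :
    IsSelfAdjoint (BenjaminOno.laxOperator u) ∧
    (∃ ev : Fin N → ℝ, StrictMono ev ∧ (∀ j, ev j < 0) ∧
      BenjaminOno.pointSpectrum (BenjaminOno.laxOperator u) = Set.range (fun j => (ev j : ℂ)) ∧
      ∀ j, Module.finrank ℂ (BenjaminOno.eigenspace (BenjaminOno.laxOperator u) (ev j : ℂ)) = 1) ∧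
    (∃! Q : Polynomial ℂ, BenjaminOno.IsCharPoly N u Q) ∧
    (∀ Q : Polynomial ℂ, BenjaminOno.IsCharPoly N u Q →
      -- both `Θ_u h` with `h ∈ L²₊` and `P / Q_u` with `deg P ≤ N - 1` belong to `L²₊`
      (∀ h : BenjaminOno.hardy, ∃ f : BenjaminOno.hardy, (f : BenjaminOno.L2)
        =ᵐ[MeasureTheory.volume] fun x => BenjaminOno.innerFunction Q x * (h : BenjaminOno.L2) x) ∧
      (∀ P ∈ Polynomial.degreeLT ℂ N, ∃ f : BenjaminOno.hardy, (f : BenjaminOno.L2)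
        =ᵐ[MeasureTheory.volume] fun x : ℝ => P.eval (x : ℂ) / Q.eval (x : ℂ)) ∧
      BenjaminOno.acSubspace (BenjaminOno.laxOperator u) = BenjaminOno.innerRange Q ∧
      BenjaminOno.scSubspace (BenjaminOno.laxOperator u) = {0} ∧
      BenjaminOno.ppSubspace (BenjaminOno.laxOperator u) = BenjaminOno.modelSpace Q ∧
      (BenjaminOno.modelSpace Q : Set BenjaminOno.hardy) = BenjaminOno.polyQuotients N Q) ∧
    BenjaminOno.spectrumOn (BenjaminOno.laxOperator u)
      (BenjaminOno.acSubspace (BenjaminOno.laxOperator u)) =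
        (fun t : ℝ => (t : ℂ)) '' Set.Ici 0 ∧
    BenjaminOno.spectrumOn (BenjaminOno.laxOperator u)
      (BenjaminOno.scSubspace (BenjaminOno.laxOperator u)) = ∅ ∧
    BenjaminOno.spectrumOn (BenjaminOno.laxOperator u) Set.univ =
      BenjaminOno.spectrumOn (BenjaminOno.laxOperator u)
        (BenjaminOno.acSubspace (BenjaminOno.laxOperator u)) ∪
      BenjaminOno.spectrumOn (BenjaminOno.laxOperator u)
        (BenjaminOno.scSubspace (BenjaminOno.laxOperator u)) ∪
      BenjaminOno.pointSpectrum (BenjaminOno.laxOperator u) := by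
  obtain ⟨Q, hQ, hd, hs⟩ := BenjaminOno.exists_isSolitonOf hu
  obtain ⟨e, ev, hmono, hneg, H⟩ := BenjaminOno.exists_spectralModel hQ hd hN.ne' hs
  have hD := BenjaminOno.isHalfLineOperator_freeOperator
  have hchar : BenjaminOno.IsCharPoly N u Q :=
    ⟨hQ.monic, hd, hQ.roots_im_neg, BenjaminOno.szego_eq_of_isSolitonOf hQ hs⟩
  have hac := H.acSubspace_eq hD
  have hsc := H.scSubspace_eq hD
  refine ⟨H.isSelfAdjoint hD, ⟨ev, hmono, hneg, H.pointSpectrum_eq hD,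
    H.finrank_eigenspace hD hmono.injective⟩, ⟨Q, hchar, fun R hR => hR.eq hchar⟩, ?_, ?_, ?_, ?_⟩
  · intro R hR
    obtain rfl : R = Q := hR.eq hchar
    refine ⟨fun h => (BenjaminOno.inHardy_coe h).innerFunction_mul hQ, fun P hP => ?_, ?_, hsc, ?_, ?_⟩
    · exact BenjaminOno.inHardy_rational_of_degree_lt hQ (hd ▸ Polynomial.mem_degreeLT.1 hP)
    · rw [hac, BenjaminOno.range_mulInner]
    · rw [H.ppSubspace_eq hD, BenjaminOno.setOf_inner_mulInner_eq_zero]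
    · rw [BenjaminOno.modelSpace_eq_polyQuotients hQ, hd]
  · rw [hac, H.spectrumOn_range hD]
  · rw [hsc, BenjaminOno.spectrumOn_zero]
  · rw [hac, hsc, H.spectrumOn_range hD, BenjaminOno.spectrumOn_zero, Set.union_empty,
      H.spectrumOn_univ hD, H.pointSpectrum_eq hD]
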